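/- Let $p$ be a prime, $k$ an algebraically closed field of characteristic $p$, $P$ a finite $p$-group and $\mathcal F$ a Frobenius $P$-category, that is: a category whose objects are all the subgroups of $P$, whose morphisms are injective group homomorphisms, which contains all the homomorphisms between subgroups of $P$ induced by conjugation by elements of $P$, and which fulfills the following conditions, where $\mathcal F(Q)$ denotes the group of $\mathcal F$-automorphisms of $Q$ and $\mathcal F_R(Q)$ the group of automorphisms of $Q$ induced by conjugation by the elements of $R\cap N_P(Q)$. 1. If $\varphi:R\to Q$ and $\varphi':T\to Q$ are $\mathcal F$-morphisms and $\psi:R\to T$ is a group homomorphism with $\varphi'\circ\psi=\varphi$, then $\psi$ is an $\mathcal F$-morphism. 2. $\mathcal F_P(P)$ is a Sylow $p$-subgroup of $\mathcal F(P)$. 3. Let $Q\le P$ be such that $\xi(C_P(Q))=C_P(\xi(Q))$ for every $\mathcal F$-morphism $\xi:Q\cdot C_P(Q)\to P$, let $\varphi:Q\to P$ be an $\mathcal F$-morphism and let $\varphi(Q)\le R\le N_P(\varphi(Q))$ be such that $\mathcal F_P(Q)$ contains the action of $\mathcal F_R(\varphi(Q))$ on $Q$ via $\varphi$. Then there is an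 $\mathcal F$-morphism $\zeta:R\to P$ with $\zeta(\varphi(u))=u$ for all $u\in Q$. A subgroup $Q$ of $P$ is *$\mathcal F$-selfcentralizing* if $C_P(\varphi(Q))\subseteq\varphi(Q)$ for every $\mathcal F$-morphism $\varphi:Q\to P$; it is *$\mathcal F$-radical* if moreover $\mathbf O_p(\mathcal F(Q)/\mathcal F_Q(Q))=1$. Let $\mathcal F^{\rm sc}$ and $\mathcal F^{\rm rd}\subseteq\mathcal F^{\rm sc}$ be the full subcategories of $\mathcal F$ over the selfcentralizing and over the radical subgroups. For a category $\mathcal C$, let $\mathbf{ch}^*(\mathcal C)$ be the category whose objects are the functors $\mathfrak q:\Delta_n\to\mathcal C$ ($n\ge 0$, $\Delta_n=\{0<\dots<n\}$), and whose morphisms from $\mathfrak q:\Delta_n\to\mathcal C$ to $\mathfrak r:\Delta_m\to\mathcal C$ are the pairs $(\nu,\delta)$ formed by an order preserving map $\delta:\Delta_m\to\Delta_n$ and a natural isomorphism $\nu:\mathfrak q\circ\delta\cong\mathfrak r$. Let $\mathbf{aut}_{\mathcal C}$ be the functor from $\mathbf{ch}^*(\mathcal C)$ to groups which maps $\mathfrak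 q$ to its group of natural automorphisms, and $(\nu,\delta)$ to $\sigma\mapsto\nu\circ(\sigma*\delta)\circ\nu^{-1}$. Let $k^*\text{-}\mathfrak{Gr}$ be the category of central extensions $1\to k^*\to\hat G\to G\to1$ of finite groups $G$, with the group homomorphisms $\hat G\to\hat G'$ which are compatible with the inclusions of $k^*$ as morphisms. A *lifting* of a functor $\mathbf a$ from a category $\mathcal D$ to groups is a functor $\mathcal D\to k^*\text{-}\mathfrak{Gr}$ together with an identification (a natural isomorphism) of its composition with $\hat G\mapsto G$ with $\mathbf a$. An isomorphism of liftings is a natural isomorphism inducing the identity on $\mathbf a$. A *folded Frobenius $P$-category* is a Frobenius $P$-category $\mathcal F$ endowed with a lifting of $\mathbf{aut}_{\mathcal F^{\rm sc}}$. **Theorem 2.9.** Any lifting $\widehat{\mathbf{aut}}_{\mathcal F^{\rm rd}}:\mathbf{ch}^*(\mathcal F^{\rm rd})\to k^*\text{-}\mathfrak{Gr}$ of $\mathbf{aut}_{\mathcal F^{\rm rd}}$ is the restriction of a lifting $\widehat{\mathbf{aut}}_{\mathcal F^{\rm sc}}:\mathbf{ch}^*(\mathcal F^{\rm sc})\to k^*\text{-}\mathfrak{Gr}$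 of $\mathbf{aut}_{\mathcal F^{\rm sc}}$ (so that $\mathcal F$ with $\widehat{\mathbf{aut}}_{\mathcal F^{\rm sc}}$ is a folded Frobenius $P$-category). This extension is unique up to a unique isomorphism: if $\mathbf L$ is a lifting of $\mathbf{aut}_{\mathcal F^{\rm sc}}$, then any isomorphism of liftings from the restriction of $\mathbf L$ to $\mathbf{ch}^*(\mathcal F^{\rm rd})$ to $\widehat{\mathbf{aut}}_{\mathcal F^{\rm rd}}$ extends to a unique isomorphism of liftings $\mathbf L\cong\widehat{\mathbf{aut}}_{\mathcal F^{\rm sc}}$. -/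

import Mathlib

open CategoryTheory

universe w u v v₁ u₁ v₂ u₂

/-! ## Categories on the subgroups of a finite `p`-group -/

/-- For a homomorphism `φ : D → E` between subgroups of `P` and a subgroup `A` of `P` contained
in `D`, the image `φ(A)`, as a subgroup of `P`. -/
def Subgroup.imageUnder {P : Type u} [Group P] {D E : Subgroup P} (φ : D →* E)
    (A : Subgroup P) : Subgroup P :=
  ((A.subgroupOf D).map φ).map E.subtype

/-- A *divisible `P`-category*: a subcategory of the category of finite groups and injective
homomorphisms, whose objects are all the subgroups of `P`, which contains every homomorphism
induced by conjugation by an element of `P`, and such that the inclusion functors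
`(𝓕)_Q → (iGr)_Q` of the categories of morphisms to `Q` are full. -/
structure DivisibleCategory (P : Type u) [Group P] where
  /-- `Mor Q R` is the set of morphisms from `Q` to `R`. -/
  Mor : ∀ Q R : Subgroup P, Set (Q →* R)
  injective : ∀ {Q R : Subgroup P} {φ : Q →* R}, φ ∈ Mor Q R → Function.Injective φ
  conj_mem : ∀ {Q R : Subgroup P} (x : P) (φ : Q →* R),
    (∀ u : Q, (φ u : P) = x * u * x⁻¹) → φ ∈ Mor Q R
  comp_mem : ∀ {Q R T : Subgroup P} {φ : Q →* R} {ψ : R →* T},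
    φ ∈ Mor Q R → ψ ∈ Mor R T → ψ.comp φ ∈ Mor Q T
  div_mem : ∀ {Q R T : Subgroup P} {φ : R →* Q} {φ' : T →* Q} (ψ : R →* T),
    φ ∈ Mor R Q → φ' ∈ Mor T Q → φ'.comp ψ = φ → ψ ∈ Mor R T

namespace DivisibleCategory

variable {P : Type u} [Group P] (F : DivisibleCategory P)

theorem id_mem (Q : Subgroup P) : MonoidHom.id Q ∈ F.Mor Q Q :=
  F.conj_mem 1 _ (by simp)

/-- The group `𝓕(Q)` of `𝓕`-automorphisms of `Q`, as a subgroup of `Aut(Q)`. -/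
def autGroup (Q : Subgroup P) : Subgroup (MulAut Q) where
  carrier := {σ | σ.toMonoidHom ∈ F.Mor Q Q}
  one_mem' := F.id_mem Q
  mul_mem' := fun ha hb => F.comp_mem hb ha
  inv_mem' := fun {a} ha => F.div_mem _ (F.id_mem Q) ha
    (by ext x; exact congrArg Subtype.val (MulEquiv.apply_symm_apply a x))

/-- The subgroup `𝓕_Q(Q)` of inner automorphisms of `Q` in `𝓕(Q)`. -/
def innGroup (Q : Subgroup P) : Subgroup (F.autGroup Q) :=
  (MulAut.conj : Q →* MulAut Q).range.subgroupOf (F.autGroup Q)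

instance innGroup_normal (Q : Subgroup P) : (F.innGroup Q).Normal where
  conj_mem := by
    rintro ⟨_, hn⟩ ⟨q, rfl⟩ ⟨g, hg⟩
    refine ⟨g q, ?_⟩
    ext x
    simp

/-- `Q` is *fully centralized*: `ξ(C_P(Q)) = C_P(ξ(Q))` for every `𝓕`-morphism
`ξ : Q·C_P(Q) → P`. -/
def FullyCentralized (Q : Subgroup P) : Prop :=
  ∀ ξ : ↥(Q ⊔ Subgroup.centralizer (Q : Set P)) →* (⊤ : Subgroup P),
    ξ ∈ F.Mor (Q ⊔ Subgroup.centralizer (Q : Set P)) ⊤ →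
      Subgroup.imageUnder ξ (Subgroup.centralizer (Q : Set P)) =
        Subgroup.centralizer (Subgroup.imageUnder ξ Q : Set P)

end DivisibleCategory

/-- A *Frobenius `P`-category* on the finite `p`-group `P`. -/
structure FrobeniusCategory (p : ℕ) (P : Type u) [Group P] extends DivisibleCategory P where
  /-- `𝓕_P(P)` is a Sylow `p`-subgroup of `𝓕(P)`. -/
  sylow : ∃ S : Sylow p (toDivisibleCategory.autGroup ⊤),
    (S : Subgroup (toDivisibleCategory.autGroup ⊤)) = toDivisibleCategory.innGroup ⊤
  /-- Let `Q` be fully centralized, `φ : Q → P` a morphism and `φ(Q) ≤ R ≤ N_P(φ(Q))`. If the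
  action of every element of `R` on `φ(Q)` corresponds, via `φ`, to the action on `Q` of an
  element of `N_P(Q)`, then there is a morphism `ζ : R → P` with `ζ(φ(u)) = u` for all
  `u ∈ Q`. -/
  extension : ∀ Q : Subgroup P, toDivisibleCategory.FullyCentralized Q →
    ∀ φ : Q →* (⊤ : Subgroup P), φ ∈ Mor Q ⊤ →
    ∀ R : Subgroup P, Subgroup.imageUnder φ Q ≤ R →
      R ≤ Subgroup.normalizer (Subgroup.imageUnder φ Q : Set P) →
      (∀ r ∈ R, ∃ x ∈ Subgroup.normalizer (Q : Set P), ∀ a b : Q, (b : P) = x * a * x⁻¹ →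
        (φ b : P) = r * φ a * r⁻¹) →
      ∃ ζ : R →* (⊤ : Subgroup P), ζ ∈ Mor R ⊤ ∧
        ∀ (a : Q) (b : R), (b : P) = φ a → (ζ b : P) = a

/-- `O_p(G)`, the largest normal `p`-subgroup of a finite group `G`, as the join of all the
normal `p`-subgroups. -/
def Subgroup.largestNormalPSubgroup (p : ℕ) (G : Type u) [Group G] : Subgroup G :=
  sSup {N : Subgroup G | N.Normal ∧ IsPGroup p N}

namespace FrobeniusCategory

variable {p : ℕ} {P : Type u} [Group P] (F : FrobeniusCategory p P)

/-- The objects of `𝓕`: the subgroups of `P`. -/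
@[ext]
structure Obj (F : FrobeniusCategory p P) where
  carrier : Subgroup P

/-- The category `𝓕`. -/
instance : Category.{u} F.Obj where
  Hom Q R := {φ : Q.carrier →* R.carrier // φ ∈ F.Mor Q.carrier R.carrier}
  id Q := ⟨MonoidHom.id _, F.id_mem _⟩
  comp φ ψ := ⟨ψ.1.comp φ.1, F.comp_mem φ.2 ψ.2⟩

/-- `Q` is *`𝓕`-selfcentralizing*: `C_P(φ(Q)) ⊆ φ(Q)` for every morphism `φ : Q → P`. -/
def selfcentralizing : ObjectProperty F.Obj := fun Q =>
  ∀ φ : Q.carrier →* (⊤ : Subgroup P), φ ∈ F.Mor Q.carrier ⊤ →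
    Subgroup.centralizer (Subgroup.imageUnder φ Q.carrier : Set P) ≤
      Subgroup.imageUnder φ Q.carrier

/-- `Q` is *`𝓕`-radical*: it is `𝓕`-selfcentralizing and `O_p(𝓕(Q)/𝓕_Q(Q)) = 1`. -/
def radical : ObjectProperty F.Obj := fun Q =>
  F.selfcentralizing Q ∧
    Subgroup.largestNormalPSubgroup p (F.autGroup Q.carrier ⧸ F.innGroup Q.carrier) = ⊥

theorem radical_le_selfcentralizing : F.radical ≤ F.selfcentralizing := fun _ h => h.1

/-- `𝓕^sc`, the full subcategory over the selfcentralizing subgroups. -/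
abbrev Sc := F.selfcentralizing.FullSubcategory

/-- `𝓕^rd`, the full subcategory over the radical subgroups. -/
abbrev Rd := F.radical.FullSubcategory

/-- The inclusion functor `𝓕^rd → 𝓕^sc`. -/
abbrev rdToSc : F.Rd ⥤ F.Sc := ObjectProperty.ιOfLE F.radical_le_selfcentralizing

end FrobeniusCategory

/-! ## The proper category of chains of a category -/

/-- A *chain* of `C`: a functor `Δ_n → C` from an ordered simplex `Δ_n = {0 < ⋯ < n}`. -/
structure Chain (C : Type u) [Category.{v} C] where
  dim : ℕ
  functor : Fin (dim + 1) ⥤ C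

namespace Chain

section

variable {C : Type u} [Category.{v} C]

/-- A morphism `(ν, δ) : (q, Δ_n) → (r, Δ_m)` of `ch*(C)`: an order preserving map
`δ : Δ_m → Δ_n` (equivalently, a functor) and a natural isomorphism `ν : q ∘ δ ≅ r`. -/
@[ext]
structure Hom (q r : Chain C) where
  δ : Fin (r.dim + 1) ⥤ Fin (q.dim + 1)
  ν : δ ⋙ q.functor ≅ r.functor

/-- The category `ch*(C)`. -/
instance : Category (Chain C) where
  Hom := Hom
  id q := ⟨𝟭 _, Functor.leftUnitor _⟩
  comp f g := ⟨g.δ ⋙ f.δ,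
    Functor.associator _ _ _ ≪≫ Functor.isoWhiskerLeft g.δ f.ν ≪≫ g.ν⟩
  id_comp f := by
    refine Hom.ext rfl (heq_of_eq ?_)
    ext i
    simp
  comp_id f := by
    refine Hom.ext rfl (heq_of_eq ?_)
    ext i
    simp
  assoc f g h := by
    refine Hom.ext rfl (heq_of_eq ?_)
    ext i
    simp

@[simp] theorem id_δ (q : Chain C) : Hom.δ (𝟙 q) = 𝟭 _ := rfl
@[simp] theorem id_ν (q : Chain C) : Hom.ν (𝟙 q) = Functor.leftUnitor _ := rfl
@[simp] theorem comp_δ {q r s : Chain C} (f : q ⟶ r) (g : r ⟶ s) :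
    Hom.δ (f ≫ g) = g.δ ⋙ f.δ := rfl
@[simp] theorem comp_ν {q r s : Chain C} (f : q ⟶ r) (g : r ⟶ s) :
    Hom.ν (f ≫ g) =
      Functor.associator _ _ _ ≪≫ Functor.isoWhiskerLeft g.δ f.ν ≪≫ g.ν := rfl

/-- The homomorphism `σ ↦ ν ∘ (σ * δ) ∘ ν⁻¹` from the natural automorphisms of `q` to those of `r`
determined by a morphism `(ν, δ) : q → r`. -/
def autMap {q r : Chain C} (f : q ⟶ r) : Aut q.functor →* Aut r.functor where
  toFun σ := f.ν.symm ≪≫ Functor.isoWhiskerLeft f.δ (show q.functor ≅ q.functor from σ) ≪≫ f.ν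
  map_one' := by
    apply Aut.ext
    ext i
    change f.ν.inv.app i ≫ 𝟙 _ ≫ f.ν.hom.app i = 𝟙 _
    simp
  map_mul' σ τ := by
    apply Aut.ext
    ext i
    change f.ν.inv.app i ≫ (τ.hom.app _ ≫ σ.hom.app _) ≫ f.ν.hom.app i =
      (f.ν.inv.app i ≫ τ.hom.app _ ≫ f.ν.hom.app i) ≫
        (f.ν.inv.app i ≫ σ.hom.app _ ≫ f.ν.hom.app i)
    simp

theorem autMap_hom_app {q r : Chain C} (f : q ⟶ r) (σ : Aut q.functor) (i : Fin (r.dim + 1)) :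
    (autMap f σ).hom.app i = f.ν.inv.app i ≫ σ.hom.app (f.δ.obj i) ≫ f.ν.hom.app i := rfl

variable (C) in
/-- The canonical functor `aut_C : ch*(C) → Gr`, mapping a chain `q` to its group of natural
automorphisms (a finite group in the cases considered below). -/
def aut : Chain C ⥤ GrpCat.{v} where
  obj q := GrpCat.of (Aut q.functor)
  map f := GrpCat.ofHom (autMap f)
  map_id q := by
    ext σ i
    change 𝟙 _ ≫ σ.hom.app i ≫ 𝟙 _ = σ.hom.app i
    simp
  map_comp {q r s} f g := by
    ext σ i
    change (autMap (f ≫ g) σ).hom.app i = (autMap g (autMap f σ)).hom.app i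
    simp [autMap_hom_app]

end

section

variable {C : Type u₁} [Category.{v} C] {D : Type u₂} [Category.{v} D]

/-- The functor `ch*(C) → ch*(D)` induced by a functor `C → D`. -/
@[simps obj]
def map (G : C ⥤ D) : Chain C ⥤ Chain D where
  obj q := ⟨q.dim, q.functor ⋙ G⟩
  map f := ⟨f.δ, (Functor.associator _ _ _).symm ≪≫ Functor.isoWhiskerRight f.ν G⟩
  map_id q := by
    refine Hom.ext rfl (heq_of_eq ?_)
    ext i
    simp
  map_comp f g := by
    refine Hom.ext rfl (heq_of_eq ?_)
    ext i
    simp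

theorem map_autMap_hom_app (G : C ⥤ D) {q r : Chain C} (f : q ⟶ r) (σ : Aut q.functor)
    (i : Fin (r.dim + 1)) :
    G.map ((autMap f σ).hom.app i) = ((map G).map f).ν.inv.app i ≫
      G.map (σ.hom.app (f.δ.obj i)) ≫ ((map G).map f).ν.hom.app i := by
  simp [autMap_hom_app, map]

/-- For a fully faithful `G : C → D`, the identification of the natural automorphisms of `G ∘ q`
with those of `q`, for every chain `q` of `C`. -/
noncomputable def mapAut (G : C ⥤ D) [G.Full] [G.Faithful] : map G ⋙ aut D ≅ aut C :=
  (NatIso.ofComponents (fun q => MulEquiv.toGrpIso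
    (((Functor.FullyFaithful.ofFullyFaithful G).whiskeringRight
      (Fin (q.dim + 1))).autMulEquivOfFullyFaithful q.functor))
    (fun f => by
      ext σ
      apply Aut.ext
      ext i
      exact map_autMap_hom_app G f σ i)).symm

end

end Chain

/-! ## Finite `k*`-groups -/

/-- A *finite `k*`-group*: a central extension `1 → k* → Ĝ → G → 1` of a finite group `G`. -/
structure KStarGrp (k : Type w) [Field k] where
  total : Type (max u w)
  base : Type u
  [groupTotal : Group total]
  [groupBase : Group base]
  [finite_base : Finite base]
  incl : kˣ →* total
  proj : total →* base
  incl_injective : Function.Injective incl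
  proj_surjective : Function.Surjective proj
  ker_proj : proj.ker = incl.range
  central : incl.range ≤ Subgroup.center total

namespace KStarGrp

attribute [instance] groupTotal groupBase finite_base

variable {k : Type w} [Field k]

/-- A `k*`-group homomorphism `Ĝ → Ĝ'`, that is to say a group homomorphism which is compatible
with the inclusions of `k*`, together with the homomorphism `G → G'` that it induces. -/
@[ext]
structure Hom (G H : KStarGrp.{w, u} k) where
  toTotal : G.total →* H.total
  toBase : G.base →* H.base
  comp_incl : toTotal.comp G.incl = H.incl
  proj_comp : H.proj.comp toTotal = toBase.comp G.proj

/-- The category `k*-Gr`. -/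
instance : Category (KStarGrp.{w, u} k) where
  Hom := Hom
  id G := ⟨MonoidHom.id _, MonoidHom.id _, rfl, rfl⟩
  comp f g := ⟨g.toTotal.comp f.toTotal, g.toBase.comp f.toBase,
    by rw [MonoidHom.comp_assoc, f.comp_incl, g.comp_incl],
    by rw [← MonoidHom.comp_assoc, g.proj_comp, MonoidHom.comp_assoc, f.proj_comp,
      MonoidHom.comp_assoc]⟩

variable (k) in
/-- The functor `k*-Gr → Gr` mapping a `k*`-group `Ĝ` to its quotient `G = Ĝ/k*`. -/
def quot : KStarGrp.{w, u} k ⥤ GrpCat.{u} where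
  obj G := GrpCat.of G.base
  map f := GrpCat.ofHom f.toBase

end KStarGrp

/-! ## Lifting functors to `k*-Gr` -/

/-- A *lifting* to `k*-Gr` of a functor `A : C → Gr`: a functor `C → k*-Gr` together with an
identification of its composition with `k*-Gr → Gr` with `A`. -/
structure KStarLifting (k : Type w) [Field k] {C : Type u₁} [Category.{v₁} C]
    (A : C ⥤ GrpCat.{u}) where
  functor : C ⥤ KStarGrp.{w, u} k
  iso : functor ⋙ KStarGrp.quot k ≅ A

namespace KStarLifting

variable {k : Type w} [Field k] {C : Type u₁} [Category.{v₁} C] {D : Type u₂} [Category.{v₂} D]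

/-- The morphisms between two liftings of `A` are the natural transformations which lift the
identity of `A`. -/
@[ext]
structure Hom {A : C ⥤ GrpCat.{u}} (L L' : KStarLifting.{w, u} k A) where
  natTrans : L.functor ⟶ L'.functor
  comm : Functor.whiskerRight natTrans (KStarGrp.quot k) ≫ L'.iso.hom = L.iso.hom

instance (A : C ⥤ GrpCat.{u}) : Category (KStarLifting.{w, u} k A) where
  Hom := Hom
  id L := ⟨𝟙 _, by simp⟩
  comp f g := ⟨f.natTrans ≫ g.natTrans,
    by rw [Functor.whiskerRight_comp, Category.assoc, g.comm, f.comm]⟩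

/-- If the restriction of `B : D → Gr` along `J : C → D` is identified with `A : C → Gr`, then
the liftings of `B` restrict to liftings of `A`. -/
@[simps! obj_functor obj_iso]
def restrict (J : C ⥤ D) {B : D ⥤ GrpCat.{u}} {A : C ⥤ GrpCat.{u}} (e : J ⋙ B ≅ A) :
    KStarLifting.{w, u} k B ⥤ KStarLifting.{w, u} k A where
  obj L := ⟨J ⋙ L.functor, Functor.associator _ _ _ ≪≫ Functor.isoWhiskerLeft J L.iso ≪≫ e⟩
  map {L L'} f := ⟨Functor.whiskerLeft J f.natTrans, by
    ext1
    ext1 c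
    have h := NatTrans.congr_app f.comm (J.obj c)
    simp only [NatTrans.comp_app, Functor.whiskerRight_app] at h
    simp [← h]⟩

end KStarLifting

namespace FrobeniusCategory

variable {p : ℕ} {P : Type u} [Group P] (F : FrobeniusCategory p P) (k : Type w) [Field k]

/-- The liftings `ch*(𝓕^rd) → k*-Gr` of `aut_{𝓕^rd}`. -/
abbrev RadicalLifting := KStarLifting.{w, u} k (Chain.aut F.Rd)

/-- The liftings `ch*(𝓕^sc) → k*-Gr` of `aut_{𝓕^sc}`; a Frobenius `P`-category endowed with such
a lifting is a *folded Frobenius `P`-category*. -/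
abbrev Folding := KStarLifting.{w, u} k (Chain.aut F.Sc)

/-- The restriction from `ch*(𝓕^sc)` to `ch*(𝓕^rd)`, and to the identity over the groups
`aut_{𝓕^rd}(q) = 𝓕(q) = aut_{𝓕^sc}(q)`. -/
noncomputable abbrev restrictFolding : F.Folding k ⥤ F.RadicalLifting k :=
  KStarLifting.restrict (Chain.map F.rdToSc) (Chain.mapAut F.rdToSc)

end FrobeniusCategory

-- The problem is moved to the exterior quotient of the category of selfcentralizing subgroups,
-- where morphisms differing by an inner automorphism of the target are identified. There all
-- morphisms are epimorphisms (`epi_ext`). Any `p`-subgroup `W` of `Aut Q` is the stabilizer of a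
-- morphism from `Q` to a usually larger group, through which every morphism stabilized by `W`
-- factors (`exists_ext_quotient`); call it the quotient of `Q` by `W`. Stabilizers of morphisms are
-- `p`-groups, nontrivial unless the morphism is an isomorphism, and the automorphism group of a
-- nonradical object has a nontrivial normal `p`-subgroup.
--
-- A lifting is traded for a transport system: the `k*`-groups of the chains of length zero, with a
-- partial transport along morphisms read off from the chains of length one (`ofLifting`). As `k*`
-- is divisible without `p`-torsion, the inner automorphisms, which form a `p`-group, lift
-- canonically to elements of `p`-power order. Transport along an inner automorphism is conjugation
-- by its lift, so these elements can be divided out and the system descends to the exterior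
-- quotient (`descend`). Nothing is lost: the `k*`-group of a chain is the pullback of the one of
-- its first object (`toLiftingDescend`).
--
-- The extension is a kind of right Kan extension: over an automorphism `a` of `Q` one takes the
-- families of elements, one for each morphism from `Q` to a radical object along which `a` extends,
-- that are compatible with transport. One has to see that a family is determined by any of its
-- values and that every value occurs (`KTransport.resolved`). This goes by descending induction on
-- the order of `Q`. If `Q` is not isomorphic to a radical object, let `S` be its quotient by a
-- nontrivial normal `p`-subgroup `O`; all automorphisms of `Q` extend to `S`. For a morphism `φ`
-- with stabilizer `V`, both `S` and the quotient by `V` map to the quotient by `V·O`. By induction,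
-- restriction between these three larger objects is bijective on families, so a family over `S`
-- prescribes a value at `φ` (`Resolved.of_normal`).
--
-- The extended system is universal (`exists_hom_kan`), which yields the existence of morphisms of
-- liftings; they are unique because every `Q` has a morphism to a radical object along which all
-- its automorphisms extend (`hom_ext_of_res`). Finally the extension is replaced by an isomorphic
-- one that restricts to the given lifting on the nose (`exists_restrict_eq`).

universe m m' u₃

/-! ## Transport systems of `k*`-groups -/

/-- The automorphisms `a` of `X` and `b` of `Y` are intertwined by `φ : X ⟶ Y`. -/
def AutComm {𝓒 : Type u₂} [Category.{v₂} 𝓒] {X Y : 𝓒} (φ : X ⟶ Y) (a : Aut X) (b : Aut Y) : Prop :=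
  a.hom ≫ φ = φ ≫ b.hom

namespace AutComm

variable {𝓒 : Type u₂} [Category.{v₂} 𝓒] {X Y Z : 𝓒} {φ : X ⟶ Y} {ψ : Y ⟶ Z}

theorem one (φ : X ⟶ Y) : AutComm φ 1 1 := by
  change 𝟙 _ ≫ φ = φ ≫ 𝟙 _
  simp

theorem mul {a a' : Aut X} {b b' : Aut Y} (h : AutComm φ a b) (h' : AutComm φ a' b') :
    AutComm φ (a * a') (b * b') := by
  change (a'.hom ≫ a.hom) ≫ φ = φ ≫ b'.hom ≫ b.hom
  rw [Category.assoc, h, ← Category.assoc, h', Category.assoc]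

theorem inv {a : Aut X} {b : Aut Y} (h : AutComm φ a b) : AutComm φ a⁻¹ b⁻¹ := by
  change a.inv ≫ φ = φ ≫ b.inv
  refine (Iso.inv_comp_eq a).2 ?_
  rw [← Category.assoc]
  exact (Iso.eq_comp_inv b).2 h.symm

theorem comp {a : Aut X} {b : Aut Y} {c : Aut Z} (h : AutComm φ a b) (h' : AutComm ψ b c) :
    AutComm (φ ≫ ψ) a c := by
  change a.hom ≫ φ ≫ ψ = (φ ≫ ψ) ≫ c.hom
  rw [← Category.assoc, h, Category.assoc, h', Category.assoc]

theorem id (a : Aut X) : AutComm (𝟙 X) a a := by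
  change a.hom ≫ 𝟙 _ = 𝟙 _ ≫ a.hom
  simp

theorem right_unique [Epi φ] {a : Aut X} {b b' : Aut Y} (h : AutComm φ a b)
    (h' : AutComm φ a b') : b = b' :=
  Aut.ext ((cancel_epi φ).1 (h.symm.trans h'))

theorem of_comp [Epi φ] {a : Aut X} {b : Aut Y} {c : Aut Z} (h : AutComm φ a b)
    (h' : AutComm (φ ≫ ψ) a c) : AutComm ψ b c := by
  change b.hom ≫ ψ = ψ ≫ c.hom
  rw [← cancel_epi φ, ← Category.assoc, ← h, Category.assoc, h', Category.assoc]

end AutComm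

/-- A *transport system*: central extensions by `k*` of the automorphism groups of a family of
objects, with a multiplicative and functorial parallel transport along all the morphisms. -/
structure KTransport (k : Type w) [Field k] {C : Type u₁} {𝓒 : Type u₂} [Category.{v₂} 𝓒]
    (o : C → 𝓒) where
  M : C → Type m
  [grp : ∀ Q, Group (M Q)]
  incl : ∀ Q, kˣ →* M Q
  proj : ∀ Q, M Q →* Aut (o Q)
  incl_injective : ∀ Q, Function.Injective (incl Q)
  proj_surjective : ∀ Q, Function.Surjective (proj Q)
  proj_incl : ∀ Q c, proj Q (incl Q c) = 1
  exists_incl : ∀ {Q x}, proj Q x = 1 → ∃ c, incl Q c = x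
  central : ∀ Q c x, incl Q c * x = x * incl Q c
  rel : ∀ {Q R : C}, (o Q ⟶ o R) → M Q → M R → Prop
  rel_comm : ∀ {Q R} {φ : o Q ⟶ o R} {x y}, rel φ x y → AutComm φ (proj Q x) (proj R y)
  rel_exists : ∀ {Q R} {φ : o Q ⟶ o R} (x : M Q) (b : Aut (o R)), AutComm φ (proj Q x) b →
    ∃ y, proj R y = b ∧ rel φ x y
  rel_mul : ∀ {Q R} {φ : o Q ⟶ o R} {x y x' y'}, rel φ x y → rel φ x' y' →
    rel φ (x * x') (y * y')
  rel_incl : ∀ {Q R} (φ : o Q ⟶ o R) (c : kˣ), rel φ (incl Q c) (incl R c)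
  rel_unique : ∀ {Q R} {φ : o Q ⟶ o R} {c : kˣ}, rel φ 1 (incl R c) → c = 1
  rel_id : ∀ {Q} (x : M Q), rel (𝟙 (o Q)) x x
  rel_comp : ∀ {Q R T} {φ : o Q ⟶ o R} {ψ : o R ⟶ o T} {x y z}, rel φ x y → rel ψ y z →
    rel (φ ≫ ψ) x z

namespace KTransport

attribute [instance] grp

variable {k : Type w} [Field k] {C : Type u₁} {𝓒 : Type u₂} [Category.{v₂} 𝓒]
  {o : C → 𝓒} (D : KTransport.{w, u₁, v₂, u₂, m} k o)

variable {D} {Q R T : C} {φ : o Q ⟶ o R} {ψ : o R ⟶ o T}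

theorem rel_one (φ : o Q ⟶ o R) : D.rel φ 1 1 := by
  simpa using D.rel_incl φ 1

theorem rel_pow {x : D.M Q} {y : D.M R} (h : D.rel φ x y) (n : ℕ) : D.rel φ (x ^ n) (y ^ n) := by
  induction n with
  | zero => simpa using rel_one φ
  | succ n ih => simpa [pow_succ] using D.rel_mul ih h

theorem exists_mul_incl {x x' : D.M Q} (h : D.proj Q x = D.proj Q x') :
    ∃ c, x' = x * D.incl Q c := by
  obtain ⟨c, hc⟩ := D.exists_incl (x := x⁻¹ * x') (by simp [h])
  exact ⟨c, by rw [hc]; simp⟩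

/-- Inverses are not part of the axioms. Transporting `x⁻¹` gives `y⁻¹` up to a scalar, and
multiplying by the pair `x`, `y` relates `1` to that scalar, which is therefore trivial. -/
theorem rel_inv {x : D.M Q} {y : D.M R} (h : D.rel φ x y) : D.rel φ x⁻¹ y⁻¹ := by
  obtain ⟨y', hy', h'⟩ := D.rel_exists (φ := φ) x⁻¹ (D.proj R y⁻¹)
    (by simpa using (D.rel_comm h).inv)
  obtain ⟨c, rfl⟩ := exists_mul_incl hy'.symm
  have := D.rel_mul h h'
  rw [mul_inv_cancel, mul_inv_cancel_left] at this
  rw [D.rel_unique this] at h'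
  simpa using h'

/-- The two candidates differ by a scalar to which `1` is transported, so `rel_unique` applies. -/
theorem rel_right_unique {x : D.M Q} {y y' : D.M R} (h : D.rel φ x y) (h' : D.rel φ x y')
    (hp : D.proj R y = D.proj R y') : y = y' := by
  obtain ⟨c, rfl⟩ := exists_mul_incl hp
  have := D.rel_mul (rel_inv h) h'
  rw [inv_mul_cancel, inv_mul_cancel_left] at this
  rw [D.rel_unique this]
  simp

theorem rel_left_unique {x x' : D.M Q} {y : D.M R} (h : D.rel φ x y) (h' : D.rel φ x' y)
    (hp : D.proj Q x = D.proj Q x') : x = x' := by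
  obtain ⟨c, rfl⟩ := exists_mul_incl hp
  have := rel_right_unique h' (D.rel_mul h (D.rel_incl φ c)) (by simp [D.proj_incl])
  have hc : D.incl R c = 1 := by simpa using this
  have : c = 1 := D.incl_injective R (by simpa using hc)
  simp [this]

/-- Transport can be inverted over a prescribed automorphism: any lift of `a` is transported to `y`
up to a scalar, and scalars can be corrected at the source. -/
theorem exists_left {y : D.M R} {a : Aut (o Q)} (h : AutComm φ a (D.proj R y)) :
    ∃ x, D.proj Q x = a ∧ D.rel φ x y := by
  obtain ⟨x, rfl⟩ := D.proj_surjective Q a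
  obtain ⟨y', hy', h'⟩ := D.rel_exists x _ h
  obtain ⟨c, rfl⟩ := exists_mul_incl hy'
  exact ⟨x * D.incl Q c, by simp [D.proj_incl], D.rel_mul h' (D.rel_incl φ c)⟩

theorem rel_of_comp_left {x : D.M Q} {y : D.M R} {z : D.M T} (h : D.rel φ x y)
    (h' : D.rel (φ ≫ ψ) x z) (hc : AutComm ψ (D.proj R y) (D.proj T z)) : D.rel ψ y z := by
  obtain ⟨z', hz', hr⟩ := D.rel_exists y _ hc
  rwa [rel_right_unique h' (D.rel_comp h hr) hz'.symm]

/-! ### Compatible families -/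

variable (D) in
/-- The families of elements over the extensions of an automorphism `a` of `Q` along the morphisms
from `Q` to the objects of the transport system, compatible with the transport. -/
@[ext]
structure Fam (Q : 𝓒) (a : Aut Q) where
  val : ∀ {R : C} (φ : Q ⟶ o R) (b : Aut (o R)), AutComm φ a b → D.M R
  proj_val : ∀ {R : C} (φ : Q ⟶ o R) (b : Aut (o R)) (h : AutComm φ a b),
    D.proj R (val φ b h) = b
  rel_val : ∀ {R R' : C} (φ : Q ⟶ o R) (b : Aut (o R)) (h : AutComm φ a b) (ψ : o R ⟶ o R')
    (χ : Q ⟶ o R') (b' : Aut (o R')) (h' : AutComm χ a b'), φ ≫ ψ = χ → AutComm ψ b b' →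
    D.rel ψ (val φ b h) (val χ b' h')

namespace Fam

variable {Q N N' : 𝓒} {a : Aut Q} {c : Aut N} {e : Aut N'}

theorem val_congr (x : D.Fam Q a) {R : C} {φ φ' : Q ⟶ o R} {b b' : Aut (o R)} (h : AutComm φ a b)
    (h' : AutComm φ' a b') (hφ : φ = φ') (hb : b = b') : x.val φ b h = x.val φ' b' h' := by
  subst hφ hb; rfl

/-- The restriction of a compatible family along a morphism. -/
@[simps]
def restrict (ν : Q ⟶ N) (hν : AutComm ν a c) (x : D.Fam Q a) : D.Fam N c where
  val φ b h := x.val (ν ≫ φ) b (hν.comp h)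
  proj_val φ b h := x.proj_val _ _ _
  rel_val φ b h ψ χ b' h' e hc := x.rel_val _ _ _ _ _ _ _ (by rw [← e, Category.assoc]) hc

theorem restrict_restrict {ν : Q ⟶ N} {μ : N ⟶ N'} {χ : Q ⟶ N'} (h : ν ≫ μ = χ)
    (hν : AutComm ν a c) (hμ : AutComm μ c e) (hχ : AutComm χ a e) (x : D.Fam Q a) :
    (x.restrict ν hν).restrict μ hμ = x.restrict χ hχ := by
  ext R φ b hb
  exact x.val_congr _ _ (by rw [← h, Category.assoc]) rfl

end Fam

variable (D) in
/-- `Q` is *resolved*: the compatible families over the automorphisms of `Q` form a `k*`-group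
which is determined by any of their values. -/
structure Resolved (Q : 𝓒) : Prop where
  full : ∃ (R : C) (φ : Q ⟶ o R), ∀ a : Aut Q, ∃ b, AutComm φ a b
  inj : ∀ {a : Aut Q} {R : C} (φ : Q ⟶ o R) (b) (h : AutComm φ a b) (x x' : D.Fam Q a),
    x.val φ b h = x'.val φ b h → x = x'
  surj : ∀ {a : Aut Q} {R : C} (φ : Q ⟶ o R) (t : D.M R) (h : AutComm φ a (D.proj R t)),
    ∃ x : D.Fam Q a, x.val φ _ h = t
  mul : ∀ {a a' : Aut Q} (x : D.Fam Q a) (x' : D.Fam Q a'), ∃ y : D.Fam Q (a * a'),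
    ∀ {R : C} (φ : Q ⟶ o R) (b b') (h : AutComm φ a b) (h' : AutComm φ a' b'),
      y.val φ (b * b') (h.mul h') = x.val φ b h * x'.val φ b' h'

namespace Resolved

variable {Q N N' : 𝓒} {a : Aut Q} {c : Aut N} {e : Aut N'}

/-- Evaluating the restriction at `φ` is evaluating the original family at `f ≫ φ`. Since one value
determines a family and can be prescribed, restriction between resolved objects is bijective; this
allows families to be moved backwards along a morphism. -/
theorem restrict_injective (hN : D.Resolved N) (hN' : D.Resolved N') (f : N ⟶ N')
    (hf : AutComm f c e) (x x' : D.Fam N c) (h : x.restrict f hf = x'.restrict f hf) : x = x' := by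
  obtain ⟨R, φ, hφ⟩ := hN'.full
  obtain ⟨b, hb⟩ := hφ e
  refine hN.inj (f ≫ φ) b (hf.comp hb) x x' ?_
  rw [← Fam.restrict_val f hf x φ b hb, h, Fam.restrict_val]

theorem restrict_surjective (hN : D.Resolved N) (hN' : D.Resolved N') (f : N ⟶ N')
    (hf : AutComm f c e) (y : D.Fam N' e) : ∃ x : D.Fam N c, x.restrict f hf = y := by
  obtain ⟨R, φ, hφ⟩ := hN'.full
  obtain ⟨b, hb⟩ := hφ e
  have hc : AutComm (f ≫ φ) c (D.proj R (y.val φ b hb)) := by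
    rw [y.proj_val]; exact hf.comp hb
  obtain ⟨x, hx⟩ := hN.surj (f ≫ φ) (y.val φ b hb) hc
  refine ⟨x, hN'.inj φ b hb _ _ ?_⟩
  rw [Fam.restrict_val, ← hx]
  exact x.val_congr _ _ rfl (y.proj_val _ _ _).symm

/-- Every morphism from `Q` factors through `φ₀`, so a family is the system of all transports of its
value at `φ₀`, and that value is arbitrary. -/
theorem of_isIso [∀ {X Y : 𝓒} (f : X ⟶ Y), Epi f] {R₀ : C} (φ₀ : Q ⟶ o R₀) [IsIso φ₀] :
    D.Resolved Q := by
  have key : ∀ a : Aut Q, ∃ b, AutComm φ₀ a b := fun a =>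
    ⟨(asIso φ₀).symm ≪≫ (show Q ≅ Q from a) ≪≫ asIso φ₀, by
      change a.hom ≫ φ₀ = φ₀ ≫ inv φ₀ ≫ a.hom ≫ φ₀
      simp⟩
  have key2 : ∀ {R : C} (φ : Q ⟶ o R), ∃ ψ : o R₀ ⟶ o R, φ₀ ≫ ψ = φ := fun φ =>
    ⟨inv φ₀ ≫ φ, by simp⟩
  refine ⟨⟨R₀, φ₀, key⟩, ?_, ?_, ?_⟩
  · intro a R φ b h x x' hx
    obtain ⟨b₀, h₀⟩ := key a
    have e₀ : x.val φ₀ b₀ h₀ = x'.val φ₀ b₀ h₀ := by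
      obtain ⟨ψ, rfl⟩ := key2 φ
      have := x.rel_val φ₀ b₀ h₀ ψ _ b h rfl (h₀.of_comp h)
      rw [hx] at this
      exact rel_left_unique this (x'.rel_val φ₀ b₀ h₀ ψ _ b h rfl (h₀.of_comp h))
        (by simp [Fam.proj_val])
    ext R' φ' b' h'
    obtain ⟨ψ, rfl⟩ := key2 φ'
    have := x.rel_val φ₀ b₀ h₀ ψ _ b' h' rfl (h₀.of_comp h')
    rw [e₀] at this
    exact rel_right_unique this (x'.rel_val φ₀ b₀ h₀ ψ _ b' h' rfl (h₀.of_comp h'))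
      (by simp [Fam.proj_val])
  · intro a R φ t h
    obtain ⟨b₀, h₀⟩ := key a
    obtain ⟨ψ, rfl⟩ := key2 φ
    obtain ⟨t₀, rfl, ht₀⟩ := exists_left (h₀.of_comp h)
    -- The factorization of `φ'` through the epimorphism `φ₀` is unique, so the transported value
    -- depends on `φ'` only.
    have ex : ∀ (R' : C) (φ' : Q ⟶ o R') (b' : Aut (o R')), AutComm φ' a b' →
        ∃ t', D.proj R' t' = b' ∧ ∀ ψ' : o R₀ ⟶ o R', φ₀ ≫ ψ' = φ' → D.rel ψ' t₀ t' := by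
      intro R' φ' b' h'
      obtain ⟨ψ', rfl⟩ := key2 φ'
      obtain ⟨t', ht', hr⟩ := D.rel_exists t₀ b' (h₀.of_comp h')
      exact ⟨t', ht', fun ψ'' e => by rwa [(cancel_epi φ₀).1 e]⟩
    choose val hval hrel using ex
    refine ⟨⟨fun {R'} φ' b' h' => val R' φ' b' h', fun {R'} φ' b' h' => hval R' φ' b' h', ?_⟩, ?_⟩
    · intro R₁ R₂ φ₁ b₁ h₁ ψ₁ χ b₂ h₂ e₁ hc
      obtain ⟨χ₁, rfl⟩ := key2 φ₁
      exact rel_of_comp_left (hrel _ _ b₁ h₁ χ₁ rfl)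
        (hrel _ χ b₂ h₂ (χ₁ ≫ ψ₁) (by rw [← e₁, Category.assoc])) (by rwa [hval, hval])
    · exact rel_right_unique (hrel _ _ _ _ ψ rfl) ht₀ (hval _ _ _ _)
  · intro a a' x x'
    obtain ⟨b₀, h₀⟩ := key a
    obtain ⟨b₀', h₀'⟩ := key a'
    have ex : ∀ (R' : C) (φ' : Q ⟶ o R') (b' : Aut (o R')), AutComm φ' (a * a') b' →
        ∃ t', D.proj R' t' = b' ∧ ∀ ψ' : o R₀ ⟶ o R', φ₀ ≫ ψ' = φ' →
          D.rel ψ' (x.val φ₀ b₀ h₀ * x'.val φ₀ b₀' h₀') t' := by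
      intro R' φ' b' h'
      obtain ⟨ψ', rfl⟩ := key2 φ'
      obtain ⟨t', ht', hr⟩ := D.rel_exists (x.val φ₀ b₀ h₀ * x'.val φ₀ b₀' h₀') b' (by
        simpa [Fam.proj_val] using (h₀.mul h₀').of_comp h')
      exact ⟨t', ht', fun ψ'' e => by rwa [(cancel_epi φ₀).1 e]⟩
    choose val hval hrel using ex
    refine ⟨⟨fun {R'} φ' b' h' => val R' φ' b' h', fun {R'} φ' b' h' => hval R' φ' b' h', ?_⟩, ?_⟩
    · intro R₁ R₂ φ₁ b₁ h₁ ψ₁ χ b₂ h₂ e₁ hc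
      obtain ⟨χ₁, rfl⟩ := key2 φ₁
      exact rel_of_comp_left (hrel _ _ b₁ h₁ χ₁ rfl)
        (hrel _ χ b₂ h₂ (χ₁ ≫ ψ₁) (by rw [← e₁, Category.assoc])) (by rwa [hval, hval])
    · intro R φ b b' h h'
      obtain ⟨ψ, rfl⟩ := key2 φ
      exact rel_right_unique (hrel _ _ _ _ ψ rfl)
        (D.rel_mul (x.rel_val φ₀ b₀ h₀ ψ _ b h rfl (h₀.of_comp h))
          (x'.rel_val φ₀ b₀' h₀' ψ _ b' h' rfl (h₀'.of_comp h')))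
        (by rw [hval, map_mul, x.proj_val, x'.proj_val])

end Resolved

end KTransport

/-! ### Stabilizers of morphisms and quotients by `p`-groups of automorphisms. -/

/-- The stabilizer of a morphism `φ : Q ⟶ R` in the automorphism group of `Q`. -/
def autStab {𝓒 : Type u₂} [Category.{v₂} 𝓒] {Q R : 𝓒} (φ : Q ⟶ R) : Subgroup (Aut Q) where
  carrier := {a | AutComm φ a 1}
  one_mem' := AutComm.one φ
  mul_mem' h h' := by simpa using h.mul h'
  inv_mem' h := by simpa using h.inv

section autStab

variable {𝓒 : Type u₂} [Category.{v₂} 𝓒] {Q R S : 𝓒} {φ : Q ⟶ R}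

theorem mem_autStab' {a : Aut Q} : a ∈ autStab φ ↔ a.hom ≫ φ = φ := by
  change a.hom ≫ φ = φ ≫ 𝟙 _ ↔ _
  rw [Category.comp_id]

theorem autStab_le_comp (φ : Q ⟶ R) (ψ : R ⟶ S) : autStab φ ≤ autStab (φ ≫ ψ) :=
  fun _ h => h.comp (AutComm.one ψ)

theorem AutComm.conj_mem_autStab {a : Aut Q} {b : Aut R} (h : AutComm φ a b) {v : Aut Q}
    (hv : v ∈ autStab φ) : a * v * a⁻¹ ∈ autStab φ := by
  have := (h.mul hv).mul h.inv
  rwa [mul_one, mul_inv_cancel] at this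

theorem autStab_ne_bot_not_isIso (h : autStab φ ≠ ⊥) : ¬ IsIso φ := by
  intro hi
  refine h ((Subgroup.eq_bot_iff_forall _).2 fun a ha => Aut.ext ?_)
  rw [mem_autStab'] at ha
  rw [← cancel_mono φ, ha]
  exact (Category.id_comp φ).symm

/-- An automorphism which normalizes the stabilizer of a quotient morphism induces an
automorphism of the quotient. -/
theorem exists_autComm_of_normalizes [∀ {X Y : 𝓒} (f : X ⟶ Y), Epi f]
    (hφ : ∀ {T : 𝓒} (χ : Q ⟶ T), autStab φ ≤ autStab χ → ∃ ψ, φ ≫ ψ = χ) (a : Aut Q)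
    (ha : ∀ v ∈ autStab φ, a * v * a⁻¹ ∈ autStab φ)
    (ha' : ∀ v ∈ autStab φ, a⁻¹ * v * a ∈ autStab φ) : ∃ b, AutComm φ a b := by
  -- Since `a` normalizes the stabilizer, `a.hom ≫ φ` is again stabilized by it and factors through
  -- `φ`; the factorizations for `a` and `a⁻¹` are mutually inverse because `φ` is an epimorphism.
  have key : ∀ a : Aut Q, (∀ v ∈ autStab φ, a * v * a⁻¹ ∈ autStab φ) →
      autStab φ ≤ autStab (a.hom ≫ φ) := by
    intro a ha v hv
    have h := mem_autStab'.1 (ha v hv)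
    rw [mem_autStab']
    have e : a * v = (a * v * a⁻¹) * a := by group
    have e' : v.hom ≫ a.hom = a.hom ≫ (a * v * a⁻¹).hom := congrArg Iso.hom e
    rw [← Category.assoc, e', Category.assoc, h]
  obtain ⟨ψ, hψ⟩ := hφ _ (key a ha)
  obtain ⟨ψ', hψ'⟩ := hφ _ (key a⁻¹ (by simpa using ha'))
  have i1 : a.hom ≫ a⁻¹.hom = 𝟙 _ := a.hom_inv_id
  have i2 : a⁻¹.hom ≫ a.hom = 𝟙 _ := a.inv_hom_id
  refine ⟨⟨ψ, ψ', ?_, ?_⟩, hψ.symm⟩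
  · rw [← cancel_epi φ, ← Category.assoc, hψ, Category.assoc, hψ', ← Category.assoc, i1]
    simp
  · rw [← cancel_epi φ, ← Category.assoc, hψ', Category.assoc, hψ, ← Category.assoc, i2]
    simp

end autStab

/-- The properties of the exterior quotient of the category of selfcentralizing subgroups, and of
the family `o` of its radical objects, which are used to extend transport systems. -/
structure RadicalFamily (p : ℕ) {C : Type u₁} {𝓒 : Type u₂} [Category.{v₂} 𝓒] (o : C → 𝓒) :
    Prop where
  epi : ∀ {X Y : 𝓒} (f : X ⟶ Y), Epi f
  exists_quotient : ∀ {Q : 𝓒} (W : Subgroup (Aut Q)), IsPGroup p W → ∃ (N : 𝓒) (ν : Q ⟶ N),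
    autStab ν = W ∧ ∀ {T : 𝓒} (χ : Q ⟶ T), W ≤ autStab χ → ∃ ψ, ν ≫ ψ = χ
  isPGroup_autStab : ∀ {Q R : 𝓒} (φ : Q ⟶ R), IsPGroup p (autStab φ)
  autStab_ne_bot : ∀ {Q R : 𝓒} (φ : Q ⟶ R), ¬ IsIso φ → autStab φ ≠ ⊥
  radical : ∀ Q : 𝓒, (∃ R, o R = Q) ∨
    ∃ O : Subgroup (Aut Q), O.Normal ∧ IsPGroup p O ∧ O ≠ ⊥
  rank : ∃ (r : 𝓒 → ℕ) (B : ℕ), (∀ Q, r Q ≤ B) ∧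
    ∀ {Q R : 𝓒} (φ : Q ⟶ R), ¬ IsIso φ → r Q < r R

/-! ### Every object is resolved: descending induction on the rank. -/

namespace KTransport

variable {k : Type w} [Field k] {C : Type u₁} {𝓒 : Type u₂} [Category.{v₂} 𝓒]
  {o : C → 𝓒} {D : KTransport.{w, u₁, v₂, u₂, m} k o} {p : ℕ}

/-- Write `V` for the stabilizer of `φ`, which is nontrivial since `φ` is no isomorphism. The
quotients of `Q` by `O`, by `V` and by `V·O` are all proper, hence resolved, and the first two map
to the third. Families over `Q` are thereby identified with families over the quotient `S` by `O`:
push to the quotient by `V·O`, pull back to the quotient by `V`, and evaluate at the morphism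
induced by `φ`. -/
theorem Resolved.of_normal (H : RadicalFamily p o) {Q : 𝓒}
    (hQ : ∀ (R : C) (φ : Q ⟶ o R), ¬ IsIso φ) (O : Subgroup (Aut Q)) (hO : O.Normal)
    (hOp : IsPGroup p O) (hO1 : O ≠ ⊥)
    (ih : ∀ (N : 𝓒) (ν : Q ⟶ N), ¬ IsIso ν → D.Resolved N) : D.Resolved Q := by
  have hepi := @H.epi
  -- the quotient by `O`, to which all the automorphisms extend
  obtain ⟨S, ω, hω, dω⟩ := H.exists_quotient O hOp
  have extS : ∀ a : Aut Q, ∃ s, AutComm ω a s := fun a =>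
    exists_autComm_of_normalizes (by rwa [hω]) a
      (by rw [hω]; exact fun v hv => hO.conj_mem v hv a)
      (by rw [hω]; exact fun v hv => by simpa using hO.conj_mem v hv a⁻¹)
  have hS : D.Resolved S := ih S ω (autStab_ne_bot_not_isIso (by rwa [hω]))
  -- for every morphism, the quotients by its stabilizer and by the product with `O`
  have hV : ∀ {R : C} (φ : Q ⟶ o R), ∃ (N : 𝓒) (ν : Q ⟶ N) (χ : N ⟶ o R), ν ≫ χ = φ ∧
      autStab ν = autStab φ ∧ D.Resolved N ∧
      (∀ {T : 𝓒} (χ : Q ⟶ T), autStab φ ≤ autStab χ → ∃ ψ, ν ≫ ψ = χ) ∧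
      ∀ a b, AutComm φ a b → ∃ c, AutComm ν a c := by
    intro R φ
    obtain ⟨N, ν, hν, dν⟩ := H.exists_quotient (autStab φ) (H.isPGroup_autStab φ)
    obtain ⟨χ, hχ⟩ := dν φ le_rfl
    refine ⟨N, ν, χ, hχ, hν, ih N ν (autStab_ne_bot_not_isIso ?_), dν, fun a b h => ?_⟩
    · rw [hν]
      exact H.autStab_ne_bot φ (hQ R φ)
    · refine exists_autComm_of_normalizes (by rwa [hν]) a ?_ ?_
      · rw [hν]
        exact fun v hv => h.conj_mem_autStab hv
      · rw [hν]
        exact fun v hv => by simpa using h.inv.conj_mem_autStab hv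
  have hW : ∀ {R : C} (φ : Q ⟶ o R), ∃ (N : 𝓒) (κ : Q ⟶ N), 
      autStab κ = autStab φ ⊔ O ∧ D.Resolved N ∧
      (∀ {T : 𝓒} (χ : Q ⟶ T), autStab φ ⊔ O ≤ autStab χ → ∃ ψ, κ ≫ ψ = χ) ∧
      ∀ a b, AutComm φ a b → ∃ c, AutComm κ a c := by
    intro R φ
    -- Normality of `O` makes the join a product, hence a `p`-group, and it is stable under the
    -- automorphisms that extend along `φ`.
    have hp : IsPGroup p (autStab φ ⊔ O : Subgroup (Aut Q)) :=
      (H.isPGroup_autStab φ).to_sup_of_normal_right hOp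
    obtain ⟨N, κ, hκ, dκ⟩ := H.exists_quotient _ hp
    have conj : ∀ a b, AutComm φ a b → ∀ v ∈ autStab φ ⊔ O, a * v * a⁻¹ ∈ autStab φ ⊔ O := by
      intro a b h v hv
      obtain ⟨x, hx, y, hy, rfl⟩ := Subgroup.mem_sup_of_normal_right.1 hv
      have e : a * (x * y) * a⁻¹ = (a * x * a⁻¹) * (a * y * a⁻¹) := by group
      rw [e]
      exact mul_mem (Subgroup.mem_sup_left (h.conj_mem_autStab hx))
        (Subgroup.mem_sup_right (hO.conj_mem y hy a))
    refine ⟨N, κ, hκ, ih N κ (autStab_ne_bot_not_isIso ?_), dκ, fun a b h => ?_⟩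
    · rw [hκ]
      exact fun h => hO1 (le_bot_iff.1 (le_sup_right.trans h.le))
    · refine exists_autComm_of_normalizes (by rwa [hκ]) a ?_ ?_
      · rw [hκ]
        exact conj a b h
      · rw [hκ]
        simpa using conj a⁻¹ b⁻¹ h.inv
  choose nV νV χV hχV hνV rV dV eV using @hV
  choose nW κW hκW rW dW eW using @hW
  have hf : ∀ (R : C) (φ : Q ⟶ o R), ∃ f, νV φ ≫ f = κW φ := fun R φ =>
    dV φ _ (by rw [hκW]; exact le_sup_left)
  have hg : ∀ (R : C) (φ : Q ⟶ o R), ∃ g, ω ≫ g = κW φ := fun R φ =>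
    dω _ (by rw [hκW]; exact le_sup_right)
  choose f hf using hf
  choose g hg using hg
  choose s hs using extS
  choose c hc using @eV
  choose e he using @eW
  have cχ : ∀ {R : C} (φ : Q ⟶ o R) (a b) (h : AutComm φ a b), AutComm (χV φ) (c φ a b h) b :=
    fun φ a b h => (hc φ a b h).of_comp (by rwa [hχV])
  have cf : ∀ {R : C} (φ : Q ⟶ o R) (a b) (h : AutComm φ a b),
      AutComm (f R φ) (c φ a b h) (e φ a b h) :=
    fun φ a b h => (hc φ a b h).of_comp (by rw [hf]; exact he φ a b h)
  have cg : ∀ {R : C} (φ : Q ⟶ o R) (a b) (h : AutComm φ a b),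
      AutComm (g R φ) (s a) (e φ a b h) :=
    fun φ a b h => (hs a).of_comp (by rw [hg]; exact he φ a b h)
  -- transport of a family from `S` to the quotient by the stabilizer
  have trans : ∀ {R : C} (φ : Q ⟶ o R) (a b) (h : AutComm φ a b) (y : D.Fam S (s a)),
      ∃ z : D.Fam (nV φ) (c φ a b h),
        z.restrict (f R φ) (cf φ a b h) = y.restrict (g R φ) (cg φ a b h) := fun φ a b h y =>
    (rV φ).restrict_surjective (rW φ) _ _ _
  have back : ∀ {R : C} (φ : Q ⟶ o R) (a b) (h : AutComm φ a b) (x : D.Fam Q a),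
      (x.restrict (νV φ) (hc φ a b h)).restrict (f R φ) (cf φ a b h) =
        (x.restrict ω (hs a)).restrict (g R φ) (cg φ a b h) := by
    intro R φ a b h x
    rw [Fam.restrict_restrict (hf R φ) _ _ (he φ a b h),
      Fam.restrict_restrict (hg R φ) _ _ (he φ a b h)]
  have val_eq : ∀ {R : C} (φ : Q ⟶ o R) (a b) (h : AutComm φ a b) (x : D.Fam Q a),
      x.val φ b h = (x.restrict (νV φ) (hc φ a b h)).val (χV φ) b (cχ φ a b h) := by
    intro R φ a b h x
    exact x.val_congr _ _ (hχV φ).symm rfl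
  -- every family over `S` comes from a unique family over `Q`
  have ext_inj : ∀ {a : Aut Q} (x x' : D.Fam Q a),
      x.restrict ω (hs a) = x'.restrict ω (hs a) → x = x' := by
    intro a x x' hx
    ext R φ b h
    rw [val_eq, val_eq]
    congr 1
    refine (rV φ).restrict_injective (rW φ) (f R φ) (cf φ a b h) _ _ ?_
    rw [back, back, hx]
  have ext_surj : ∀ {a : Aut Q} (y : D.Fam S (s a)), ∃ x : D.Fam Q a,
      ∀ {R : C} (φ : Q ⟶ o R) (b) (h : AutComm φ a b) (z : D.Fam (nV φ) (c φ a b h)),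
        z.restrict (f R φ) (cf φ a b h) = y.restrict (g R φ) (cg φ a b h) →
          x.val φ b h = z.val (χV φ) b (cχ φ a b h) := by
    intro a y
    choose z hz using fun (R : C) (φ : Q ⟶ o R) b (h : AutComm φ a b) => trans φ a b h y
    refine ⟨⟨fun {R} φ b h => (z R φ b h).val (χV φ) b (cχ φ a b h),
      fun {R} φ b h => (z R φ b h).proj_val _ _ _, ?_⟩, ?_⟩
    · intro R R' φ b h ψ χ b' h' e' hψ
      obtain ⟨ρ, hρ⟩ := dV φ (νV χ) (by rw [hνV, ← e']; exact autStab_le_comp φ ψ)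
      obtain ⟨ρ', hρ'⟩ := dW φ (κW χ) (by
        rw [hκW, ← e']
        exact sup_le_sup_right (autStab_le_comp φ ψ) _)
      have cρ : AutComm ρ (c φ a b h) (c χ a b' h') :=
        (hc φ a b h).of_comp (by rw [hρ]; exact hc χ a b' h')
      have cρ' : AutComm ρ' (e φ a b h) (e χ a b' h') :=
        (he φ a b h).of_comp (by rw [hρ']; exact he χ a b' h')
      have sq : f R φ ≫ ρ' = ρ ≫ f R' χ := by
        rw [← cancel_epi (νV φ), ← Category.assoc, hf, hρ', ← Category.assoc, hρ, hf]
      have tri : g R φ ≫ ρ' = g R' χ := by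
        rw [← cancel_epi ω, ← Category.assoc, hg, hρ', hg]
      have sq' : ρ ≫ χV χ = χV φ ≫ ψ := by
        rw [← cancel_epi (νV φ), ← Category.assoc, hρ, hχV, ← Category.assoc, hχV, e']
      -- Both sides live over the quotient by the stabilizer of `χ`, and on the quotient by its
      -- product with `O` both become the restriction of `y`; restriction to the latter is
      -- injective.
      have zz : z R' χ b' h' = (z R φ b h).restrict ρ cρ := by
        refine (rV χ).restrict_injective (rW χ) (f R' χ) (cf χ a b' h') _ _ ?_
        rw [hz, Fam.restrict_restrict sq.symm _ _ ((cf φ a b h).comp cρ'),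
          ← Fam.restrict_restrict rfl (cf φ a b h) cρ', hz,
          Fam.restrict_restrict tri _ _ (cg χ a b' h')]
      rw [zz]
      exact (z R φ b h).rel_val _ _ _ _ _ _ _ sq'.symm hψ
    · intro R φ b h z' hz'
      have : z R φ b h = z' := (rV φ).restrict_injective (rW φ) (f R φ) (cf φ a b h) _ _
        (by rw [hz, hz'])
      exact congrArg (fun z => z.val (χV φ) b (cχ φ a b h)) this
  have val_inj : ∀ {a : Aut Q} {R : C} (φ : Q ⟶ o R) (b) (h : AutComm φ a b) (x x' : D.Fam Q a),
      x.val φ b h = x'.val φ b h → x = x' := by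
    intro a R φ b h x x' hx
    rw [val_eq, val_eq] at hx
    have := (rV φ).inj _ _ _ _ _ hx
    refine ext_inj x x' (hS.restrict_injective (rW φ) (g R φ) (cg φ a b h) _ _ ?_)
    rw [← back, ← back, this]
  refine ⟨?_, val_inj, ?_, ?_⟩
  · obtain ⟨R, φ, hφ⟩ := hS.full
    exact ⟨R, ω ≫ φ, fun a => ⟨_, (hs a).comp (hφ (s a)).choose_spec⟩⟩
  -- The same path is followed backwards: `t` determines a family over the quotient by `V`, then one
  -- over the quotient by `V·O`, which is lifted to `S`.
  · intro a R φ t h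
    obtain ⟨z, hz⟩ := (rV φ).surj (χV φ) t (cχ φ a _ h)
    obtain ⟨y, hy⟩ := hS.restrict_surjective (rW φ) (g R φ) (cg φ a _ h)
      (z.restrict (f R φ) (cf φ a _ h))
    obtain ⟨x, hx⟩ := ext_surj y
    exact ⟨x, by rw [hx φ _ h z hy.symm, hz]⟩
  · intro a a' x x'
    obtain ⟨y, hy⟩ := hS.mul (x.restrict ω (hs a)) (x'.restrict ω (hs a'))
    -- Extensions to `S` are unique since `ω` is an epimorphism. The product family over `S`
    -- therefore sits over the chosen extension of `a * a'`, but only up to this equality of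
    -- indices, whence the restatement below.
    have es : s a * s a' = s (a * a') := ((hs a).mul (hs a')).right_unique (hs (a * a'))
    obtain ⟨y', hy'⟩ : ∃ y' : D.Fam S (s (a * a')), ∀ {R : C} (φ : S ⟶ o R) (b b')
        (h : AutComm φ (s a) b) (h' : AutComm φ (s a') b') (h'' : AutComm φ (s (a * a')) (b * b')),
        y'.val φ (b * b') h'' = x.val (ω ≫ φ) b ((hs a).comp h) *
          x'.val (ω ≫ φ) b' ((hs a').comp h') := by
      rw [← es]
      exact ⟨y, fun φ b b' h h' _ => hy φ b b' h h'⟩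
    obtain ⟨x'', hx''⟩ := ext_surj y'
    refine ⟨x'', fun {R} φ b b' h h' => ?_⟩
    obtain ⟨z, hz⟩ := (rV φ).mul (x.restrict (νV φ) (hc φ a b h))
      (x'.restrict (νV φ) (hc φ a' b' h'))
    have ec : c φ a b h * c φ a' b' h' = c φ (a * a') (b * b') (h.mul h') :=
      ((hc φ a b h).mul (hc φ a' b' h')).right_unique (hc _ _ _ _)
    obtain ⟨z', hz'⟩ : ∃ z' : D.Fam (nV φ) (c φ (a * a') (b * b') (h.mul h')),
        ∀ {T : C} (χ : nV φ ⟶ o T) (d d') (k : AutComm χ (c φ a b h) d)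
          (k' : AutComm χ (c φ a' b' h') d')
          (k'' : AutComm χ (c φ (a * a') (b * b') (h.mul h')) (d * d')),
        z'.val χ (d * d') k'' = x.val (νV φ ≫ χ) d ((hc φ a b h).comp k) *
          x'.val (νV φ ≫ χ) d' ((hc φ a' b' h').comp k') := by
      rw [← ec]
      exact ⟨z, fun χ d d' k k' _ => hz χ d d' k k'⟩
    rw [hx'' φ _ (h.mul h') z', hz' (χV φ) b b' (cχ φ a b h) (cχ φ a' b' h')]
    · exact congrArg₂ _ (x.val_congr _ _ (hχV φ) rfl) (x'.val_congr _ _ (hχV φ) rfl)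
    -- It remains to see that the product over the quotient by `V` and the product over `S` agree on
    -- the quotient by `V·O`. One value suffices, and there both are products of values of `x` and
    -- `x'` at the same morphism from `Q`.
    · obtain ⟨T, χ, hχ⟩ := (rW φ).full
      obtain ⟨d, hd⟩ := hχ (e φ a b h)
      obtain ⟨d', hd'⟩ := hχ (e φ a' b' h')
      have ee : e φ a b h * e φ a' b' h' = e φ (a * a') (b * b') (h.mul h') :=
        ((he φ a b h).mul (he φ a' b' h')).right_unique (he _ _ _ _)
      refine (rW φ).inj χ (d * d') (by rw [← ee]; exact hd.mul hd') _ _ ?_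
      rw [Fam.restrict_val, Fam.restrict_val,
        hz' _ d d' ((cf φ a b h).comp hd) ((cf φ a' b' h').comp hd'),
        hy' _ d d' ((cg φ a b h).comp hd) ((cg φ a' b' h').comp hd')]
      have e3 : νV φ ≫ f R φ ≫ χ = ω ≫ g R φ ≫ χ := by
        rw [← Category.assoc, hf, ← Category.assoc, hg]
      exact congrArg₂ _ (x.val_congr _ _ e3 rfl) (x'.val_congr _ _ e3 rfl)

/-- Non-isomorphisms strictly raise the bounded rank, so the induction can assume that all proper
quotients are resolved. An object isomorphic to none of the family has a nontrivial normal
`p`-subgroup to divide by. -/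
theorem resolved (H : RadicalFamily p o) (Q : 𝓒) : D.Resolved Q := by
  obtain ⟨r, B, hB, hr⟩ := H.rank
  induction hn : B - r Q using Nat.strong_induction_on generalizing Q with
  | _ n ih =>
  have hepi := @H.epi
  by_cases hQ : ∃ (R : C) (φ : Q ⟶ o R), IsIso φ
  · obtain ⟨R, φ, hφ⟩ := hQ
    exact Resolved.of_isIso φ
  · push Not at hQ
    obtain ⟨R, rfl⟩ | ⟨O, hO, hOp, hO1⟩ := H.radical Q
    · exact (hQ R (𝟙 _) inferInstance).elim
    · refine Resolved.of_normal H hQ O hO hOp hO1 fun N ν hν => ?_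
      have h1 := hr ν hν
      have h2 := hB N
      exact ih (B - r N) (by omega) N rfl

end KTransport

/-! ### Extension of a transport system to all objects, and its universal property. -/

namespace KTransport

variable {k : Type w} [Field k] {C : Type u₁} {𝓒 : Type u₂} [Category.{v₂} 𝓒]
  {o : C → 𝓒} {p : ℕ}

/-- The restriction of a transport system to a subfamily of objects. -/
def comap {C' : Type u₃} {o' : C' → 𝓒} (D : KTransport.{w, u₃, v₂, u₂, m} k o') (r : C → C') :
    KTransport.{w, u₁, v₂, u₂, m} k (fun R => o' (r R)) where
  M R := D.M (r R)
  incl R := D.incl (r R)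
  proj R := D.proj (r R)
  incl_injective R := D.incl_injective (r R)
  proj_surjective R := D.proj_surjective (r R)
  proj_incl R := D.proj_incl (r R)
  exists_incl h := D.exists_incl h
  central R := D.central (r R)
  rel φ x y := D.rel φ x y
  rel_comm h := D.rel_comm h
  rel_exists := D.rel_exists
  rel_mul h h' := D.rel_mul h h'
  rel_incl := D.rel_incl
  rel_unique h := D.rel_unique h
  rel_id := D.rel_id
  rel_comp := D.rel_comp

/-- The morphisms of transport systems over the same objects. -/
structure Hom (D₁ : KTransport.{w, u₁, v₂, u₂, m} k o) (D₂ : KTransport.{w, u₁, v₂, u₂, m'} k o) where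
  app : ∀ Q, D₁.M Q →* D₂.M Q
  proj_app : ∀ Q x, D₂.proj Q (app Q x) = D₁.proj Q x
  app_incl : ∀ Q c, app Q (D₁.incl Q c) = D₂.incl Q c
  app_rel : ∀ {Q R} {φ : o Q ⟶ o R} {x y}, D₁.rel φ x y → D₂.rel φ (app Q x) (app R y)

variable {D : KTransport.{w, u₁, v₂, u₂, m} k o}

variable (D) in
theorem exists_extension {Q R : C} (φ : o Q ⟶ o R) (h : ∀ a, ∃ b, AutComm φ a b) (x : D.M Q) :
    ∃ y, D.rel φ x y := by
  obtain ⟨b, hb⟩ := h (D.proj Q x)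
  obtain ⟨y, -, hy⟩ := D.rel_exists x b hb
  exact ⟨y, hy⟩

namespace Fam

variable {Q : 𝓒} {a : Aut Q}

/-- The constant compatible families over the identity. -/
@[simps]
def const [∀ {X Y : 𝓒} (f : X ⟶ Y), Epi f] (Q : 𝓒) (c : kˣ) : D.Fam Q 1 where
  val _ _ _ := D.incl _ c
  proj_val φ _ h := (D.proj_incl _ c).trans ((AutComm.one φ).right_unique h)
  rel_val _ _ _ ψ _ _ _ _ _ := D.rel_incl ψ c

theorem restrict_const [∀ {X Y : 𝓒} (f : X ⟶ Y), Epi f] {N : 𝓒} (ν : Q ⟶ N) (c : kˣ) :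
    (const (D := D) Q c).restrict ν (AutComm.one ν) = const N c := rfl

theorem restrict_id (x : D.Fam Q a) : x.restrict (𝟙 Q) (AutComm.id a) = x := by
  ext R φ b h
  exact x.val_congr _ _ (Category.id_comp φ) rfl

end Fam

section Kan

variable (hres : ∀ Q, D.Resolved Q)

/-- An object of the transport system to which all the automorphisms of `Q` extend. -/
noncomputable def fullObj (Q : 𝓒) : C := (hres Q).full.choose

/-- A morphism along which all the automorphisms of `Q` extend. -/
noncomputable def fullHom (Q : 𝓒) : Q ⟶ o (fullObj hres Q) := (hres Q).full.choose_spec.choose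

theorem exists_autComm_fullHom (Q : 𝓒) (a : Aut Q) : ∃ b, AutComm (fullHom hres Q) a b :=
  (hres Q).full.choose_spec.choose_spec a

/-- The `k*`-group over the automorphism group of `Q` obtained by extension of the transport
system. -/
def kanGroup (Q : 𝓒) : Subgroup (Aut Q × D.M (fullObj hres Q)) where
  carrier := {x | AutComm (fullHom hres Q) x.1 (D.proj _ x.2)}
  one_mem' := by simpa using AutComm.one _
  mul_mem' h h' := by simpa using AutComm.mul h h'
  inv_mem' h := by simpa using AutComm.inv h

variable {hres}

/-- The compatible family determined by an element of the extended `k*`-group. -/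
noncomputable def kanFam {Q : 𝓒} (x : kanGroup hres Q) : D.Fam Q x.1.1 :=
  ((hres Q).surj (fullHom hres Q) x.1.2 x.2).choose

theorem kanFam_val {Q : 𝓒} (x : kanGroup hres Q) :
    (kanFam x).val (fullHom hres Q) _ x.2 = x.1.2 :=
  ((hres Q).surj (fullHom hres Q) x.1.2 x.2).choose_spec

theorem kanFam_eq {Q : 𝓒} (x : kanGroup hres Q) (y : D.Fam Q x.1.1) {R : C} (φ : Q ⟶ o R) (b)
    (h : AutComm φ x.1.1 b) (e : (kanFam x).val φ b h = y.val φ b h) : kanFam x = y :=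
  (hres Q).inj φ b h _ _ e

/-- The product of two families is a family, and its value at `fullHom` is the product of the second
components, so it is the family of the product. -/
theorem kanFam_mul {Q : 𝓒} (x x' : kanGroup hres Q) {R : C} (φ : Q ⟶ o R) (b b')
    (h : AutComm φ x.1.1 b) (h' : AutComm φ x'.1.1 b') :
    (kanFam (x * x')).val φ (b * b') (h.mul h') =
      (kanFam x).val φ b h * (kanFam x').val φ b' h' := by
  obtain ⟨y, hy⟩ := (hres Q).mul (kanFam x) (kanFam x')
  have : kanFam (x * x') = y := by
    refine kanFam_eq _ _ _ _ (x * x').2 ((kanFam_val (x * x')).trans ?_)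
    refine Eq.trans ?_ ((hy (fullHom hres Q) _ _ x.2 x'.2).symm.trans ?_)
    · rw [kanFam_val, kanFam_val]; rfl
    · exact y.val_congr _ _ rfl (by simp)
  rw [this]
  exact hy φ b b' h h'

/-- Elements of `kanGroup` are thus the same as compatible families; pairing an automorphism with
one value along a full morphism merely gives a model that is visibly a group. -/
theorem exists_kanFam_eq [∀ {X Y : 𝓒} (f : X ⟶ Y), Epi f] {Q : 𝓒} {a : Aut Q}
    (y : D.Fam Q a) : ∃ t, ∃ h : (a, t) ∈ kanGroup hres Q,
      kanFam (⟨(a, t), h⟩ : kanGroup hres Q) = y := by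
  obtain ⟨b, hb⟩ := exists_autComm_fullHom hres Q a
  have h : (a, y.val _ b hb) ∈ kanGroup hres Q := by
    change AutComm _ a (D.proj _ (y.val _ b hb))
    rwa [y.proj_val]
  refine ⟨y.val _ b hb, h, kanFam_eq _ _ (fullHom hres Q) _ h ?_⟩
  exact (kanFam_val (⟨_, h⟩ : kanGroup hres Q)).trans (y.val_congr _ _ rfl (y.proj_val _ _ _).symm)

theorem kanGroup_ext [∀ {X Y : 𝓒} (f : X ⟶ Y), Epi f] {Q : 𝓒} {x x' : kanGroup hres Q}
    (h : x.1.1 = x'.1.1) {R : C} (φ : Q ⟶ o R) (b b') (hb : AutComm φ x.1.1 b)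
    (hb' : AutComm φ x'.1.1 b') (hv : (kanFam x).val φ b hb = (kanFam x').val φ b' hb') :
    x = x' := by
  obtain ⟨⟨a, t⟩, hx⟩ := x
  obtain ⟨⟨a', t'⟩, hx'⟩ := x'
  obtain rfl : a = a' := h
  obtain rfl : b = b' := hb.right_unique hb'
  have h1 := (hres Q).inj φ b hb _ _ hv
  have e1 := kanFam_val (⟨(a, t), hx⟩ : kanGroup hres Q)
  have e2 := kanFam_val (⟨(a, t'), hx'⟩ : kanGroup hres Q)
  have h2 : D.proj _ t = D.proj _ t' := hx.right_unique hx'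
  have : t = t' := by
    refine e1.symm.trans (Eq.trans ?_ e2)
    refine Eq.trans ?_ (congrArg (fun y : D.Fam Q a => y.val _ _ hx') h1)
    exact Fam.val_congr _ _ _ rfl h2
  subst this
  rfl

/-- The elements of `k*` in the extended `k*`-groups. -/
noncomputable def kanIncl (hres : ∀ Q, D.Resolved Q) (Q : 𝓒) : kˣ →* kanGroup hres Q where
  toFun c := ⟨(1, D.incl _ c), by
    change AutComm _ 1 (D.proj _ (D.incl _ c))
    rw [D.proj_incl]
    exact AutComm.one _⟩
  map_one' := Subtype.ext (by simp)
  map_mul' c c' := Subtype.ext (by simp)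

theorem kanFam_incl [∀ {X Y : 𝓒} (f : X ⟶ Y), Epi f] (Q : 𝓒) (c : kˣ) :
    kanFam (kanIncl hres Q c) = Fam.const Q c :=
  kanFam_eq _ _ _ _ (kanIncl hres Q c).2 (kanFam_val (kanIncl hres Q c))

theorem kanFam_one [∀ {X Y : 𝓒} (f : X ⟶ Y), Epi f] (Q : 𝓒) :
    kanFam (1 : kanGroup hres Q) = Fam.const Q 1 :=
  kanFam_eq _ _ _ _ (1 : kanGroup hres Q).2 ((kanFam_val 1).trans (map_one _).symm)

theorem kanFam_restrict_mul {Q N : 𝓒} (ν : Q ⟶ N) {x x' : kanGroup hres Q} {y y' : kanGroup hres N}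
    (h : AutComm ν x.1.1 y.1.1) (h' : AutComm ν x'.1.1 y'.1.1)
    (e : (kanFam x).restrict ν h = kanFam y) (e' : (kanFam x').restrict ν h' = kanFam y') :
    (kanFam (x * x')).restrict ν (h.mul h') = kanFam (y * y') := by
  obtain ⟨b, hb⟩ := exists_autComm_fullHom hres N y.1.1
  obtain ⟨b', hb'⟩ := exists_autComm_fullHom hres N y'.1.1
  refine (kanFam_eq (y * y') _ (fullHom hres N) (b * b') (hb.mul hb') ?_).symm
  rw [kanFam_mul _ _ _ _ _ hb hb', ← e, ← e']
  exact (kanFam_mul _ _ _ _ _ (h.comp hb) (h'.comp hb')).symm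

/-- The extension of a transport system to all the objects. -/
noncomputable def kan [∀ {X Y : 𝓒} (f : X ⟶ Y), Epi f] (hres : ∀ Q, D.Resolved Q)
    {C' : Type u₃} (o' : C' → 𝓒) : KTransport.{w, u₃, v₂, u₂, max v₂ m} k o' where
  M Q := kanGroup hres (o' Q)
  incl Q := kanIncl hres (o' Q)
  proj Q := (MonoidHom.fst _ _).comp (kanGroup hres (o' Q)).subtype
  incl_injective Q c c' h :=
    D.incl_injective _ (congrArg (fun x : kanGroup hres (o' Q) => x.1.2) h)
  proj_surjective Q a := by
    obtain ⟨b, hb⟩ := exists_autComm_fullHom hres (o' Q) a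
    obtain ⟨t, rfl⟩ := D.proj_surjective _ b
    exact ⟨⟨(a, t), hb⟩, rfl⟩
  proj_incl Q c := rfl
  exists_incl {Q x} h := by
    obtain ⟨⟨a, t⟩, hx⟩ := x
    obtain rfl : a = 1 := h
    obtain ⟨c, rfl⟩ := D.exists_incl ((AutComm.one _).right_unique hx).symm
    exact ⟨c, rfl⟩
  central Q c x := Subtype.ext (Prod.ext ((one_mul _).trans (mul_one _).symm) (D.central _ c x.1.2))
  rel {Q R} φ x y := ∃ h : AutComm φ x.1.1 y.1.1, (kanFam x).restrict φ h = kanFam y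
  rel_comm h := h.1
  rel_exists {Q R φ} x b h := by
    obtain ⟨t, ht, e⟩ := exists_kanFam_eq (hres := hres) ((kanFam x).restrict φ h)
    exact ⟨⟨(b, t), ht⟩, rfl, h, e.symm⟩
  rel_mul := by
    rintro Q R φ x y x' y' ⟨h, e⟩ ⟨h', e'⟩
    exact ⟨h.mul h', kanFam_restrict_mul φ h h' e e'⟩
  rel_incl φ c := ⟨AutComm.one φ, by
    rw [kanFam_incl]
    exact (Fam.restrict_const φ c).trans (kanFam_incl _ c).symm⟩
  rel_unique := by
    rintro Q R φ c ⟨h, e⟩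
    have e' := (congrArg (Fam.restrict φ h) (kanFam_one (hres := hres) (o' Q))).symm.trans
      (e.trans (kanFam_incl (o' R) c))
    have := congrArg (fun x : D.Fam (o' R) 1 => x.val (fullHom hres (o' R)) 1 (AutComm.one _)) e'
    exact (D.incl_injective _ this).symm
  rel_id x := ⟨AutComm.id _, Fam.restrict_id _⟩
  rel_comp := by
    rintro Q R T φ ψ x y z ⟨h, e⟩ ⟨h', e'⟩
    exact ⟨h.comp h', by rw [← e', ← e, Fam.restrict_restrict rfl]⟩

/-- The evaluation of the extension of a transport system at its original objects. -/
noncomputable def kanEval [∀ {X Y : 𝓒} (f : X ⟶ Y), Epi f] {C' : Type u₃} {o' : C' → 𝓒}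
    {r : C → C'} {D : KTransport.{w, u₁, v₂, u₂, m} k (fun R => o' (r R))}
    (hres : ∀ Q, D.Resolved Q) : ((D.kan hres o').comap r).Hom D where
  app R :=
    { toFun := fun x => (kanFam (show kanGroup hres (o' (r R)) from x)).val (𝟙 _) _ (AutComm.id _)
      map_one' := (congrArg (fun x : D.Fam _ 1 => x.val (𝟙 _) 1 (AutComm.id _))
        (kanFam_one (hres := hres) _)).trans (map_one _)
      map_mul' := fun x y => kanFam_mul _ _ _ _ _ _ _ }
  proj_app R x := Fam.proj_val _ _ _ _
  app_incl R c := congrArg (fun x : D.Fam _ 1 => x.val (𝟙 _) 1 (AutComm.id _))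
    (kanFam_incl (hres := hres) _ c)
  app_rel := by
    rintro Q R φ x y ⟨h, e⟩
    have hx := (kanFam (show kanGroup hres (o' (r Q)) from x)).rel_val (𝟙 _) _ (AutComm.id _) φ _ _
      (h.comp (AutComm.id _)) (by rw [Category.id_comp, Category.comp_id]) h
    exact (congrArg (fun z : D.Fam _ _ => D.rel φ _ (z.val (𝟙 _) _ (AutComm.id _))) e).mp hx

/-- The compatible family determined by an element of a transport system with a morphism to the
given one. -/
noncomputable def Hom.fam {C' : Type u₃} {o' : C' → 𝓒} {r : C → C'}
    {D : KTransport.{w, u₁, v₂, u₂, m} k (fun R => o' (r R))}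
    {D' : KTransport.{w, u₃, v₂, u₂, m'} k o'} (γ : (D'.comap r).Hom D) {Q : C'} (x : D'.M Q) :
    D.Fam (o' Q) (D'.proj Q x) where
  val {R} φ b h := γ.app R (D'.rel_exists x b h).choose
  proj_val {R} φ b h := (γ.proj_app R _).trans (D'.rel_exists x b h).choose_spec.1
  rel_val {R R'} φ b h ψ χ b' h' e hc := by
    have h1 := (D'.rel_exists x b h).choose_spec
    have h2 := (D'.rel_exists x b' h').choose_spec
    refine γ.app_rel (rel_of_comp_left h1.2 (D := D') ?_ ?_)
    · rw [e]
      exact h2.2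
    · rw [h1.1, h2.1]
      exact hc

theorem Hom.fam_val {C' : Type u₃} {o' : C' → 𝓒} {r : C → C'}
    {D : KTransport.{w, u₁, v₂, u₂, m} k (fun R => o' (r R))}
    {D' : KTransport.{w, u₃, v₂, u₂, m'} k o'} (γ : (D'.comap r).Hom D) {Q : C'} (x : D'.M Q)
    {R : C} (φ : o' Q ⟶ o' (r R)) (b) (h : AutComm φ (D'.proj Q x) b) (y : D'.M (r R))
    (hy : D'.proj _ y = b) (hr : D'.rel φ x y) : (γ.fam x).val φ b h = γ.app R y := by
  have h1 := (D'.rel_exists x b h).choose_spec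
  exact congrArg (γ.app R) (rel_right_unique h1.2 hr (h1.1.trans hy.symm))

/-- An element of `D'` is sent to the family of all its transports to the objects of `D`, carried
over by `γ`. As families are elements of the extension, this defines the map; every identity it has
to satisfy is checked on a single value. -/
theorem exists_hom_kan [∀ {X Y : 𝓒} (f : X ⟶ Y), Epi f] {C' : Type u₃} {o' : C' → 𝓒}
    {r : C → C'} {D : KTransport.{w, u₁, v₂, u₂, m} k (fun R => o' (r R))}
    (hres : ∀ Q, D.Resolved Q) {D' : KTransport.{w, u₃, v₂, u₂, m'} k o'}
    (γ : (D'.comap r).Hom D) : ∃ β : D'.Hom (D.kan hres o'),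
      ∀ R x, (kanEval hres).app R (β.app (r R) x) = γ.app R x := by
  have key : ∀ {Q : C'} (x : D'.M Q), ∃ x' : kanGroup hres (o' Q),
      ∃ h : x'.1.1 = D'.proj Q x, ∀ {R : C} (φ : o' Q ⟶ o' (r R)) (b)
        (hb : AutComm φ (D'.proj Q x) b), (kanFam x').val φ b (by rwa [h]) =
          (γ.fam x).val φ b hb := by
    intro Q x
    obtain ⟨t, ht, e⟩ := exists_kanFam_eq (hres := hres) (γ.fam x)
    exact ⟨⟨_, ht⟩, rfl, fun φ b hb => by rw [e]⟩
  choose f hf hv using @key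
  have hf' : ∀ {Q : C'} {x : D'.M Q} {y : kanGroup hres (o' Q)} (h : D'.proj Q x = y.1.1)
      {R : C} (φ : o' Q ⟶ o' (r R)) (b) (hb : AutComm φ (D'.proj Q x) b)
      (hb' : AutComm φ y.1.1 b), (kanFam y).val φ b hb' = (γ.fam x).val φ b hb → f x = y := by
    intro Q x y h R φ b hb hb' e
    exact kanGroup_ext ((hf x).trans h) _ b b (by rwa [hf]) hb' ((hv x _ b hb).trans e.symm)
  have hf1 : ∀ Q (c : kˣ), f (D'.incl Q c) = kanIncl hres (o' Q) c := by
    intro Q c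
    have hb : AutComm (fullHom hres (o' Q)) (D'.proj Q (D'.incl Q c)) 1 := by
      rw [D'.proj_incl]
      exact AutComm.one _
    refine hf' (D'.proj_incl Q c) (fullHom hres (o' Q)) 1 hb (AutComm.one _) ?_
    rw [γ.fam_val _ _ _ hb (D'.incl _ c) (D'.proj_incl _ c) (D'.rel_incl _ c)]
    exact (congrArg (fun x : D.Fam _ 1 => x.val (fullHom hres (o' Q)) 1 (AutComm.one _))
      (kanFam_incl (hres := hres) _ c)).trans (γ.app_incl _ c).symm
  have hfm : ∀ Q (x x' : D'.M Q), f (x * x') = f x * f x' := by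
    intro Q x x'
    -- Along a full morphism both factors can be transported, so the product can be compared with
    -- the product of the values there.
    obtain ⟨y, hy⟩ := D'.exists_extension (fullHom hres (o' Q)) (exists_autComm_fullHom hres _) x
    obtain ⟨y', hy'⟩ := D'.exists_extension (fullHom hres (o' Q)) (exists_autComm_fullHom hres _) x'
    have c := D'.rel_comm hy
    have c' := D'.rel_comm hy'
    refine hf' (by rw [map_mul]; exact (congrArg₂ (· * ·) (hf x) (hf x')).symm)
      (fullHom hres (o' Q)) (D'.proj _ y * D'.proj _ y') (by rw [map_mul]; exact c.mul c')
      (by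
        change AutComm _ ((f x).1.1 * (f x').1.1) _
        rw [hf, hf]
        exact c.mul c') ?_
    rw [γ.fam_val _ _ _ _ (y * y') (map_mul _ _ _) (D'.rel_mul hy hy')]
    refine Eq.trans ?_ (MonoidHom.map_mul (γ.app _) y y').symm
    refine (kanFam_mul _ _ _ _ _ (by rwa [hf]) (by rwa [hf])).trans ?_
    rw [hv _ _ _ c, hv _ _ _ c', γ.fam_val _ _ _ _ y rfl hy, γ.fam_val _ _ _ _ y' rfl hy']
  refine ⟨⟨fun Q => ⟨⟨f, ?_⟩, hfm Q⟩, fun Q x => hf x, hf1, ?_⟩, ?_⟩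
  · have := hf1 Q 1
    rw [map_one, map_one] at this
    exact this
  · intro Q R φ x y h
    have hc : AutComm φ (f x).1.1 (f y).1.1 := by
      rw [hf, hf]
      exact D'.rel_comm h
    obtain ⟨t, ht⟩ := D'.exists_extension (fullHom hres (o' R)) (exists_autComm_fullHom hres _) y
    have c := D'.rel_comm ht
    have c' := D'.rel_comm (D'.rel_comp h ht)
    refine ⟨hc, (kanFam_eq (f y) _ (fullHom hres (o' R)) (D'.proj _ t) (by rwa [hf]) ?_).symm⟩
    rw [hv _ _ _ c, γ.fam_val _ _ _ _ t rfl ht]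
    refine Eq.symm ((hv x (φ ≫ fullHom hres (o' R)) _ c').trans ?_)
    rw [γ.fam_val _ _ _ _ t rfl (D'.rel_comp h ht)]
  · intro R x
    refine Eq.trans ?_ ((hv x (𝟙 (o' (r R))) _ (AutComm.id _)).trans
      (γ.fam_val _ _ _ _ x rfl (D'.rel_id x)))
    exact Fam.val_congr _ _ _ rfl (hf x)

end Kan

end KTransport

/-! ## Elements of `p`-power order in central extensions of `p`-groups -/

section torsion

/-- The centre of `E` has `p`-power index `p ^ s`, and the transfer to the centre is the map `z ↦ z
^ p ^ s`. Being a homomorphism to an abelian group, it sends `x * y` to an element of `p`-power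
order. -/
theorem exists_mul_pow_eq_one {p : ℕ} [Fact p.Prime] {E : Type*} {G : Type*} [Group E] [Group G]
    [Finite G] (hG : IsPGroup p G) (f : E →* G) (hf : f.ker ≤ Subgroup.center E) {x y : E} {n m : ℕ}
    (hx : x ^ p ^ n = 1) (hy : y ^ p ^ m = 1) : ∃ l, (x * y) ^ p ^ l = 1 := by
  obtain ⟨r, hr⟩ := IsPGroup.exists_card_eq hG
  have h1 : f.ker.index ∣ p ^ r := by
    rw [Subgroup.index_ker, ← hr]
    exact Subgroup.card_subgroup_dvd_card _
  have h2 : (Subgroup.center E).index ∣ p ^ r := (Subgroup.index_dvd_of_le hf).trans h1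
  obtain ⟨s, -, hs⟩ := (Nat.dvd_prime_pow Fact.out).1 h2
  have : (Subgroup.center E).FiniteIndex :=
    ⟨by rw [hs]; exact pow_ne_zero _ (Fact.out : p.Prime).ne_zero⟩
  have key : ∀ z : E, (MonoidHom.transferCenterPow E z : E) = z ^ p ^ s := fun z => by
    rw [MonoidHom.transferCenterPow_apply, hs]
  have tx : (MonoidHom.transferCenterPow E x) ^ p ^ (n + m) = 1 := by
    rw [← map_pow, pow_add, pow_mul, hx, one_pow, map_one]
  have ty : (MonoidHom.transferCenterPow E y) ^ p ^ (n + m) = 1 := by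
    rw [← map_pow, add_comm, pow_add, pow_mul, hy, one_pow, map_one]
  refine ⟨s + (n + m), ?_⟩
  rw [pow_add, pow_mul, ← key, map_mul, ← Subgroup.coe_pow,
    (show Commute (MonoidHom.transferCenterPow E x) (MonoidHom.transferCenterPow E y) from
      Subtype.ext (Subgroup.mem_center_iff.1 (MonoidHom.transferCenterPow E y).2 _)).mul_pow, tx, ty]
  simp

theorem units_eq_one_of_pow {k : Type*} [Field k] (p : ℕ) [Fact p.Prime] [CharP k p] {c : kˣ}
    {n : ℕ} (h : c ^ p ^ n = 1) : c = 1 := by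
  have : ExpChar k p := ExpChar.prime Fact.out
  refine Units.ext ?_
  have h' : (c : k) ^ (p ^ n * 1) = 1 := by
    rw [mul_one, ← Units.val_pow_eq_pow_val, h, Units.val_one]
  simpa using (ExpChar.pow_prime_pow_mul_eq_one_iff p n 1 (c : k)).1 h'

theorem exists_units_pow_eq {k : Type*} [Field k] [IsAlgClosed k] (c : kˣ) {n : ℕ} (hn : 0 < n) :
    ∃ d : kˣ, d ^ n = c := by
  obtain ⟨z, hz⟩ := IsAlgClosed.exists_pow_nat_eq (c : k) hn
  have hz0 : z ≠ 0 := by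
    rintro rfl
    rw [zero_pow hn.ne'] at hz
    exact c.ne_zero hz.symm
  exact ⟨Units.mk0 z hz0, Units.ext (by simpa using hz)⟩

end torsion

/-! ### Descent of a transport system along a quotient by `p`-groups of automorphisms. -/

theorem AutComm.map {C : Type u₁} [Category.{v₁} C] {𝓒 : Type u₂} [Category.{v₂} 𝓒] (Γ : C ⥤ 𝓒)
    {X Y : C} {φ : X ⟶ Y} {a : Aut X} {b : Aut Y} (h : AutComm φ a b) :
    AutComm (Γ.map φ) (Γ.mapAut X a) (Γ.mapAut Y b) := by
  change Γ.map a.hom ≫ Γ.map φ = Γ.map φ ≫ Γ.map b.hom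
  rw [← Γ.map_comp, ← Γ.map_comp, h]

/-- A full functor to a category of epimorphisms which identifies morphisms differing by
automorphisms in a `p`-group. -/
structure IsPQuotient (p : ℕ) {C : Type u₁} [Category.{v₁} C] {𝓒 : Type u₂} [Category.{v₂} 𝓒]
    (Γ : C ⥤ 𝓒) : Prop where
  epi : ∀ {X Y : 𝓒} (f : X ⟶ Y), Epi f
  full : Γ.Full
  exists_aut : ∀ {Q R : C} (φ ψ : Q ⟶ R), Γ.map φ = Γ.map ψ →
    ∃ u : Aut R, Γ.mapAut R u = 1 ∧ ψ = φ ≫ u.hom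
  isPGroup_ker : ∀ Q : C, IsPGroup p (Γ.mapAut Q).ker
  finite_aut : ∀ Q : C, Finite (Aut Q)

/-- Lifts of `a` and of its inverse compose, in both orders, to automorphisms; hence the lift of `a`
has a left and a right inverse. -/
theorem IsPQuotient.mapAut_surjective {p : ℕ} {C : Type u₁} [Category.{v₁} C] {𝓒 : Type u₂}
    [Category.{v₂} 𝓒] {Γ : C ⥤ 𝓒} (H : IsPQuotient p Γ) (Q : C) :
    Function.Surjective (Γ.mapAut Q) := by
  intro a
  have := H.full
  obtain ⟨φ, hφ⟩ := Γ.map_surjective a.hom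
  obtain ⟨ψ, hψ⟩ := Γ.map_surjective a.inv
  obtain ⟨u, -, hu⟩ := H.exists_aut (𝟙 Q) (φ ≫ ψ) (by
    rw [Γ.map_comp, hφ, hψ, Γ.map_id]; exact a.hom_inv_id.symm)
  obtain ⟨u', -, hu'⟩ := H.exists_aut (𝟙 Q) (ψ ≫ φ) (by
    rw [Γ.map_comp, hφ, hψ, Γ.map_id]; exact a.inv_hom_id.symm)
  rw [Category.id_comp] at hu hu'
  have h1 : φ ≫ ψ ≫ u.inv = 𝟙 Q := by rw [← Category.assoc, hu]; exact u.hom_inv_id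
  have h2 : (u'.inv ≫ ψ) ≫ φ = 𝟙 Q := by rw [Category.assoc, hu']; exact u'.inv_hom_id
  have h3 : u'.inv ≫ ψ = ψ ≫ u.inv := by
    rw [← Category.comp_id (u'.inv ≫ ψ), ← h1, ← Category.assoc, h2, Category.id_comp]
  refine ⟨⟨φ, ψ ≫ u.inv, h1, by rw [← h3, h2]⟩, Aut.ext hφ⟩

namespace KTransport

set_option linter.unusedSectionVars false

variable {k : Type w} [Field k] {C : Type u₁} [Category.{v₁} C] {𝓒 : Type u₂} [Category.{v₂} 𝓒]
  {p : ℕ} [Fact p.Prime] [CharP k p]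

variable {Γ : C ⥤ 𝓒} (H : IsPQuotient p Γ)
  (D : KTransport.{w, u₁, v₁, u₁, m} k (fun Q : C => Q))

/-- The elements of `p`-power order over the kernel of the reduction of the automorphisms. -/
def pker (Q : C) : Subgroup (D.M Q) where
  carrier := {x | Γ.mapAut Q (D.proj Q x) = 1 ∧ ∃ n, x ^ p ^ n = 1}
  one_mem' := ⟨by simp, 0, by simp⟩
  inv_mem' := by
    rintro x ⟨h, n, hn⟩
    exact ⟨by simp [h], n, by simp [hn]⟩
  mul_mem' := by
    rintro x y ⟨hx, n, hn⟩ ⟨hy, m, hm⟩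
    refine ⟨by simp [hx, hy], ?_⟩
    -- `K` is a central extension by `k*` of the `p`-group of automorphisms in the kernel, so its
    -- elements of `p`-power order are closed under products.
    let K : Subgroup (D.M Q) := ((Γ.mapAut Q).ker).comap (D.proj Q)
    let f : K →* (Γ.mapAut Q).ker := (D.proj Q).subgroupComap _
    have := H.finite_aut Q
    have hf : f.ker ≤ Subgroup.center K := by
      intro z hz
      obtain ⟨c, hc⟩ := D.exists_incl (x := (z : D.M Q)) (congrArg Subtype.val hz)
      refine Subgroup.mem_center_iff.2 fun g => Subtype.ext ?_
      change (g : D.M Q) * z = z * g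
      rw [← hc, D.central]
    obtain ⟨l, hl⟩ := exists_mul_pow_eq_one (H.isPGroup_ker Q) f hf (x := ⟨x, hx⟩) (y := ⟨y, hy⟩)
      (Subtype.ext hn) (Subtype.ext hm)
    exact ⟨l, congrArg Subtype.val hl⟩

variable {H} {D}

instance pker_normal (Q : C) : (pker H D Q).Normal where
  conj_mem := by
    rintro x ⟨h, n, hn⟩ g
    exact ⟨by simp [h], n, by rw [conj_pow, hn]; simp⟩

theorem eq_one_of_incl_mem_pker {Q : C} {c : kˣ} (h : D.incl Q c ∈ pker H D Q) : c = 1 := by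
  obtain ⟨-, n, hn⟩ := h
  rw [← map_pow, ← map_one (D.incl Q)] at hn
  exact units_eq_one_of_pow p (D.incl_injective Q hn)

/-- In characteristic `p`, `k*` has no `p`-torsion, so `pker` meets it trivially. With
`exists_mem_pker`, `pker` is a canonical copy of the kernel of `Γ.mapAut`. -/
theorem eq_of_mem_pker {Q : C} {x y : D.M Q} (hx : x ∈ pker H D Q) (hy : y ∈ pker H D Q)
    (h : D.proj Q x = D.proj Q y) : x = y := by
  obtain ⟨c, rfl⟩ := exists_mul_incl h
  have : D.incl Q c ∈ pker H D Q := (Subgroup.mul_mem_cancel_left _ hx).1 hy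
  rw [eq_one_of_incl_mem_pker this]
  simp

/-- A `p`-power of any lift of `u` is a scalar; dividing the lift by a root of it, available since
`k` is algebraically closed, gives a lift of `p`-power order. -/
theorem exists_mem_pker [IsAlgClosed k] {Q : C} {u : Aut Q} (hu : Γ.mapAut Q u = 1) :
    ∃ x ∈ pker H D Q, D.proj Q x = u := by
  obtain ⟨x, rfl⟩ := D.proj_surjective Q u
  obtain ⟨n, hn⟩ := H.isPGroup_ker Q ⟨_, hu⟩
  have hn' : D.proj Q (x ^ p ^ n) = 1 := by
    rw [map_pow]
    exact congrArg Subtype.val hn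
  obtain ⟨c, hc⟩ := D.exists_incl hn'
  obtain ⟨d, hd⟩ := exists_units_pow_eq c⁻¹ (pow_pos (Fact.out : p.Prime).pos n)
  refine ⟨x * D.incl Q d, ⟨by simp [D.proj_incl, hu], n, ?_⟩, by simp [D.proj_incl]⟩
  rw [(show Commute x (D.incl Q d) from (D.central Q d x).symm).mul_pow, ← hc, ← map_pow, hd]
  simp

theorem mem_pker_of_rel {Q R : C} {φ : Q ⟶ R} {x : D.M Q} {y : D.M R} (h : D.rel φ x y)
    (hx : x ∈ pker H D Q) : y ∈ pker H D R := by
  obtain ⟨hx1, n, hn⟩ := hx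
  have hepi := @H.epi
  have hy1 : Γ.mapAut R (D.proj R y) = 1 := by
    have := (D.rel_comm h).map Γ
    rw [hx1] at this
    exact this.right_unique (AutComm.one _)
  obtain ⟨m, hm⟩ := H.isPGroup_ker R ⟨_, hy1⟩
  have hm' : D.proj R y ^ p ^ m = 1 := congrArg Subtype.val hm
  refine ⟨hy1, n + m, ?_⟩
  -- This power of `y` is a scalar and is transported from `1`, so it is `1`.
  have h' := rel_pow h (p ^ (n + m))
  rw [pow_add, pow_mul x, hn, one_pow] at h'
  obtain ⟨c, hc⟩ := D.exists_incl (x := y ^ (p ^ n * p ^ m)) (by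
    rw [map_pow, mul_comm, pow_mul, hm', one_pow])
  rw [← hc] at h'
  rw [pow_add, ← hc, D.rel_unique h', map_one]

/-- The transport along an automorphism in the kernel of the reduction is the conjugation by its
lift of `p`-power order. -/
theorem eq_conj_of_rel [IsAlgClosed k] {R : C} {u : Aut R} {v y y' : D.M R} (hv : v ∈ pker H D R)
    (hu : D.proj R v = u) (h : D.rel u.hom y y') : y' = v * y * v⁻¹ := by
  have pr : ∀ {y y'}, D.rel u.hom y y' → D.proj R y' = D.proj R (v * y * v⁻¹) := by
    intro y y' h
    have := D.rel_comm h
    rw [map_mul, map_mul, map_inv, hu]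
    refine Aut.ext ?_
    change _ = u.inv ≫ (D.proj R y).hom ≫ u.hom
    exact (Iso.eq_inv_comp u).2 this.symm
  obtain ⟨c, hc⟩ := exists_mul_incl (pr h).symm
  -- Transport preserves `pker`, and over `u` there is only one element of it.
  have hvv : D.rel u.hom v v := by
    obtain ⟨v', hv', hr⟩ := D.rel_exists (φ := u.hom) v u (by rw [hu]; rfl)
    rwa [eq_of_mem_pker (mem_pker_of_rel hr hv) hv (by rw [hu, hv'])] at hr
  -- A priori transport along `u` is conjugation by `v` up to a scalar `c`. Iterating `n` times
  -- multiplies by `c ^ n`; for `n` the `p`-power order of `v`, both transport and conjugation are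
  -- trivial, so `c` has `p`-power order and equals `1`.
  have key : ∀ n : ℕ, D.rel (u ^ n).hom y (v ^ n * y * v⁻¹ ^ n * D.incl R c ^ n) := by
    intro n
    induction n with
    | zero =>
      have e : v ^ 0 * y * v⁻¹ ^ 0 * D.incl R c ^ 0 = y := by simp
      rw [e, pow_zero]
      exact D.rel_id y
    | succ n ih =>
      have e' : (u ^ (n + 1)).hom = (u ^ n).hom ≫ u.hom := congrArg Iso.hom (pow_succ' u n)
      rw [e']
      refine D.rel_comp ih ?_
      have hn : ∀ n : ℕ, D.rel u.hom (v ^ n * y * v⁻¹ ^ n * D.incl R c ^ n)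
          (v ^ n * y' * v⁻¹ ^ n * D.incl R c ^ n) := by
        intro n
        refine D.rel_mul (D.rel_mul (D.rel_mul (rel_pow hvv n) h) (rel_pow (rel_inv hvv) n)) ?_
        exact rel_pow (D.rel_incl _ c) n
      have := hn n
      rw [hc] at this
      convert this using 1
      have hcc : ∀ z, D.incl R c * z = z * D.incl R c := D.central R c
      calc v ^ (n + 1) * y * v⁻¹ ^ (n + 1) * D.incl R c ^ (n + 1)
          = v ^ n * (v * y * v⁻¹) * (v⁻¹ ^ n * D.incl R c) * D.incl R c ^ n := by
            rw [pow_succ, pow_succ' v⁻¹, pow_succ' (D.incl R c)]; group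
        _ = v ^ n * (v * y * v⁻¹ * D.incl R c) * v⁻¹ ^ n * D.incl R c ^ n := by
            rw [← hcc]; group
  obtain ⟨hv1, n, hn⟩ := hv
  have hun : u ^ p ^ n = 1 := by rw [← hu, ← map_pow, hn, map_one]
  have := key (p ^ n)
  rw [hun, hn, inv_pow, hn] at this
  have h1 := rel_right_unique (D.rel_id y) this (by simp [D.proj_incl])
  have h2 : D.incl R c ^ p ^ n = 1 := by simpa using h1.symm
  rw [← map_pow, ← map_one (D.incl R)] at h2
  rw [hc, units_eq_one_of_pow p (D.incl_injective R h2)]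
  simp

/-- The classes modulo `pker` of elements that correspond to each other by transport along a
morphism depend only on the reduction of the morphism. -/
theorem exists_rel_of_rel [IsAlgClosed k] {Q R : C} {φ φ' : Q ⟶ R} (hφ : Γ.map φ = Γ.map φ')
    {x x' : D.M Q} {y : D.M R} (h : D.rel φ x y) (hx : x⁻¹ * x' ∈ pker H D Q) :
    ∃ y', y⁻¹ * y' ∈ pker H D R ∧ D.rel φ' x' y' := by
  obtain ⟨u, hu, rfl⟩ := H.exists_aut φ φ' hφ
  have hfull := H.full
  have hepi := @H.epi
  -- First the change of representative at the source: an automorphism in the kernel extends along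
  -- `φ`, since composing with it does not alter the reduction of `φ`. Replacing `φ` by `φ ≫ u.hom`
  -- is then a conjugation by an element of `pker`.
  obtain ⟨z, hz, hr⟩ : ∃ z ∈ pker H D R, D.rel φ (x⁻¹ * x') z := by
    have e : Γ.map φ = Γ.map ((D.proj Q (x⁻¹ * x')).hom ≫ φ) := by
      have : Γ.map (D.proj Q (x⁻¹ * x')).hom = 𝟙 _ := congrArg Iso.hom hx.1
      rw [Γ.map_comp, this, Category.id_comp]
    obtain ⟨b, hb, e⟩ := H.exists_aut _ _ e
    obtain ⟨z, -, hr⟩ := D.rel_exists (φ := φ) (x⁻¹ * x') b e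
    exact ⟨z, mem_pker_of_rel hr hx, hr⟩
  have h' := D.rel_mul h hr
  rw [mul_inv_cancel_left] at h'
  obtain ⟨v, hv, hvu⟩ := exists_mem_pker (H := H) (D := D) hu
  obtain ⟨y', -, hy'⟩ := D.rel_exists (φ := u.hom) (y * z) (u * D.proj R (y * z) * u⁻¹) (by
    change _ ≫ u.hom = u.hom ≫ u.inv ≫ _ ≫ u.hom
    rw [← Category.assoc u.hom]
    exact ((congrArg (· ≫ _) u.hom_inv_id).trans (Category.id_comp _)).symm)
  refine ⟨y', ?_, D.rel_comp h' hy'⟩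
  rw [eq_conj_of_rel hv hvu hy']
  have e : y⁻¹ * (v * (y * z) * v⁻¹) = (y⁻¹ * v * y⁻¹⁻¹) * (z * v⁻¹) := by group
  rw [e]
  exact mul_mem ((pker_normal R).conj_mem _ hv _) (mul_mem hz (inv_mem hv))

variable (H D)

/-- The transport system induced on a quotient of the category. -/
def descend [IsAlgClosed k] : KTransport.{w, u₁, v₂, u₂, m} k Γ.obj where
  M Q := D.M Q ⧸ pker H D Q
  incl Q := (QuotientGroup.mk' _).comp (D.incl Q)
  proj Q := QuotientGroup.lift _ ((Γ.mapAut Q).comp (D.proj Q)) fun _ h => h.1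
  incl_injective Q := by
    rw [injective_iff_map_eq_one]
    intro c hc
    exact eq_one_of_incl_mem_pker ((QuotientGroup.eq_one_iff _).1 hc)
  proj_surjective Q a := by
    obtain ⟨b, rfl⟩ := H.mapAut_surjective Q a
    obtain ⟨x, rfl⟩ := D.proj_surjective Q b
    exact ⟨x, rfl⟩
  proj_incl Q c := by
    change Γ.mapAut Q (D.proj Q (D.incl Q c)) = 1
    rw [D.proj_incl, map_one]
  exists_incl {Q x} h := by
    induction x using QuotientGroup.induction_on with
    | H x =>
    -- An element over the kernel is an element of `pker` times a scalar.
    obtain ⟨v, hv, hvx⟩ := exists_mem_pker (H := H) (D := D) (u := D.proj Q x) h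
    obtain ⟨c, rfl⟩ := exists_mul_incl hvx
    refine ⟨c, QuotientGroup.eq.2 ?_⟩
    rw [← D.central, inv_mul_cancel_left]
    exact hv
  central Q c x := by
    induction x using QuotientGroup.induction_on with
    | H x => exact congrArg _ (D.central Q c x)
  rel {Q R} φ X Y := ∃ (φ' : Q ⟶ R) (x : D.M Q) (y : D.M R), Γ.map φ' = φ ∧
    (x : D.M Q ⧸ pker H D Q) = X ∧ (y : D.M R ⧸ pker H D R) = Y ∧ D.rel φ' x y
  rel_comm := by
    rintro Q R _ _ _ ⟨φ, x, y, rfl, rfl, rfl, h⟩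
    exact (D.rel_comm h).map Γ
  rel_exists := by
    intro Q R φ X b h
    have := H.full
    obtain ⟨φ, rfl⟩ := Γ.map_surjective φ
    obtain ⟨b, rfl⟩ := H.mapAut_surjective R b
    induction X using QuotientGroup.induction_on with
    | H x =>
    have e : Γ.map (φ ≫ b.hom) = Γ.map ((D.proj Q x).hom ≫ φ) := by
      rw [Γ.map_comp, Γ.map_comp]
      exact h.symm
    obtain ⟨u, hu, e⟩ := H.exists_aut _ _ e
    obtain ⟨y, hy, hr⟩ := D.rel_exists (φ := φ) x (u * b) (e.trans (Category.assoc _ _ _))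
    refine ⟨y, ?_, φ, x, y, rfl, rfl, rfl, hr⟩
    change Γ.mapAut R (D.proj R y) = _
    rw [hy, map_mul, hu, one_mul]
  rel_mul := by
    rintro Q R _ _ _ _ _ ⟨φ, x, y, rfl, rfl, rfl, h⟩ ⟨φ', x', y', hφ, rfl, rfl, h'⟩
    obtain ⟨z, hz, hr⟩ := exists_rel_of_rel (H := H) (x' := x') hφ h' (by simp)
    exact ⟨φ, x * x', y * z, rfl, rfl, congrArg (fun t => (y : D.M R ⧸ pker H D R) * t)
      (QuotientGroup.eq.2 hz).symm, D.rel_mul h hr⟩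
  rel_incl {Q R} φ c := by
    have := H.full
    obtain ⟨φ, rfl⟩ := Γ.map_surjective φ
    exact ⟨φ, _, _, rfl, rfl, rfl, D.rel_incl φ c⟩
  rel_unique := by
    rintro Q R _ c ⟨φ, x, y, rfl, hx, hy, h⟩
    have hx' : x ∈ pker H D Q := (QuotientGroup.eq_one_iff x).1 hx
    have hy' := mem_pker_of_rel h hx'
    exact eq_one_of_incl_mem_pker
      ((QuotientGroup.eq_one_iff _).1 (hy.symm.trans ((QuotientGroup.eq_one_iff _).2 hy')))
  rel_id {Q} X := by
    induction X using QuotientGroup.induction_on with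
    | H x => exact ⟨𝟙 Q, x, x, Γ.map_id Q, rfl, rfl, D.rel_id x⟩
  rel_comp := by
    rintro Q R T _ _ _ _ _ ⟨φ, x, y, rfl, rfl, rfl, h⟩ ⟨ψ, y', z, rfl, hy, rfl, h'⟩
    obtain ⟨z', hz, hr⟩ := exists_rel_of_rel (H := H) (x' := y) rfl h' (QuotientGroup.eq.1 hy)
    exact ⟨φ ≫ ψ, x, z', Γ.map_comp _ _, rfl, (QuotientGroup.eq.2 hz).symm, D.rel_comp h hr⟩

end KTransport

/-! ## Liftings in terms of elements -/

namespace KStarLifting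

variable {k : Type w} [Field k] {C : Type u₁} [Category.{v₁} C] {A : C ⥤ GrpCat.{u}}
  (L : KStarLifting.{w, u} k A)

/-- The `k*`-group over the group `A.obj c`. -/
abbrev tot (c : C) : Type (max u w) := (L.functor.obj c).total

/-- The inclusion of `k*`. -/
abbrev inc (c : C) : kˣ →* L.tot c := (L.functor.obj c).incl

/-- The projection onto `A.obj c`. -/
def pr (c : C) : L.tot c →* A.obj c := (L.iso.hom.app c).hom.comp (L.functor.obj c).proj

/-- The homomorphism determined by a morphism. -/
abbrev tr {c d : C} (f : c ⟶ d) : L.tot c →* L.tot d := (L.functor.map f).toTotal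

variable {L} {c d e : C}

theorem isoHom_bijective (c : C) : Function.Bijective (L.iso.hom.app c).hom := by
  have h1 := L.iso.hom_inv_id_app c
  have h2 := L.iso.inv_hom_id_app c
  exact Function.bijective_iff_has_inverse.2 ⟨(L.iso.inv.app c).hom,
    fun x => congrArg (fun f => f.hom x) h1, fun x => congrArg (fun f => f.hom x) h2⟩

theorem pr_surjective (c : C) : Function.Surjective (L.pr c) :=
  (isoHom_bijective c).2.comp (L.functor.obj c).proj_surjective

theorem pr_inc (x : kˣ) : L.pr c (L.inc c x) = 1 := by
  have : (L.functor.obj c).incl x ∈ (L.functor.obj c).proj.ker := by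
    rw [(L.functor.obj c).ker_proj]
    exact ⟨x, rfl⟩
  exact (congrArg (L.iso.hom.app c).hom this).trans (map_one _)

theorem exists_inc {x : L.tot c} (h : L.pr c x = 1) : ∃ a, L.inc c a = x := by
  have h1 : (L.functor.obj c).proj x = 1 :=
    (isoHom_bijective c).1 (h.trans (map_one (L.iso.hom.app c).hom).symm)
  have : x ∈ (L.functor.obj c).proj.ker := h1
  rwa [(L.functor.obj c).ker_proj] at this

theorem exists_inc_mul {x y : L.tot c} (h : L.pr c x = L.pr c y) : ∃ a, y = L.inc c a * x := by
  obtain ⟨a, ha⟩ := exists_inc (x := y * x⁻¹) (by rw [map_mul, map_inv, h, mul_inv_cancel])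
  exact ⟨a, by rw [ha]; simp⟩

theorem inc_central (a : kˣ) (x : L.tot c) : L.inc c a * x = x * L.inc c a :=
  (Subgroup.mem_center_iff.1 ((L.functor.obj c).central ⟨a, rfl⟩) x).symm

theorem tr_inc (f : c ⟶ d) (a : kˣ) : L.tr f (L.inc c a) = L.inc d a :=
  DFunLike.congr_fun (L.functor.map f).comp_incl a

theorem pr_tr (f : c ⟶ d) (x : L.tot c) : L.pr d (L.tr f x) = (A.map f).hom (L.pr c x) := by
  have h1 := DFunLike.congr_fun (L.functor.map f).proj_comp x
  have h2 := congrArg (fun g => g.hom ((L.functor.obj c).proj x)) (L.iso.hom.naturality f)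
  exact (congrArg (L.iso.hom.app d).hom h1).trans h2

theorem tr_id (x : L.tot c) : L.tr (𝟙 c) x = x := by
  change (L.functor.map (𝟙 c)).toTotal x = x
  rw [L.functor.map_id]
  rfl

theorem tr_comp (f : c ⟶ d) (g : d ⟶ e) (x : L.tot c) : L.tr (f ≫ g) x = L.tr g (L.tr f x) := by
  change (L.functor.map (f ≫ g)).toTotal x = _
  rw [L.functor.map_comp]
  rfl

/-- As `tr f` is the identity on `k*`, it is injective over each element of `A.obj c`. Together with
`exists_tr_eq` this says that the `k*`-group at `c` is the pullback of the one at `d` along `A.map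
f`. -/
theorem eq_of_tr_eq (f : c ⟶ d) {x y : L.tot c} (h : L.tr f x = L.tr f y)
    (hp : L.pr c x = L.pr c y) : x = y := by
  obtain ⟨a, rfl⟩ := exists_inc_mul hp
  rw [map_mul, tr_inc] at h
  have h1 : L.inc d a = 1 := by simpa using h
  rw [(L.functor.obj d).incl_injective (h1.trans (map_one _).symm)]
  simp

theorem exists_tr_eq (f : c ⟶ d) (y : L.tot d) (a : A.obj c) (h : (A.map f).hom a = L.pr d y) :
    ∃ x, L.pr c x = a ∧ L.tr f x = y := by
  obtain ⟨x, rfl⟩ := pr_surjective (L := L) c a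
  rw [← pr_tr] at h
  obtain ⟨b, rfl⟩ := exists_inc_mul h
  exact ⟨L.inc c b * x, by rw [map_mul, pr_inc, one_mul], by rw [map_mul, tr_inc]⟩

variable {L' L'' : KStarLifting.{w, u} k A}

/-- The natural transformation underlying a morphism of liftings. -/
abbrev Hom.nat (f : L ⟶ L') : L.functor ⟶ L'.functor := KStarLifting.Hom.natTrans f

/-- The components of a morphism of liftings. -/
def Hom.at (f : L ⟶ L') (c : C) : L.tot c →* L'.tot c :=
  ((Hom.nat f).app c).toTotal

theorem at_inc (f : L ⟶ L') (a : kˣ) : Hom.at f c (L.inc c a) = L'.inc c a :=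
  DFunLike.congr_fun ((Hom.nat f).app c).comp_incl a

theorem pr_at (f : L ⟶ L') (x : L.tot c) : L'.pr c (Hom.at f c x) = L.pr c x := by
  have h1 := DFunLike.congr_fun ((Hom.nat f).app c).proj_comp x
  have h2 := NatTrans.congr_app (KStarLifting.Hom.comm f) c
  exact (congrArg (L'.iso.hom.app c).hom h1).trans
    (congrArg (fun g => g.hom ((L.functor.obj c).proj x)) h2)

theorem at_tr (f : L ⟶ L') (g : c ⟶ d) (x : L.tot c) :
    Hom.at f d (L.tr g x) = L'.tr g (Hom.at f c x) := by
  have := (Hom.nat f).naturality g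
  exact congrArg (fun h : L.functor.obj c ⟶ L'.functor.obj d => h.toTotal x) this

theorem hom_ext' {f g : L ⟶ L'} (h : ∀ c x, Hom.at f c x = Hom.at g c x) : f = g := by
  refine KStarLifting.Hom.ext (NatTrans.ext (funext fun c => ?_))
  have h1 : ((Hom.nat f).app c).toTotal =
      ((Hom.nat g).app c).toTotal := MonoidHom.ext (h c)
  refine KStarGrp.Hom.ext h1 (MonoidHom.ext fun b => ?_)
  obtain ⟨x, rfl⟩ := (L.functor.obj c).proj_surjective b
  have h2 := DFunLike.congr_fun ((Hom.nat f).app c).proj_comp x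
  have h3 := DFunLike.congr_fun ((Hom.nat g).app c).proj_comp x
  refine h2.symm.trans (Eq.trans ?_ h3)
  exact congrArg (L'.functor.obj c).proj (h c x)

/-- A morphism of liftings given by its components. -/
def homMk (f : ∀ c, L.tot c →* L'.tot c) (hinc : ∀ c a, f c (L.inc c a) = L'.inc c a)
    (hpr : ∀ c x, L'.pr c (f c x) = L.pr c x)
    (htr : ∀ {c d} (g : c ⟶ d) x, f d (L.tr g x) = L'.tr g (f c x)) : L ⟶ L' :=
  KStarLifting.Hom.mk
    { app := fun c =>
        { toTotal := f c
          toBase := (L'.iso.inv.app c).hom.comp (L.iso.hom.app c).hom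
          comp_incl := MonoidHom.ext (hinc c)
          proj_comp := MonoidHom.ext fun x => (isoHom_bijective c).1 ((hpr c x).trans
            (congrArg (fun g => g.hom (L.pr c x)) (L'.iso.inv_hom_id_app c)).symm) }
      naturality := fun c d g => by
        refine KStarGrp.Hom.ext (MonoidHom.ext (htr g)) (MonoidHom.ext fun b => ?_)
        have h1 := L.iso.hom.naturality g
        have h2 := L'.iso.inv.naturality g
        change (L'.iso.inv.app d).hom ((L.iso.hom.app d).hom ((L.functor.map g).toBase b)) =
          (L'.functor.map g).toBase ((L'.iso.inv.app c).hom ((L.iso.hom.app c).hom b))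
        have h3 := congrArg (fun g => g.hom b) h1
        have h4 := congrArg (fun f => f.hom ((L.iso.hom.app c).hom b)) h2
        exact (congrArg (L'.iso.inv.app d).hom h3).trans h4 }
    (by
      ext c b
      exact congrArg (fun g => g.hom ((L.iso.hom.app c).hom b)) (L'.iso.inv_hom_id_app c))

theorem at_bijective (f : L ⟶ L') (c : C) : Function.Bijective (Hom.at f c) := by
  constructor
  · rw [injective_iff_map_eq_one]
    intro x hx
    obtain ⟨a, rfl⟩ := exists_inc (x := x) (by rw [← pr_at f, hx, map_one])
    rw [at_inc] at hx
    rw [(L'.functor.obj c).incl_injective (hx.trans (map_one _).symm), map_one]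
  · intro y
    obtain ⟨x, hx⟩ := pr_surjective (L := L) c (L'.pr c y)
    obtain ⟨a, rfl⟩ := exists_inc_mul ((pr_at f x).trans hx)
    exact ⟨L.inc c a * x, by rw [map_mul, at_inc]⟩

/-- All the morphisms of liftings are isomorphisms. -/
instance (f : L ⟶ L') : IsIso f := by
  let e : ∀ c, L.tot c ≃* L'.tot c := fun c => MulEquiv.ofBijective (Hom.at f c) (at_bijective f c)
  have he : ∀ c x, Hom.at f c ((e c).symm x) = x := fun c x => (e c).apply_symm_apply x
  let g : L' ⟶ L := homMk (fun c => (e c).symm.toMonoidHom)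
    (fun c a => (at_bijective f c).1 ((he c _).trans (at_inc f a).symm))
    (fun c x => (pr_at f _).symm.trans (congrArg _ (he c x)))
    (fun {c d} g x => (at_bijective f d).1 ((he d _).trans
      ((at_tr f g _).trans (congrArg _ (he c x))).symm))
  refine ⟨g, hom_ext' fun c x => (e c).symm_apply_apply x, hom_ext' fun c x => he c x⟩

/-- By the pullback property, equality of morphisms of liftings propagates backwards along any
arrow; forwards it needs surjectivity of `A.map`, as in `at_eq_of_source`. -/
theorem at_eq_of_target {f g : L ⟶ L'} (h : c ⟶ d) (hd : ∀ x, Hom.at f d x = Hom.at g d x)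
    (x : L.tot c) : Hom.at f c x = Hom.at g c x :=
  eq_of_tr_eq h (by rw [← at_tr, ← at_tr, hd]) (by rw [pr_at, pr_at])

theorem at_eq_of_source {f g : L ⟶ L'} (h : c ⟶ d) (hs : Function.Surjective (A.map h).hom)
    (hc : ∀ x, Hom.at f c x = Hom.at g c x) (y : L.tot d) : Hom.at f d y = Hom.at g d y := by
  obtain ⟨a, ha⟩ := hs (L.pr d y)
  obtain ⟨x, -, rfl⟩ := exists_tr_eq h y a ha
  rw [at_tr, at_tr, hc]

end KStarLifting

/-! ## Chains of length zero and one -/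

namespace Chain

variable {C : Type u₁} [Category.{v₁} C]

theorem hom_ext' {q r : Chain C} {f g : q ⟶ r} (hδ : ∀ i : Fin (r.dim + 1), (Hom.δ f).obj i = (Hom.δ g).obj i)
    (hν : ∀ i : Fin (r.dim + 1), (Hom.ν f).hom.app i =
      q.functor.map (eqToHom (hδ i)) ≫ (Hom.ν g).hom.app i) : f = g := by
  obtain ⟨δ, ν⟩ := f
  obtain ⟨δ', ν'⟩ := g
  obtain rfl : δ = δ' := CategoryTheory.Functor.ext hδ (fun _ _ _ => Subsingleton.elim _ _)
  refine Hom.ext rfl (heq_of_eq ?_)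
  ext i
  simpa using! hν i

theorem comp_ν_app {q r s : Chain C} (f : q ⟶ r) (g : r ⟶ s) (i : Fin (s.dim + 1)) :
    (Hom.ν (f ≫ g)).hom.app i = (Hom.ν f).hom.app ((Hom.δ g).obj i) ≫ (Hom.ν g).hom.app i :=
  Category.id_comp _

/-- The chain of length zero on an object. -/
def pt (Q : C) : Chain C := ⟨0, (Functor.const _).obj Q⟩

/-- The chain of length one on a morphism. -/
def ar {Q R : C} (φ : Q ⟶ R) : Chain C := ⟨1, ComposableArrows.mk₁ φ⟩

/-- The morphism from a chain to a chain of length zero given by one of its objects. -/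
def toPt (q : Chain C) (i : Fin (q.dim + 1)) {R : C} (e : q.functor.obj i ≅ R) : q ⟶ pt R :=
  Hom.mk (q := q) (r := pt R) ((Functor.const _).obj i)
    (NatIso.ofComponents (fun _ => e) (fun f => by
      have : ((Functor.const (Fin (0 + 1))).obj i).map f = 𝟙 i := rfl
      change q.functor.map (𝟙 i) ≫ e.hom = e.hom ≫ 𝟙 R
      simp))

/-- The morphism from a chain to a chain of length one given by two of its objects. -/
def toAr (q : Chain C) {i j : Fin (q.dim + 1)} (h : i ≤ j) {Q R : C} (φ : Q ⟶ R)
    (e : q.functor.obj i ≅ Q) (e' : q.functor.obj j ≅ R)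
    (hc : q.functor.map (homOfLE h) ≫ e'.hom = e.hom ≫ φ) : q ⟶ ar φ :=
  Hom.mk (q := q) (r := ar φ) (ComposableArrows.mk₁ (homOfLE h))
    (ComposableArrows.isoMk₁ (F := ComposableArrows.mk₁ (homOfLE h) ⋙ q.functor)
      (G := ComposableArrows.mk₁ φ) e e' hc)

/-- The source of a chain of length one. -/
abbrev src {Q R : C} (φ : Q ⟶ R) : ar φ ⟶ pt Q := toPt (ar φ) (0 : Fin 2) (Iso.refl Q)

/-- The target of a chain of length one. -/
abbrev tgt {Q R : C} (φ : Q ⟶ R) : ar φ ⟶ pt R := toPt (ar φ) (1 : Fin 2) (Iso.refl R)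

theorem toAr_src (q : Chain C) {i j : Fin (q.dim + 1)} (h : i ≤ j) {Q R : C} (φ : Q ⟶ R)
    (e : q.functor.obj i ≅ Q) (e' : q.functor.obj j ≅ R) (hc) :
    toAr q h φ e e' hc ≫ src φ = toPt q i e := by
  refine hom_ext' (fun _ => rfl) fun t => ?_
  rw [comp_ν_app]
  change e.hom ≫ 𝟙 Q = q.functor.map (𝟙 i) ≫ e.hom
  simp

theorem toAr_tgt (q : Chain C) {i j : Fin (q.dim + 1)} (h : i ≤ j) {Q R : C} (φ : Q ⟶ R)
    (e : q.functor.obj i ≅ Q) (e' : q.functor.obj j ≅ R) (hc) :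
    toAr q h φ e e' hc ≫ tgt φ = toPt q j e' := by
  refine hom_ext' (fun _ => rfl) fun t => ?_
  rw [comp_ν_app]
  change e'.hom ≫ 𝟙 R = q.functor.map (𝟙 j) ≫ e'.hom
  simp

theorem comp_toPt {q r : Chain C} (f : q ⟶ r) (i : Fin (r.dim + 1)) {R : C}
    (e : r.functor.obj i ≅ R) :
    f ≫ toPt r i e = toPt q ((Hom.δ f).obj i) ((Hom.ν f).app i ≪≫ e) := by
  refine hom_ext' (fun _ => rfl) fun t => ?_
  rw [comp_ν_app]
  change (Hom.ν f).hom.app i ≫ e.hom = q.functor.map (𝟙 _) ≫ (Hom.ν f).hom.app i ≫ e.hom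
  rw [q.functor.map_id]
  exact (Category.id_comp _).symm

theorem toPt_pt (Q : C) : toPt (pt Q) 0 (Iso.refl Q) = 𝟙 (pt Q) := by
  refine hom_ext' (fun i => (Fin.eq_zero i).symm) fun t => ?_
  change 𝟙 Q = 𝟙 Q ≫ 𝟙 Q
  simp

/-- The automorphism of an object of a chain determined by an automorphism of the chain. -/
def evalAut (q : Chain C) (i : Fin (q.dim + 1)) : Aut q.functor →* Aut (q.functor.obj i) where
  toFun σ := Iso.app (show q.functor ≅ q.functor from σ) i
  map_one' := rfl
  map_mul' _ _ := rfl

theorem aut_ext {q : Chain C} {σ τ : Aut q.functor} (h : ∀ i, evalAut q i σ = evalAut q i τ) :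
    σ = τ :=
  Aut.ext (NatTrans.ext (funext fun i => congrArg Iso.hom (h i)))

theorem autComm_map {q : Chain C} (σ : Aut q.functor) {i j : Fin (q.dim + 1)} (h : i ⟶ j) :
    AutComm (q.functor.map h) (evalAut q i σ) (evalAut q j σ) :=
  (σ.hom.naturality h).symm

theorem autComm_ν {q r : Chain C} (f : q ⟶ r) (σ : Aut q.functor) (i : Fin (r.dim + 1)) :
    AutComm ((Hom.ν f).hom.app i) (evalAut q ((Hom.δ f).obj i) σ)
      (evalAut r i (autMap f σ)) := by
  change _ = (Hom.ν f).hom.app i ≫ (Hom.ν f).inv.app i ≫ σ.hom.app _ ≫ (Hom.ν f).hom.app i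
  rw [← Category.assoc ((Hom.ν f).hom.app i), Iso.hom_inv_id_app]
  exact (Category.id_comp _).symm

theorem evalAut_toPt (q : Chain C) (i : Fin (q.dim + 1)) (σ : Aut q.functor) :
    evalAut (pt _) 0 (autMap (toPt q i (Iso.refl _)) σ) = evalAut q i σ := by
  have := autComm_ν (toPt q i (Iso.refl _)) σ (0 : Fin 1)
  exact AutComm.right_unique (φ := 𝟙 (q.functor.obj i)) this (AutComm.id _)

theorem evalAut_pt_bijective (Q : C) : Function.Bijective (evalAut (pt Q) (0 : Fin 1)) := by
  refine ⟨fun σ τ h => aut_ext fun i => ?_, fun a => ?_⟩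
  · obtain rfl := Fin.eq_zero i
    exact h
  · exact ⟨NatIso.ofComponents (fun _ => a) (fun _ =>
      (Category.id_comp a.hom).trans (Category.comp_id a.hom).symm), rfl⟩

theorem exists_aut_ar {Q R : C} {φ : Q ⟶ R} {a : Aut Q} {b : Aut R} (h : AutComm φ a b) :
    ∃ σ : Aut (ar φ).functor, evalAut (ar φ) (0 : Fin 2) σ = a ∧
      evalAut (ar φ) (1 : Fin 2) σ = b :=
  ⟨ComposableArrows.isoMk₁ (F := ComposableArrows.mk₁ φ) (G := ComposableArrows.mk₁ φ) a b h.symm,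
    Aut.ext rfl, Aut.ext rfl⟩

theorem aut_ar_ext {Q R : C} {φ : Q ⟶ R} {σ τ : Aut (ar φ).functor}
    (h0 : evalAut (ar φ) (0 : Fin 2) σ = evalAut (ar φ) (0 : Fin 2) τ)
    (h1 : evalAut (ar φ) (1 : Fin 2) σ = evalAut (ar φ) (1 : Fin 2) τ) : σ = τ := by
  refine aut_ext fun i => ?_
  change Fin 2 at i
  fin_cases i
  · exact h0
  · exact h1

/-- The chain of length two on two composable morphisms. -/
def ar₂ {Q R T : C} (φ : Q ⟶ R) (ψ : R ⟶ T) : Chain C := ⟨2, ComposableArrows.mk₂ φ ψ⟩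

theorem exists_aut_ar₂ {Q R T : C} {φ : Q ⟶ R} {ψ : R ⟶ T} {a : Aut Q} {b : Aut R} {c : Aut T}
    (h : AutComm φ a b) (h' : AutComm ψ b c) :
    ∃ σ : Aut (ar₂ φ ψ).functor, evalAut (ar₂ φ ψ) (0 : Fin 3) σ = a ∧
      evalAut (ar₂ φ ψ) (1 : Fin 3) σ = b ∧ evalAut (ar₂ φ ψ) (2 : Fin 3) σ = c :=
  ⟨ComposableArrows.isoMk₂ (f := ComposableArrows.mk₂ φ ψ) (g := ComposableArrows.mk₂ φ ψ) a b c
    h.symm h'.symm, Aut.ext rfl, Aut.ext rfl, Aut.ext rfl⟩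

/-- The morphism between the first objects of two chains determined by a morphism of chains. -/
def head {q r : Chain C} (f : q ⟶ r) : q.functor.obj 0 ⟶ r.functor.obj 0 :=
  q.functor.map (homOfLE (Fin.zero_le _)) ≫ (Hom.ν f).hom.app 0

theorem head_id (q : Chain C) : head (𝟙 q) = 𝟙 _ := by
  change q.functor.map (𝟙 0) ≫ 𝟙 _ = 𝟙 _
  simp

/-- Naturality of the first isomorphism makes the first object of a chain functorial in the chain,
so that a transport system defines a functor on chains. -/
theorem head_comp {q r s : Chain C} (f : q ⟶ r) (g : r ⟶ s) : head (f ≫ g) = head f ≫ head g := by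
  have := (Hom.ν f).hom.naturality (homOfLE (Fin.zero_le ((Hom.δ g).obj 0)))
  change q.functor.map _ ≫ (Hom.ν f).hom.app _ = (Hom.ν f).hom.app 0 ≫ r.functor.map _ at this
  rw [head, head, head, comp_ν_app, Category.assoc, ← Category.assoc ((Hom.ν f).hom.app 0)]
  rw [← this, Category.assoc, ← Category.assoc (q.functor.map _) (q.functor.map _),
    ← q.functor.map_comp]
  rfl

theorem autComm_head {q r : Chain C} (f : q ⟶ r) (σ : Aut q.functor) :
    AutComm (head f) (evalAut q 0 σ) (evalAut r 0 (autMap f σ)) :=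
  (autComm_map σ _).comp (autComm_ν f σ 0)

end Chain

/-! ## Liftings and transport systems -/

namespace KTransport

open KStarLifting Chain

variable {k : Type w} [Field k] {C : Type u₁} [Category.{u} C]

theorem _root_.AutComm.congr {𝓓 : Type u₂} [Category.{v₂} 𝓓] {Q R : 𝓓} {φ : Q ⟶ R} {a a' : Aut Q}
    {b b' : Aut R} (h : AutComm φ a b) (ha : a' = a) (hb : b' = b) : AutComm φ a' b' := by
  subst ha hb
  exact h

theorem evalAut_pr_tr_toPt (L : KStarLifting.{w, u} k (Chain.aut C)) (q : Chain C)
    (i : Fin (q.dim + 1)) (z : L.tot q) :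
    evalAut (pt _) (0 : Fin 1) (L.pr _ (L.tr (toPt q i (Iso.refl _)) z)) =
      evalAut q i (L.pr q z) := by
  rw [pr_tr]
  exact evalAut_toPt q i _

theorem evalAut_pr_src (L : KStarLifting.{w, u} k (Chain.aut C)) {Q R : C} {φ : Q ⟶ R}
    (z : L.tot (ar φ)) : evalAut (pt Q) (0 : Fin 1) (L.pr _ (L.tr (src φ) z)) =
      evalAut (ar φ) (0 : Fin 2) (L.pr _ z) :=
  evalAut_pr_tr_toPt L (ar φ) (0 : Fin 2) z

theorem evalAut_pr_tgt (L : KStarLifting.{w, u} k (Chain.aut C)) {Q R : C} {φ : Q ⟶ R}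
    (z : L.tot (ar φ)) : evalAut (pt R) (0 : Fin 1) (L.pr _ (L.tr (tgt φ) z)) =
      evalAut (ar φ) (1 : Fin 2) (L.pr _ z) :=
  evalAut_pr_tr_toPt L (ar φ) (1 : Fin 2) z

theorem autComm_ar {Q R : C} (φ : Q ⟶ R) (σ : Aut (ar φ).functor) :
    AutComm φ (evalAut (ar φ) (0 : Fin 2) σ) (evalAut (ar φ) (1 : Fin 2) σ) :=
  autComm_map (q := ar φ) σ (i := (0 : Fin 2)) (j := (1 : Fin 2)) (homOfLE (by simp))

theorem tr_src_toAr (L : KStarLifting.{w, u} k (Chain.aut C)) (q : Chain C)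
    {i j : Fin (q.dim + 1)} (h : i ≤ j) {Q R : C} (φ : Q ⟶ R) (e : q.functor.obj i ≅ Q)
    (e' : q.functor.obj j ≅ R) (hc : q.functor.map (homOfLE h) ≫ e'.hom = e.hom ≫ φ)
    (z : L.tot q) : L.tr (src φ) (L.tr (toAr q h φ e e' hc) z) = L.tr (toPt q i e) z := by
  rw [← tr_comp, toAr_src]

theorem tr_tgt_toAr (L : KStarLifting.{w, u} k (Chain.aut C)) (q : Chain C)
    {i j : Fin (q.dim + 1)} (h : i ≤ j) {Q R : C} (φ : Q ⟶ R) (e : q.functor.obj i ≅ Q)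
    (e' : q.functor.obj j ≅ R) (hc : q.functor.map (homOfLE h) ≫ e'.hom = e.hom ≫ φ)
    (z : L.tot q) : L.tr (tgt φ) (L.tr (toAr q h φ e e' hc) z) = L.tr (toPt q j e') z := by
  rw [← tr_comp, toAr_tgt]

theorem exists_tr_src (L : KStarLifting.{w, u} k (Chain.aut C)) {Q R : C} {φ : Q ⟶ R}
    (x : L.tot (pt Q)) (b : Aut R) (h : AutComm φ (evalAut (pt Q) (0 : Fin 1) (L.pr _ x)) b) :
    ∃ z : L.tot (ar φ), L.tr (src φ) z = x ∧ evalAut (ar φ) (1 : Fin 2) (L.pr _ z) = b := by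
  obtain ⟨σ, h0, h1⟩ := exists_aut_ar h
  obtain ⟨z, rfl, hz⟩ := exists_tr_eq (L := L) (src φ) x σ
    ((evalAut_pt_bijective Q).1 ((evalAut_toPt (ar φ) (0 : Fin 2) σ).trans h0))
  exact ⟨z, hz, h1⟩

theorem ar_ext {L : KStarLifting.{w, u} k (Chain.aut C)} {Q R : C} {φ : Q ⟶ R}
    {z z' : L.tot (ar φ)} (h : L.tr (src φ) z = L.tr (src φ) z')
    (h' : evalAut (ar φ) (1 : Fin 2) (L.pr _ z) = evalAut (ar φ) (1 : Fin 2) (L.pr _ z')) :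
    z = z' :=
  eq_of_tr_eq _ h (aut_ar_ext ((evalAut_pr_src L z).symm.trans ((congrArg (fun y => evalAut (pt Q) (0 : Fin 1)
    (L.pr _ y)) h).trans (evalAut_pr_src L z'))) h')

/-- The transport system determined by a lifting. -/
def ofLifting (L : KStarLifting.{w, u} k (Chain.aut C)) :
    KTransport.{w, u₁, u, u₁, max u w} k (fun Q : C => Q) where
  M Q := L.tot (pt Q)
  incl Q := L.inc (pt Q)
  proj Q := (evalAut (pt Q) (0 : Fin 1)).comp (L.pr (pt Q))
  incl_injective Q := (L.functor.obj (pt Q)).incl_injective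
  proj_surjective Q := (evalAut_pt_bijective Q).2.comp (pr_surjective _)
  proj_incl Q c := (congrArg (evalAut (pt Q) (0 : Fin 1)) (pr_inc c)).trans (map_one (evalAut (pt Q) (0 : Fin 1)))
  exists_incl {Q x} h := exists_inc ((evalAut_pt_bijective Q).1 (h.trans (map_one _).symm))
  central Q := inc_central
  rel φ x y := ∃ z : L.tot (ar φ), L.tr (src φ) z = x ∧ L.tr (tgt φ) z = y
  rel_comm := by
    rintro Q R φ _ _ ⟨z, rfl, rfl⟩
    exact (autComm_ar φ (L.pr _ z)).congr (evalAut_pr_src L z) (evalAut_pr_tgt L z)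
  rel_exists := by
    intro Q R φ x b h
    obtain ⟨z, hz, h1⟩ := exists_tr_src L x b h
    exact ⟨_, (evalAut_pr_tgt L z).trans h1, z, hz, rfl⟩
  rel_mul := by
    rintro Q R φ _ _ _ _ ⟨z, rfl, rfl⟩ ⟨z', rfl, rfl⟩
    exact ⟨z * z', map_mul _ _ _, map_mul _ _ _⟩
  rel_incl φ c := ⟨L.inc _ c, tr_inc _ _, tr_inc _ _⟩
  rel_unique := by
    rintro Q R φ c ⟨z, hz, hz'⟩
    -- The automorphism of the arrow under `z` is trivial at both ends, and `z` has trivial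
    -- restriction to the source.
    have : z = 1 := by
      refine ar_ext (hz.trans (map_one _).symm) ?_
      refine (evalAut_pr_tgt L z).symm.trans ((congrArg (fun y => evalAut (pt R) (0 : Fin 1)
        (L.pr _ y)) hz').trans ((congrArg (evalAut (pt R) (0 : Fin 1)) (pr_inc c)).trans ?_))
      exact (map_one _).trans ((congrArg _ (map_one (L.pr (ar φ)))).trans (map_one _)).symm
    rw [this, map_one] at hz'
    exact ((L.functor.obj (pt R)).incl_injective ((map_one _).trans hz')).symm
  rel_id {Q} x := by
    refine ⟨L.tr (toAr (pt Q) (le_refl (0 : Fin 1)) (𝟙 Q) (Iso.refl _) (Iso.refl _) ?_) x, ?_, ?_⟩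
    · rfl
    · exact (tr_src_toAr L (pt Q) _ _ _ _ _ x).trans ((congrArg (fun f => L.tr f x)
        (toPt_pt Q)).trans (tr_id x))
    · exact (tr_tgt_toAr L (pt Q) _ _ _ _ _ x).trans ((congrArg (fun f => L.tr f x)
        (toPt_pt Q)).trans (tr_id x))
  rel_comp := by
    rintro Q R T φ ψ _ _ _ ⟨z, rfl, rfl⟩ ⟨z', hz, rfl⟩
    have c1 := autComm_ar φ (L.pr _ z)
    have c2 := autComm_ar ψ (L.pr _ z')
    have e1 : evalAut (ar φ) (1 : Fin 2) (L.pr _ z) = evalAut (ar ψ) (0 : Fin 2) (L.pr _ z') :=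
      (evalAut_pr_tgt L z).symm.trans ((congrArg (fun y => evalAut (pt R) (0 : Fin 1)
        (L.pr _ y)) hz).symm.trans (evalAut_pr_src L z'))
    -- The automorphisms under `z` and `z'` agree at the middle object and give one of the chain of
    -- length two. Its lift `ζ` with the prescribed restriction at the first object restricts to `z`
    -- and `z'` on the two arrows, and on the composite arrow it witnesses the relation.
    obtain ⟨σ, s0, s1, s2⟩ := exists_aut_ar₂ (φ := φ) (ψ := ψ) c1 (c2.congr e1 rfl)
    obtain ⟨ζ, hσ, hζ⟩ := exists_tr_eq (L := L) (toPt (ar₂ φ ψ) (0 : Fin 3) (Iso.refl Q))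
      (L.tr (src φ) z) σ ((evalAut_pt_bijective Q).1 ((evalAut_toPt (ar₂ φ ψ) (0 : Fin 3) σ).trans
        (s0.trans (evalAut_pr_src L z).symm)))
    let f01 := toAr (ar₂ φ ψ) (i := (0 : Fin 3)) (j := (1 : Fin 3))
      (show (0 : Fin 3) ≤ 1 by decide) φ (Iso.refl Q)
      (Iso.refl R) ((Category.comp_id _).trans (Category.id_comp _).symm)
    let f12 := toAr (ar₂ φ ψ) (i := (1 : Fin 3)) (j := (2 : Fin 3))
      (show (1 : Fin 3) ≤ 2 by decide) ψ (Iso.refl R)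
      (Iso.refl T) ((Category.comp_id _).trans (Category.id_comp _).symm)
    let f02 := toAr (ar₂ φ ψ) (i := (0 : Fin 3)) (j := (2 : Fin 3))
      (show (0 : Fin 3) ≤ 2 by decide) (φ ≫ ψ) (Iso.refl Q)
      (Iso.refl T) ((Category.comp_id _).trans (Category.id_comp _).symm)
    have g01 : L.tr f01 ζ = z := by
      refine ar_ext ((tr_src_toAr L _ _ _ _ _ _ ζ).trans hζ) ?_
      refine (evalAut_pr_tgt L _).symm.trans ((congrArg (fun y => evalAut (pt R) (0 : Fin 1)
        (L.pr _ y)) (tr_tgt_toAr L _ _ _ _ _ _ ζ)).trans ?_)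
      exact (evalAut_pr_tr_toPt L (ar₂ φ ψ) (1 : Fin 3) ζ).trans ((congrArg _ hσ).trans s1)
    have g1 : L.tr (toPt (ar₂ φ ψ) (1 : Fin 3) (Iso.refl R)) ζ = L.tr (tgt φ) z :=
      (tr_tgt_toAr L _ _ _ _ _ _ ζ).symm.trans (congrArg (L.tr (tgt φ)) g01)
    have g12 : L.tr f12 ζ = z' := by
      refine ar_ext ((tr_src_toAr L _ _ _ _ _ _ ζ).trans (g1.trans hz.symm)) ?_
      refine (evalAut_pr_tgt L _).symm.trans ((congrArg (fun y => evalAut (pt T) (0 : Fin 1)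
        (L.pr _ y)) (tr_tgt_toAr L _ _ _ _ _ _ ζ)).trans ?_)
      exact (evalAut_pr_tr_toPt L (ar₂ φ ψ) (2 : Fin 3) ζ).trans ((congrArg _ hσ).trans s2)
    refine ⟨L.tr f02 ζ, (tr_src_toAr L _ _ _ _ _ _ ζ).trans hζ, ?_⟩
    exact (tr_tgt_toAr L _ _ _ _ _ _ ζ).trans ((tr_tgt_toAr L _ _ _ _ _ _ ζ).symm.trans
      (congrArg (L.tr (tgt ψ)) g12))

theorem ofLifting_rel (L : KStarLifting.{w, u} k (Chain.aut C)) (q : Chain C)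
    {i j : Fin (q.dim + 1)} (h : i ≤ j) {Q R : C} (φ : Q ⟶ R) (e : q.functor.obj i ≅ Q)
    (e' : q.functor.obj j ≅ R) (hc : q.functor.map (homOfLE h) ≫ e'.hom = e.hom ≫ φ)
    (z : L.tot q) : (ofLifting L).rel φ (L.tr (toPt q i e) z) (L.tr (toPt q j e') z) :=
  ⟨L.tr (toAr q h φ e e' hc) z, tr_src_toAr L _ _ _ _ _ _ z, tr_tgt_toAr L _ _ _ _ _ _ z⟩

variable {𝓒 : Type u₂} [Category.{v₂} 𝓒]

/-- The parallel transport as a function. -/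
noncomputable def transp {I : Type u₃} {o : I → 𝓒} (D : KTransport.{w, u₃, v₂, u₂, m} k o) {Q R : I}
    (φ : o Q ⟶ o R) (x : D.M Q) (b : Aut (o R)) (h : AutComm φ (D.proj Q x) b) : D.M R :=
  (D.rel_exists x b h).choose

section

variable {I : Type u₃} {o : I → 𝓒} {D : KTransport.{w, u₃, v₂, u₂, m} k o} {Q R : I}
    {φ : o Q ⟶ o R} {x : D.M Q} {b : Aut (o R)} (h : AutComm φ (D.proj Q x) b)

theorem proj_transp : D.proj R (D.transp φ x b h) = b := (D.rel_exists x b h).choose_spec.1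

theorem rel_transp : D.rel φ x (D.transp φ x b h) := (D.rel_exists x b h).choose_spec.2

theorem transp_eq {y : D.M R} (hy : D.rel φ x y) (hb : D.proj R y = b) : D.transp φ x b h = y :=
  rel_right_unique (rel_transp h) hy (by rw [hb, proj_transp])

end

variable (G : C ⥤ 𝓒)

theorem autComm_map_head {q r : Chain C} (f : q ⟶ r) {σ : Aut q.functor}
    {a : Aut (G.obj (q.functor.obj 0))} (h : G.mapAut _ (evalAut q 0 σ) = a) :
    AutComm (G.map (head f)) a (G.mapAut _ (evalAut r 0 (autMap f σ))) := by
  subst h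
  exact (autComm_head f σ).map G

variable (D : KTransport.{w, u₁, v₂, u₂, max u w} k G.obj)

/-- The `k*`-group over the automorphism group of a chain. -/
def liftGroup (q : Chain C) : Subgroup (Aut q.functor × D.M (q.functor.obj 0)) where
  carrier := {x | G.mapAut _ (evalAut q 0 x.1) = D.proj _ x.2}
  one_mem' := by simp
  mul_mem' := by
    intro x y hx hy
    change G.mapAut _ (evalAut q 0 (x.1 * y.1)) = D.proj _ (x.2 * y.2)
    rw [map_mul, map_mul, map_mul, hx, hy]
  inv_mem' := by
    intro x hx
    change G.mapAut _ (evalAut q 0 x.1⁻¹) = D.proj _ x.2⁻¹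
    rw [map_inv, map_inv, map_inv, hx]

/-- The `k*`-group over the automorphism group of a chain, with its structural maps. -/
def liftObj (hfin : ∀ q : Chain C, Finite (Aut q.functor)) (q : Chain C) : KStarGrp.{w, u} k where
  total := liftGroup G D q
  base := Aut q.functor
  finite_base := hfin q
  incl :=
    { toFun := fun c => ⟨(1, D.incl _ c), by
        change G.mapAut _ (evalAut q 0 1) = D.proj _ (D.incl _ c)
        rw [D.proj_incl, map_one, map_one]⟩
      map_one' := Subtype.ext (by simp)
      map_mul' := fun _ _ => Subtype.ext (by simp) }
  proj := (MonoidHom.fst _ _).comp (liftGroup G D q).subtype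
  incl_injective c c' h := D.incl_injective _ (congrArg (fun x : liftGroup G D q => x.1.2) h)
  proj_surjective σ := by
    obtain ⟨x, hx⟩ := D.proj_surjective _ (G.mapAut _ (evalAut q 0 σ))
    exact ⟨⟨(σ, x), hx.symm⟩, rfl⟩
  ker_proj := by
    ext x
    constructor
    · obtain ⟨⟨σ, x⟩, hx⟩ := x
      rintro (rfl : σ = 1)
      obtain ⟨c, rfl⟩ := D.exists_incl (hx.symm.trans (by
        change G.mapAut _ (evalAut q 0 1) = 1
        rw [map_one, map_one]))
      exact ⟨c, rfl⟩
    · rintro ⟨c, rfl⟩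
      rfl
  central := by
    rintro _ ⟨c, rfl⟩
    refine Subgroup.mem_center_iff.2 fun x => Subtype.ext (Prod.ext ?_ ?_)
    · exact (mul_one _).trans (one_mul _).symm
    · exact (D.central _ c _).symm

variable {G D} in
theorem liftGroup_ext {q : Chain C} {x y : liftGroup G D q} (h : x.1.1 = y.1.1)
    (h' : x.1.2 = y.1.2) : x = y :=
  Subtype.ext (Prod.ext h h')

variable {G D} in
/-- The map of `k*`-groups determined by a morphism of chains. -/
noncomputable def liftFun {q r : Chain C} (f : q ⟶ r) (x : liftGroup G D q) : liftGroup G D r :=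
  ⟨(autMap f x.1.1, D.transp (G.map (head f)) x.1.2 _ (autComm_map_head G f x.2)),
    (proj_transp (autComm_map_head G f x.2)).symm⟩

variable {G D} in
theorem rel_liftFun {q r : Chain C} (f : q ⟶ r) (x : liftGroup G D q) :
    D.rel (G.map (head f)) x.1.2 (liftFun f x).1.2 :=
  rel_transp (autComm_map_head G f x.2)

variable {G D} in
theorem liftFun_eq {q r : Chain C} {f : q ⟶ r} {x : liftGroup G D q} {y : liftGroup G D r}
    (h : autMap f x.1.1 = y.1.1) (hy : D.rel (G.map (head f)) x.1.2 y.1.2) : liftFun f x = y := by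
  refine liftGroup_ext h (transp_eq (autComm_map_head G f x.2) hy ?_)
  rw [h]
  exact y.2.symm

variable {G D} in
/-- The homomorphism of `k*`-groups determined by a morphism of chains. -/
noncomputable def liftMap {q r : Chain C} (f : q ⟶ r) : liftGroup G D q →* liftGroup G D r where
  toFun := liftFun f
  map_one' := liftFun_eq (map_one (autMap f)) (rel_one _)
  map_mul' x y := liftFun_eq (map_mul (autMap f) _ _) (D.rel_mul (rel_liftFun f x) (rel_liftFun f y))

/-- The functor to `k*`-groups determined by a transport system. -/
noncomputable def liftFunctor (hfin : ∀ q : Chain C, Finite (Aut q.functor)) :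
    Chain C ⥤ KStarGrp.{w, u} k where
  obj := liftObj G D hfin
  map {q r} f :=
    KStarGrp.Hom.mk (G := liftObj G D hfin q) (H := liftObj G D hfin r) (liftMap f) (autMap f)
      (MonoidHom.ext fun c => liftFun_eq (map_one (autMap f)) (D.rel_incl _ c)) rfl
  map_id q := by
    have e : ∀ σ, autMap (𝟙 q) σ = σ := fun σ =>
      congrArg (fun f => f.hom σ) ((Chain.aut C).map_id q)
    refine KStarGrp.Hom.ext (MonoidHom.ext fun x => liftFun_eq (e x.1.1) ?_) (MonoidHom.ext e)
    rw [head_id, G.map_id]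
    exact D.rel_id _
  map_comp {q r s} f g := by
    have e : ∀ σ, autMap (f ≫ g) σ = autMap g (autMap f σ) := fun σ =>
      congrArg (fun f => f.hom σ) ((Chain.aut C).map_comp f g)
    refine KStarGrp.Hom.ext (MonoidHom.ext fun x => liftFun_eq (e x.1.1) ?_) (MonoidHom.ext e)
    rw [head_comp, G.map_comp]
    exact D.rel_comp (rel_liftFun f x) (rel_liftFun g (liftFun f x))

/-- The lifting determined by a transport system. -/
noncomputable def toLifting (hfin : ∀ q : Chain C, Finite (Aut q.functor)) :
    KStarLifting.{w, u} k (Chain.aut C) where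
  functor := liftFunctor G D hfin
  iso := NatIso.ofComponents (fun _ => Iso.refl _) (fun _ => rfl)

end KTransport

/-! ## Extension of liftings -/

namespace KTransport

open KStarLifting Chain

section

variable {k : Type w} [Field k] {C : Type u₁} [Category.{u} C] {𝓒 : Type u₂} [Category.{v₂} 𝓒]
  {G : C ⥤ 𝓒} {D D' : KTransport.{w, u₁, v₂, u₂, max u w} k G.obj}

/-- The morphism of liftings determined by a morphism of transport systems. -/
noncomputable def Hom.toLifting (h : D.Hom D') (hfin : ∀ q : Chain C, Finite (Aut q.functor)) :
    toLifting G D hfin ⟶ KTransport.toLifting G D' hfin :=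
  homMk (L := KTransport.toLifting G D hfin) (L' := KTransport.toLifting G D' hfin)
    (fun q =>
      { toFun := fun x : liftGroup G D q =>
          (⟨(x.1.1, h.app _ x.1.2), x.2.trans (h.proj_app _ _).symm⟩ : liftGroup G D' q)
        map_one' := liftGroup_ext rfl (map_one _)
        map_mul' := fun _ _ => liftGroup_ext rfl (map_mul _ _ _) })
    (fun _ c => liftGroup_ext rfl (h.app_incl _ c))
    (fun _ _ => rfl)
    (fun f x => (liftFun_eq (D := D') rfl (h.app_rel (rel_liftFun (D := D) f x))).symm)

variable {p : ℕ} [Fact p.Prime] [CharP k p] [IsAlgClosed k]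

theorem mem_liftGroup_descend (H : IsPQuotient p G) (L : KStarLifting.{w, u} k (Chain.aut C))
    (q : Chain C) (z : L.tot q) : ((L.pr q z, (QuotientGroup.mk (L.tr (toPt q 0 (Iso.refl _)) z) :
      (descend H (ofLifting L)).M (q.functor.obj 0))) :
        Aut q.functor × (descend H (ofLifting L)).M (q.functor.obj 0)) ∈
      liftGroup G (descend H (ofLifting L)) q :=
  (congrArg (G.mapAut _) (evalAut_pr_tr_toPt L q 0 z)).symm

/-- The canonical isomorphism between a lifting and the lifting determined by its transport
system on a quotient. -/
noncomputable def toLiftingDescend (H : IsPQuotient p G) (L : KStarLifting.{w, u} k (Chain.aut C))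
    (hfin : ∀ q : Chain C, Finite (Aut q.functor)) :
    L ⟶ KTransport.toLifting G (descend H (ofLifting L)) hfin :=
  homMk (L := L) (L' := KTransport.toLifting G (descend H (ofLifting L)) hfin)
    (fun q =>
      { toFun := fun z => (⟨(L.pr q z, QuotientGroup.mk (L.tr (toPt q 0 (Iso.refl _)) z)),
          mem_liftGroup_descend H L q z⟩ : liftGroup G (descend H (ofLifting L)) q)
        map_one' := liftGroup_ext (map_one (L.pr q)) (congrArg QuotientGroup.mk
          (map_one (L.tr (toPt q 0 (Iso.refl _)))))
        map_mul' := fun x y => liftGroup_ext (map_mul (L.pr q) x y) (congrArg QuotientGroup.mk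
          (map_mul (L.tr (toPt q 0 (Iso.refl _))) x y)) })
    (fun _ c => liftGroup_ext (pr_inc c) (congrArg QuotientGroup.mk (tr_inc _ c)))
    (fun _ _ => rfl)
    (fun {q r} f z => by
      refine (liftFun_eq (D := descend H (ofLifting L)) (f := f)
        (x := ⟨_, mem_liftGroup_descend H L q z⟩) (y := ⟨_, mem_liftGroup_descend H L r (L.tr f z)⟩)
        (pr_tr f z).symm ⟨head f, _, _, rfl, rfl, rfl, ?_⟩).symm
      rw [← tr_comp, comp_toPt]
      -- The chain `q` maps to the arrow `head f` through its terms of index `0` and `δ(0)`, so `z`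
      -- itself witnesses the transport along `head f`.
      refine ofLifting_rel L q (Fin.zero_le _) (head f) _ _ ?_ z
      change _ ≫ (Hom.ν f).hom.app 0 ≫ 𝟙 _ = 𝟙 _ ≫ head f
      rw [Category.comp_id, Category.id_comp]
      rfl)

end

section

variable {k : Type w} [Field k] {C₀ : Type u₃} [Category.{u} C₀] {C : Type u₁} [Category.{u} C]

/-- The restriction of liftings along a fully faithful functor. -/
noncomputable abbrev _root_.KStarLifting.res (J : C₀ ⥤ C) [J.Full] [J.Faithful] :
    KStarLifting.{w, u} k (Chain.aut C) ⥤ KStarLifting.{w, u} k (Chain.aut C₀) :=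
  KStarLifting.restrict (Chain.map J) (Chain.mapAut J)

/-- The natural automorphism of a chain determined by a natural automorphism of its image. -/
noncomputable def unmapAut (J : C₀ ⥤ C) [J.Full] [J.Faithful] (q : Chain C₀) :
    Aut ((Chain.map J).obj q).functor →* Aut q.functor :=
  ((Chain.mapAut J).hom.app q).hom

theorem mapAut_evalAut_unmapAut (J : C₀ ⥤ C) [J.Full] [J.Faithful] (q : Chain C₀) (i : Fin (q.dim + 1))
    (σ : Aut ((Chain.map J).obj q).functor) :
    J.mapAut _ (evalAut q i (unmapAut J q σ)) = evalAut ((Chain.map J).obj q) i σ := by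
  have h : ((Chain.mapAut J).inv.app q).hom (unmapAut J q σ) = σ :=
    congrArg (fun f => f.hom σ) ((Chain.mapAut J).hom_inv_id_app q)
  refine Eq.trans ?_ (congrArg (evalAut ((Chain.map J).obj q) i) h)
  rfl

theorem unmapAut_autMap (J : C₀ ⥤ C) [J.Full] [J.Faithful] {q r : Chain C₀} (f : q ⟶ r) (σ : Aut ((Chain.map J).obj q).functor) :
    unmapAut J r (autMap ((Chain.map J).map f) σ) = autMap f (unmapAut J q σ) :=
  congrArg (fun f => f.hom σ) ((Chain.mapAut J).hom.naturality f)

theorem res_pr (J : C₀ ⥤ C) [J.Full] [J.Faithful] (L : KStarLifting.{w, u} k (Chain.aut C)) (q : Chain C₀)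
    (z : L.tot ((Chain.map J).obj q)) :
    ((res J).obj L).pr q z = unmapAut J q (L.pr _ z) := by
  have h : ((res J).obj L).iso.hom.app q =
      L.iso.hom.app ((Chain.map J).obj q) ≫ (Chain.mapAut J).hom.app q := by
    rw [KStarLifting.restrict_obj_iso]
    simp
    rfl
  exact congrArg (fun f => f.hom ((L.functor.obj _).proj z)) h

theorem head_map (J : C₀ ⥤ C) {q r : Chain C₀} (f : q ⟶ r) :
    head ((Chain.map J).map f) = J.map (head f) := by
  change J.map _ ≫ ((Hom.ν ((Chain.map J).map f)).hom.app 0) = _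
  rw [head, J.map_comp]
  congr 1
  exact Category.id_comp _

/-- The image of a chain of length zero. -/
def mapPt (J : C₀ ⥤ C) (R : C₀) : pt (J.obj R) ⟶ (Chain.map J).obj (pt R) :=
  Chain.Hom.mk (q := pt (J.obj R)) (r := (Chain.map J).obj (pt R)) (𝟭 _)
    (NatIso.ofComponents (fun _ => Iso.refl _) (fun _ => by
      change 𝟙 _ ≫ 𝟙 _ = 𝟙 _ ≫ J.map (𝟙 _)
      simp))

/-- The image of a chain of length one. -/
def mapAr (J : C₀ ⥤ C) {Q R : C₀} (φ : Q ⟶ R) : ar (J.map φ) ⟶ (Chain.map J).obj (ar φ) :=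
  Chain.Hom.mk (q := ar (J.map φ)) (r := (Chain.map J).obj (ar φ)) (𝟭 _)
    (ComposableArrows.isoMk₁ (F := 𝟭 (Fin 2) ⋙ ComposableArrows.mk₁ (J.map φ))
      (G := ComposableArrows.mk₁ φ ⋙ J) (Iso.refl _) (Iso.refl _) (by
        change J.map φ ≫ 𝟙 _ = 𝟙 _ ≫ J.map φ
        simp))

theorem mapAr_src (J : C₀ ⥤ C) {Q R : C₀} (φ : Q ⟶ R) :
    mapAr J φ ≫ (Chain.map J).map (src φ) = src (J.map φ) ≫ mapPt J Q := by
  refine Chain.hom_ext' (fun _ => rfl) fun t => ?_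
  rw [comp_ν_app, comp_ν_app]
  have h : 𝟙 (J.obj Q) ≫ 𝟙 _ ≫ J.map (𝟙 Q) = 𝟙 (J.obj Q) ≫ 𝟙 (J.obj Q) ≫ 𝟙 (J.obj Q) := by
    rw [J.map_id]
  exact h.trans (congrArg (· ≫ 𝟙 (J.obj Q) ≫ 𝟙 (J.obj Q))
    ((ar (J.map φ)).functor.map_id (0 : Fin 2)).symm)

theorem mapAr_tgt (J : C₀ ⥤ C) {Q R : C₀} (φ : Q ⟶ R) :
    mapAr J φ ≫ (Chain.map J).map (tgt φ) = tgt (J.map φ) ≫ mapPt J R := by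
  refine Chain.hom_ext' (fun _ => rfl) fun t => ?_
  rw [comp_ν_app, comp_ν_app]
  have h : 𝟙 (J.obj R) ≫ 𝟙 _ ≫ J.map (𝟙 R) = 𝟙 (J.obj R) ≫ 𝟙 (J.obj R) ≫ 𝟙 (J.obj R) := by
    rw [J.map_id]
  exact h.trans (congrArg (· ≫ 𝟙 (J.obj R) ≫ 𝟙 (J.obj R))
    ((ar (J.map φ)).functor.map_id (1 : Fin 2)).symm)

theorem toPt_mapPt (J : C₀ ⥤ C) (q : Chain C₀) (i : Fin (q.dim + 1)) :
    toPt ((Chain.map J).obj q) i (Iso.refl _) ≫ mapPt J (q.functor.obj i) =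
      (Chain.map J).map (toPt q i (Iso.refl _)) := by
  refine Chain.hom_ext' (fun _ => rfl) fun t => ?_
  refine (comp_ν_app (toPt ((Chain.map J).obj q) i (Iso.refl _)) _ t).trans ?_
  have h : 𝟙 (J.obj (q.functor.obj i)) ≫ 𝟙 (J.obj (q.functor.obj i)) =
      J.map (q.functor.map (𝟙 i)) ≫ 𝟙 _ ≫ J.map (𝟙 (q.functor.obj i)) := by
    simp
  exact h

variable {𝓒 : Type u₂} [Category.{v₂} 𝓒]

/-- The morphism from the restriction of the lifting determined by a transport system to the
lifting determined by the restricted transport system. -/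
noncomputable def resToLifting (J : C₀ ⥤ C) [J.Full] [J.Faithful] (G : C ⥤ 𝓒)
    (D : KTransport.{w, u₁, v₂, u₂, max u w} k G.obj)
    (hfin₀ : ∀ q : Chain C₀, Finite (Aut q.functor)) (hfin : ∀ q : Chain C, Finite (Aut q.functor)) :
    (res J).obj (toLifting G D hfin) ⟶ toLifting (J ⋙ G) (D.comap J.obj) hfin₀ :=
  homMk (L := (res J).obj (toLifting G D hfin)) (L' := toLifting (J ⋙ G) (D.comap J.obj) hfin₀)
    (fun q =>
      { toFun := fun x : liftGroup G D ((Chain.map J).obj q) =>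
          (⟨(unmapAut J q x.1.1, x.1.2), (congrArg (G.mapAut _)
            (mapAut_evalAut_unmapAut J q 0 x.1.1)).trans x.2⟩ : liftGroup (J ⋙ G) (D.comap J.obj) q)
        map_one' := liftGroup_ext (D := D.comap J.obj) (G := J ⋙ G) (map_one (unmapAut J q)) rfl
        map_mul' := fun x y => liftGroup_ext (D := D.comap J.obj) (G := J ⋙ G)
          (map_mul (unmapAut J q) x.1.1 y.1.1) rfl })
    (fun q _ => liftGroup_ext (D := D.comap J.obj) (G := J ⋙ G) (map_one (unmapAut J q)) rfl)
    (fun q x => (res_pr J (toLifting G D hfin) q x).symm)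
    (fun {q r} f x => by
      refine (liftFun_eq (G := J ⋙ G) (D := D.comap J.obj) (f := f)
        (unmapAut_autMap J f x.1.1).symm ?_).symm
      have := rel_liftFun (D := D) ((Chain.map J).map f) x
      rwa [head_map] at this)

end

section

variable {k : Type w} [Field k] {C₀ : Type u₃} [Category.{u} C₀] {C : Type u₁} [Category.{u} C]
  {𝓒 : Type u₂} [Category.{u} 𝓒] {p : ℕ} {J : C₀ ⥤ C} [J.Full] [J.Faithful] {G : C ⥤ 𝓒}
  {L : KStarLifting.{w, u} k (Chain.aut C₀)} {L' : KStarLifting.{w, u} k (Chain.aut C)}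

/-- The homomorphism over the automorphisms of an object determined by a morphism of liftings. -/
noncomputable def compPt (α : (res J).obj L' ⟶ L) (R : C₀) : L'.tot (pt (J.obj R)) →* L.tot (pt R) :=
  (KStarLifting.Hom.at α (pt R)).comp (L'.tr (mapPt J R))

theorem compPt_tr_toPt (α : (res J).obj L' ⟶ L) (q : Chain C₀) (i : Fin (q.dim + 1))
    (z : L'.tot ((Chain.map J).obj q)) :
    compPt α _ (L'.tr (toPt ((Chain.map J).obj q) i (Iso.refl _)) z) =
      L.tr (toPt q i (Iso.refl _)) (KStarLifting.Hom.at α q z) := by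
  refine Eq.trans ?_ (at_tr α (toPt q i (Iso.refl _)) z)
  refine congrArg (KStarLifting.Hom.at α (pt _)) ((tr_comp _ _ z).symm.trans ?_)
  exact congrArg (fun f => L'.tr f z) (toPt_mapPt J q i)

theorem mapAut_compPt (α : (res J).obj L' ⟶ L) (R : C₀) (z : L'.tot (pt (J.obj R))) :
    J.mapAut _ ((ofLifting L).proj R (compPt α R z)) = (ofLifting L').proj (J.obj R) z := by
  refine (congrArg (fun σ => J.mapAut _ (evalAut (pt R) (0 : Fin 1) σ))
    ((pr_at α (L'.tr (mapPt J R) z)).trans (res_pr J L' (pt R) _))).trans ?_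
  refine (mapAut_evalAut_unmapAut J (pt R) (0 : Fin 1) _).trans ?_
  refine (congrArg (evalAut ((Chain.map J).obj (pt R)) (0 : Fin 1)) (pr_tr (mapPt J R) z)).trans ?_
  have := autComm_ν (mapPt J R) (L'.pr _ z) (0 : Fin 1)
  exact Aut.ext (((Category.id_comp _).symm.trans this.symm).trans (Category.comp_id _))

theorem compPt_rel (α : (res J).obj L' ⟶ L) {Q R : C₀} (φ : Q ⟶ R) {x : L'.tot (pt (J.obj Q))}
    {y : L'.tot (pt (J.obj R))} (h : (ofLifting L').rel (J.map φ) x y) :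
    (ofLifting L).rel φ (compPt α Q x) (compPt α R y) := by
  obtain ⟨z, rfl, rfl⟩ := h
  refine ⟨KStarLifting.Hom.at α (ar φ) (L'.tr (mapAr J φ) z), ?_, ?_⟩
  · refine (at_tr α (src φ) _).symm.trans (congrArg (KStarLifting.Hom.at α (pt Q)) ?_)
    exact (tr_comp _ _ z).symm.trans ((congrArg (fun f => L'.tr f z) (mapAr_src J φ)).trans
      (tr_comp _ _ z))
  · refine (at_tr α (tgt φ) _).symm.trans (congrArg (KStarLifting.Hom.at α (pt R)) ?_)
    exact (tr_comp _ _ z).symm.trans ((congrArg (fun f => L'.tr f z) (mapAr_tgt J φ)).trans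
      (tr_comp _ _ z))

/-- Two morphisms of liftings which coincide over the objects of a sufficiently large full
subcategory are equal. -/
theorem hom_ext_of_res (hJ : ∀ Q : C, ∃ (R : C₀) (φ : Q ⟶ J.obj R), ∀ a : Aut Q, ∃ b, AutComm φ a b)
    {L' L'' : KStarLifting.{w, u} k (Chain.aut C)} {β β' : L' ⟶ L''}
    (h : (res J).map β = (res J).map β') : β = β' := by
  have h1 : ∀ R (x : L'.tot (pt (J.obj R))), KStarLifting.Hom.at β _ x =
      KStarLifting.Hom.at β' _ x := by
    intro R x
    refine at_eq_of_target (mapPt J R) (fun y => ?_) x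
    exact congrArg (fun γ => KStarLifting.Hom.at γ (pt R) y) h
  have h2 : ∀ Q (x : L'.tot (pt Q)), KStarLifting.Hom.at β _ x = KStarLifting.Hom.at β' _ x := by
    intro Q
    obtain ⟨R, φ, hφ⟩ := hJ Q
    -- Equality passes from the target of the arrow `φ` back to the arrow, then on to its source,
    -- because every automorphism of `Q` extends along `φ` to an automorphism of the arrow.
    refine at_eq_of_source (src φ) (fun σ => ?_) (at_eq_of_target (tgt φ) (h1 R))
    obtain ⟨b, hb⟩ := hφ (evalAut (pt Q) (0 : Fin 1) σ)
    obtain ⟨τ, hτ, -⟩ := exists_aut_ar hb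
    exact ⟨τ, (evalAut_pt_bijective Q).1 ((evalAut_toPt (ar φ) (0 : Fin 2) τ).trans hτ)⟩
  exact KStarLifting.hom_ext' fun q => at_eq_of_target (toPt q 0 (Iso.refl _)) (h2 _)

/-- An extension of an automorphism in the quotient lifts up to an automorphism of `R` in the
kernel, which is absorbed into the extension. -/
theorem exists_full_of_map_full (H : IsPQuotient p G) {Q R : C} (φ : G.obj Q ⟶ G.obj R)
    (h : ∀ a, ∃ b, AutComm φ a b) : ∃ ψ : Q ⟶ R, ∀ a : Aut Q, ∃ b, AutComm ψ a b := by
  have := H.full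
  obtain ⟨φ, rfl⟩ := G.map_surjective φ
  refine ⟨φ, fun a => ?_⟩
  obtain ⟨b, hb⟩ := h (G.mapAut _ a)
  obtain ⟨b, rfl⟩ := H.mapAut_surjective R b
  have e : G.map (φ ≫ b.hom) = G.map (a.hom ≫ φ) := by
    rw [G.map_comp, G.map_comp]
    exact hb.symm
  obtain ⟨u, -, e⟩ := H.exists_aut _ _ e
  exact ⟨u * b, e.trans (Category.assoc _ _ _)⟩

variable [Fact p.Prime]

theorem compPt_mem (H : IsPQuotient p G) (H₀ : IsPQuotient p (J ⋙ G)) (α : (res J).obj L' ⟶ L)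
    (R : C₀) : pker H (ofLifting L') (J.obj R) ≤
      (pker H₀ (ofLifting L) R).comap (compPt α R) := by
  rintro z ⟨hz, n, hn⟩
  refine ⟨(congrArg (G.mapAut _) (mapAut_compPt α R z)).trans hz, n, ?_⟩
  exact (map_pow (compPt α R) z (p ^ n)).symm.trans ((congrArg _ hn).trans (map_one _))

variable [CharP k p] [IsAlgClosed k]

/-- The morphism of transport systems determined by a morphism of liftings. -/
noncomputable def descendHom (H : IsPQuotient p G) (H₀ : IsPQuotient p (J ⋙ G))
    (α : (res J).obj L' ⟶ L) : KTransport.Hom ((descend H (ofLifting L')).comap J.obj)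
      (descend H₀ (ofLifting L)) where
  app R := QuotientGroup.map (pker H (ofLifting L') (J.obj R)) (pker H₀ (ofLifting L) R)
    (compPt α R) (compPt_mem H H₀ α R)
  proj_app R x := by
    induction x using QuotientGroup.induction_on with
    | H x => exact congrArg (G.mapAut _) (mapAut_compPt α R x)
  app_incl R c := congrArg QuotientGroup.mk
    ((congrArg (KStarLifting.Hom.at α (pt R)) (tr_inc (mapPt J R) c)).trans (at_inc α c))
  app_rel := by
    rintro Q R _ _ _ ⟨φ, x, y, rfl, rfl, rfl, h⟩
    obtain ⟨φ, rfl⟩ := J.map_surjective φ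
    exact ⟨φ, _, _, rfl, rfl, rfl, compPt_rel α φ h⟩

/-- The extension of a lifting, unique up to a unique isomorphism. -/
theorem exists_extension_of_lifting (H : IsPQuotient p G) (H₀ : IsPQuotient p (J ⋙ G))
    (hR : RadicalFamily p (fun R => G.obj (J.obj R)))
    (hfin₀ : ∀ q : Chain C₀, Finite (Aut q.functor)) (hfin : ∀ q : Chain C, Finite (Aut q.functor))
    (L : KStarLifting.{w, u} k (Chain.aut C₀)) :
    ∃ (L₁ : KStarLifting.{w, u} k (Chain.aut C)) (e : (res J).obj L₁ ⟶ L),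
      ∀ (L' : KStarLifting.{w, u} k (Chain.aut C)) (α : (res J).obj L' ⟶ L),
        ∃! β : L' ⟶ L₁, (res J).map β ≫ e = α := by
  let D : KTransport.{w, u₃, u, u₂, max u w} k (fun R => G.obj (J.obj R)) :=
    descend H₀ (ofLifting L)
  have hepi := @hR.epi
  have hres : ∀ Q, D.Resolved Q := KTransport.resolved hR
  have hJ : ∀ Q : C, ∃ (R : C₀) (φ : Q ⟶ J.obj R), ∀ a : Aut Q, ∃ b, AutComm φ a b := by
    intro Q
    obtain ⟨R, φ, h⟩ := (hres (G.obj Q)).full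
    obtain ⟨ψ, h'⟩ := exists_full_of_map_full H (R := J.obj R) φ h
    exact ⟨R, ψ, h'⟩
  let D₁ : KTransport.{w, u₁, u, u₂, max u w} k G.obj := D.kan hres G.obj
  let ev : (D₁.comap J.obj).Hom D := kanEval hres
  let E : (res J).obj (toLifting G D₁ hfin) ⟶ toLifting (J ⋙ G) D hfin₀ :=
    resToLifting J G D₁ hfin₀ hfin ≫ Hom.toLifting (G := J ⋙ G) ev hfin₀
  let θ := toLiftingDescend H₀ L hfin₀
  refine ⟨toLifting G D₁ hfin, E ≫ inv θ, fun L' α => ?_⟩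
  -- `α` induces a morphism of transport systems over the subcategory, which by universality extends
  -- to all objects.
  obtain ⟨β, hβ⟩ := exists_hom_kan hres (descendHom H H₀ α)
  have key : (res J).map (toLiftingDescend H L' hfin ≫ Hom.toLifting β hfin) ≫ E ≫ inv θ = α := by
    rw [← Category.assoc, IsIso.comp_inv_eq]
    -- An element of the target is an automorphism of the chain together with a class at its first
    -- object. The automorphisms agree for any morphisms of liftings, so only the classes need the
    -- choice of `β`.
    refine KStarLifting.hom_ext' fun q z => liftGroup_ext (D := D) (G := J ⋙ G) ?_ ?_
    · exact (pr_at ((res J).map (toLiftingDescend H L' hfin ≫ Hom.toLifting β hfin) ≫ E) z).trans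
        (pr_at (α ≫ θ) z).symm
    · refine (hβ (q.functor.obj 0) _).trans (congrArg QuotientGroup.mk ?_)
      exact compPt_tr_toPt α q 0 z
  refine ⟨_, key, fun β' hβ' => hom_ext_of_res hJ ?_⟩
  exact (cancel_mono (E ≫ inv θ)).1 (hβ'.trans key.symm)

end

end KTransport

/-! ## Morphisms and selfcentralizing subgroups -/

namespace DivisibleCategory

variable {P : Type u} [Group P] {F : DivisibleCategory P} {Q R : Subgroup P}

variable (F) in
/-- The morphisms from `Q` to `P`. -/
def IsMor (f : Q →* P) : Prop :=
  f.codRestrict (⊤ : Subgroup P) (fun _ => trivial) ∈ F.Mor Q ⊤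

theorem mor_iff {φ : Q →* R} : φ ∈ F.Mor Q R ↔ F.IsMor (R.subtype.comp φ) := by
  have h : Subgroup.inclusion (le_top : R ≤ ⊤) ∈ F.Mor R ⊤ := F.conj_mem 1 _ (by simp)
  exact ⟨fun hφ => F.comp_mem hφ h, fun hφ => F.div_mem φ hφ h rfl⟩

theorem IsMor.injective {f : Q →* P} (hf : F.IsMor f) : Function.Injective f := fun _ _ h =>
  F.injective hf (Subtype.ext h)

theorem isMor_top_subtype {φ : Q →* (⊤ : Subgroup P)} (h : φ ∈ F.Mor Q ⊤) :
    F.IsMor ((⊤ : Subgroup P).subtype.comp φ) := h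

theorem isMor_subtype (F : DivisibleCategory P) (Q : Subgroup P) : F.IsMor Q.subtype :=
  F.conj_mem 1 _ (fun u => (by simp : (u : P) = 1 * u * 1⁻¹))

theorem IsMor.conj {f : Q →* P} (hf : F.IsMor f) (x : P) :
    F.IsMor ((MulAut.conj x).toMonoidHom.comp f) :=
  F.comp_mem (ψ := ((MulAut.conj x).toMonoidHom.comp (⊤ : Subgroup P).subtype).codRestrict ⊤
    (fun _ => trivial)) hf (F.conj_mem x _ fun _ => rfl)

theorem IsMor.comp {f : Q →* P} {g : R →* P} (hf : F.IsMor f) (hg : F.IsMor g) (h : ∀ u, f u ∈ R) :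
    F.IsMor (g.comp (f.codRestrict R h)) :=
  F.comp_mem (mor_iff.2 hf) hg

theorem IsMor.restrict {f : R →* P} (hf : F.IsMor f) (h : Q ≤ R) :
    F.IsMor (f.comp (Subgroup.inclusion h)) :=
  (F.isMor_subtype Q).comp hf (fun u => h u.2)

theorem IsMor.comp_mulAut {f : Q →* P} (hf : F.IsMor f) {a : MulAut Q} (ha : a ∈ F.autGroup Q) :
    F.IsMor (f.comp a.toMonoidHom) :=
  F.comp_mem (show a.toMonoidHom ∈ F.Mor Q Q from ha) hf

theorem IsMor.exists_inv {f : Q →* P} (hf : F.IsMor f) :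
    ∃ g : f.range →* P, F.IsMor g ∧ ∀ u h, g ⟨f u, h⟩ = u := by
  let e := MonoidHom.ofInjective hf.injective
  have he : ∀ x, e (e.symm x) = x := e.apply_symm_apply
  refine ⟨Q.subtype.comp e.symm.toMonoidHom, mor_iff.1 ?_, fun u h => ?_⟩
  · refine F.div_mem (φ := MonoidHom.id _) (φ' := e.toMonoidHom) _ (F.id_mem _) (mor_iff.2 hf) ?_
    ext x
    exact congrArg Subtype.val (he x)
  · exact congrArg Subtype.val (e.symm_apply_apply u)

/-- The automorphism of `Q` determined by a morphism `f` and by a morphism with the same image. -/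
theorem IsMor.exists_mulAut {f f' : Q →* P} (hf : F.IsMor f) (hf' : F.IsMor f')
    (h : f'.range = f.range) : ∃ a ∈ F.autGroup Q, ∀ u, f (a u) = f' u := by
  let e := MonoidHom.ofInjective hf.injective
  let e' := MonoidHom.ofInjective hf'.injective
  let a : MulAut Q := (e'.trans (MulEquiv.subgroupCongr h)).trans e.symm
  have ha : ∀ u, f (a u) = f' u := fun u =>
    congrArg Subtype.val (e.apply_symm_apply ((MulEquiv.subgroupCongr h) (e' u)))
  refine ⟨a, ?_, ha⟩
  exact F.div_mem (φ' := f.codRestrict ⊤ (fun _ => trivial)) a.toMonoidHom hf' hf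
    (MonoidHom.ext fun u => Subtype.ext (ha u))

theorem exists_mulAut_of_endo [Finite P] {ψ : Q →* P} (hψ : F.IsMor ψ) (h : ∀ x, ψ x ∈ Q) :
    ∃ a ∈ F.autGroup Q, ∀ u, (a u : P) = ψ u := by
  refine (F.isMor_subtype Q).exists_mulAut hψ ?_
  have hle : ψ.range ≤ Q := by
    rintro _ ⟨x, rfl⟩
    exact h x
  rw [Q.range_subtype]
  exact Subgroup.eq_of_le_of_card_ge hle
    (Nat.card_congr (MonoidHom.ofInjective hψ.injective).toEquiv).le

variable (F) in
/-- The selfcentralizing subgroups. -/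
def IsSc (Q : Subgroup P) : Prop :=
  ∀ f : Q →* P, F.IsMor f → ∀ y, (∀ u, y * f u = f u * y) → ∃ u, f u = y

theorem IsSc.range {f : Q →* P} (hQ : F.IsSc Q) (hf : F.IsMor f) : F.IsSc f.range := by
  intro g hg y hy
  obtain ⟨u, hu⟩ := hQ _ (hf.comp hg fun u => ⟨u, rfl⟩) y fun u => hy ⟨f u, u, rfl⟩
  exact ⟨_, hu⟩

theorem IsSc.mono (hQ : F.IsSc Q) (h : Q ≤ R) : F.IsSc R := by
  intro g hg y hy
  obtain ⟨u, hu⟩ := hQ _ (hg.restrict h) y fun u => hy _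
  exact ⟨_, hu⟩

theorem imageUnder_self (φ : Q →* R) : Subgroup.imageUnder φ Q = (R.subtype.comp φ).range := by
  rw [Subgroup.imageUnder, Subgroup.subgroupOf_self, MonoidHom.range_comp, MonoidHom.range_eq_map]

/-- `C_P(Q)` lies in `Q` and `C_P(ξ(Q))` lies in `ξ(Q)`, so they are the centres of `Q` and of its
isomorphic image. Hence the extension axiom is available at every selfcentralizing subgroup. -/
theorem IsSc.fullyCentralized (hQ : F.IsSc Q) : F.FullyCentralized Q := by
  have hC : ∀ x ∈ Subgroup.centralizer (Q : Set P), x ∈ Q := by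
    intro x hx
    obtain ⟨u, rfl⟩ := hQ _ (F.isMor_subtype Q) x fun u =>
      (Subgroup.mem_centralizer_iff.1 hx u u.2).symm
    exact u.2
  intro ξ hξ
  have hr := (isMor_top_subtype hξ).restrict (le_sup_left : Q ≤ Q ⊔ Subgroup.centralizer (Q : Set P))
  ext y
  constructor
  · rintro ⟨_, ⟨x, hx, rfl⟩, rfl⟩
    rw [Subgroup.mem_centralizer_iff]
    rintro _ ⟨_, ⟨z, hz, rfl⟩, rfl⟩
    have : z * x = x * z := Subtype.ext (Subgroup.mem_centralizer_iff.1 hx _ hz)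
    change ((ξ z : P) * ξ x) = ξ x * ξ z
    rw [← Subgroup.coe_mul, ← Subgroup.coe_mul, ← map_mul, ← map_mul, this]
  · intro hy
    obtain ⟨u, hu⟩ := hQ _ hr y fun u => by
      refine (Subgroup.mem_centralizer_iff.1 hy _ ?_).symm
      exact ⟨_, ⟨⟨u, Subgroup.mem_sup_left u.2⟩, u.2, rfl⟩, rfl⟩
    refine ⟨_, ⟨⟨u, Subgroup.mem_sup_left u.2⟩, ?_, rfl⟩, hu⟩
    refine Subgroup.mem_centralizer_iff.2 fun v hv => ?_
    have := Subgroup.mem_centralizer_iff.1 hy _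
      ⟨_, ⟨⟨v, Subgroup.mem_sup_left hv⟩, hv, rfl⟩, rfl⟩
    rw [← hu] at this
    have h2 := hr.injective (a₁ := ⟨v, hv⟩ * u) (a₂ := u * ⟨v, hv⟩) (by
      rw [map_mul, map_mul]
      exact this)
    exact congrArg Subtype.val h2

end DivisibleCategory

namespace FrobeniusCategory

open DivisibleCategory

variable {p : ℕ} {P : Type u} [Group P] {F : FrobeniusCategory p P} {Q : Subgroup P}

theorem selfcentralizing_iff {Q : F.Obj} : F.selfcentralizing Q ↔ F.IsSc Q.carrier := by
  constructor
  · intro h f hf y hy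
    have := h _ hf (x := y) (by
      rw [imageUnder_self]
      refine Subgroup.mem_centralizer_iff.2 ?_
      rintro _ ⟨u, rfl⟩
      exact (hy u).symm)
    rw [imageUnder_self] at this
    obtain ⟨u, hu⟩ := this
    exact ⟨u, hu⟩
  · intro h φ hφ y hy
    rw [imageUnder_self] at hy ⊢
    obtain ⟨u, hu⟩ := h _ (isMor_top_subtype hφ) y fun u =>
      (Subgroup.mem_centralizer_iff.1 hy _ ⟨u, rfl⟩).symm
    exact ⟨u, hu⟩

theorem mem_normalizer_range [Finite P] {f : Q →* P} {n : P} (h : ∀ u, ∃ v, f v = n * f u * n⁻¹) :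
    n ∈ Subgroup.normalizer (f.range : Set P) := by
  have hle : f.range.map (MulAut.conj n).toMonoidHom ≤ f.range := by
    rintro _ ⟨_, ⟨u, rfl⟩, rfl⟩
    obtain ⟨v, hv⟩ := h u
    exact ⟨v, hv⟩
  have heq : f.range.map (MulAut.conj n).toMonoidHom = f.range :=
    Subgroup.eq_of_le_of_card_ge hle
      (Nat.card_congr (f.range.equivMapOfInjective _ (MulAut.conj n).injective).toEquiv).le
  rw [Subgroup.mem_normalizer_iff]
  intro y
  constructor
  · intro hy
    rw [← heq]
    exact ⟨y, hy, rfl⟩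
  · intro hy
    rw [← heq] at hy
    obtain ⟨y', hym, e⟩ := hy
    rwa [(MulAut.conj n).injective e] at hym

/-- The extension of a morphism from a selfcentralizing subgroup to a subgroup in which it is
normal. -/
theorem exists_isMor_extension [Finite P] (hQ : F.IsSc Q) {f f' : Q →* P} (hf : F.IsMor f)
    (hf' : F.IsMor f') {N : Subgroup P} (hN : ∀ u, f u ∈ N)
    (hn : ∀ n ∈ N, ∀ u, ∃ v, f v = n * f u * n⁻¹)
    (hx : ∀ n ∈ N, ∃ n', ∀ u v, f v = n * f u * n⁻¹ → f' v = n' * f' u * n'⁻¹) :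
    ∃ ψ : N →* P, F.IsMor ψ ∧ ∀ u, ψ ⟨f u, hN u⟩ = f' u := by
  obtain ⟨g, hg, hgf⟩ := hf'.exists_inv
  have hgmem : ∀ u, g u ∈ Q := by
    rintro ⟨_, u, rfl⟩
    exact (hgf u ⟨u, rfl⟩).symm ▸ u.2
  -- The extension axiom is applied to the subgroup `f'(Q)` and the morphism `f ∘ f'⁻¹`, so that the
  -- map it provides on `N` sends `f u` to `f' u`.
  have hφ := hg.comp hf hgmem
  have hφf : ∀ u h, (f.comp (g.codRestrict Q hgmem)) ⟨f' u, h⟩ = f u := by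
    intro u h
    exact congrArg f (Subtype.ext (hgf u h))
  have him : Subgroup.imageUnder ((f.comp (g.codRestrict Q hgmem)).codRestrict (⊤ : Subgroup P)
      (fun _ => trivial)) f'.range = f.range := by
    rw [imageUnder_self]
    ext y
    constructor
    · rintro ⟨⟨_, u, rfl⟩, rfl⟩
      exact ⟨u, (hφf u _).symm⟩
    · rintro ⟨u, rfl⟩
      exact ⟨⟨f' u, u, rfl⟩, hφf u _⟩
  obtain ⟨ζ, hζ, h⟩ := F.extension f'.range (hQ.range hf').fullyCentralized _ hφ N
    (by
      rw [him]
      rintro _ ⟨u, rfl⟩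
      exact hN u)
    (by
      rw [him]
      exact fun n hnN => mem_normalizer_range (hn n hnN))
    (fun n hnN => by
      obtain ⟨n', hn'⟩ := hx n hnN
      have hnn : n' ∈ Subgroup.normalizer (f'.range : Set P) := by
        refine mem_normalizer_range fun u => ?_
        obtain ⟨v, hv⟩ := hn n hnN u
        exact ⟨v, hn' u v hv⟩
      refine ⟨n', hnn, ?_⟩
      rintro ⟨_, u, rfl⟩ ⟨_, v, rfl⟩ e
      obtain ⟨v', hv'⟩ := hn n hnN u
      have := hf'.injective ((hn' u v' hv').trans e.symm)
      subst this
      exact (hφf _ _).trans (hv'.trans (congrArg (fun t => n * t * n⁻¹) (hφf u _).symm)))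
  exact ⟨_, isMor_top_subtype hζ, fun u => h ⟨f' u, u, rfl⟩ ⟨f u, hN u⟩ (hφf u _).symm⟩

end FrobeniusCategory

/-! ### Realization of `p`-groups of automorphisms by conjugation in `P`. -/

namespace FrobeniusCategory

open DivisibleCategory

variable {p : ℕ} {P : Type u} [Group P] {F : FrobeniusCategory p P} {Q : Subgroup P}

theorem mul_of_conj {f : Q →* P} {a b : MulAut Q} {x y : P} (hx : ∀ u, f (a u) = x * f u * x⁻¹)
    (hy : ∀ u, f (b u) = y * f u * y⁻¹) (u : Q) : f ((a * b) u) = (x * y) * f u * (x * y)⁻¹ := by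
  rw [MulAut.mul_apply, hx, hy]
  group

theorem pow_of_conj {f : Q →* P} {a : MulAut Q} {x : P} (hx : ∀ u, f (a u) = x * f u * x⁻¹)
    (n : ℕ) (u : Q) : f ((a ^ n) u) = x ^ n * f u * (x ^ n)⁻¹ := by
  induction n generalizing u with
  | zero => simp
  | succ n ih => rw [pow_succ, pow_succ]; exact mul_of_conj ih hx u

/-- The automorphisms of `Q` induced by the conjugation in `P`, along a morphism `f`. -/
def conjStab (F : FrobeniusCategory p P) (f : Q →* P) : Subgroup (F.autGroup Q) where
  carrier := {a | ∃ x, ∀ u, f (a.1 u) = x * f u * x⁻¹}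
  one_mem' := ⟨1, fun u => by simp⟩
  mul_mem' := by
    rintro a b ⟨x, hx⟩ ⟨y, hy⟩
    exact ⟨x * y, mul_of_conj hx hy⟩
  inv_mem' := by
    rintro a ⟨x, hx⟩
    refine ⟨x⁻¹, fun u => ?_⟩
    have h : a.1 ((a⁻¹).1 u) = u := MulEquiv.apply_symm_apply a.1 u
    have := hx ((a⁻¹).1 u)
    rw [h] at this
    rw [this]
    group

theorem isPGroup_of_conj (hP : IsPGroup p P) {f : Q →* P} (hf : Function.Injective f)
    (A : Subgroup (F.autGroup Q)) (h : A ≤ conjStab F f) : IsPGroup p A := by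
  rintro ⟨a, ha⟩
  obtain ⟨x, hx⟩ := h ha
  obtain ⟨n, hn⟩ := hP x
  refine ⟨n, Subtype.ext (Subtype.ext (MulEquiv.ext fun u => hf ?_))⟩
  refine (pow_of_conj hx (p ^ n) u).trans ?_
  rw [hn]
  simp

theorem exists_normalizing {G : Type*} [Group G] [Finite G] [Fact p.Prime] {S T : Subgroup G}
    (hT : IsPGroup p T) (h : S ≤ T) (h' : ¬ T ≤ S) :
    ∃ g ∈ T, (∀ a ∈ S, g * a * g⁻¹ ∈ S) ∧ g ∉ S := by
  have := hT.isNilpotent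
  have hlt : S.subgroupOf T < ⊤ := lt_top_iff_ne_top.2 fun e => h' (Subgroup.subgroupOf_eq_top.1 e)
  obtain ⟨g, hg, hgS⟩ := SetLike.exists_of_lt (Group.normalizerCondition_of_isNilpotent _ hlt)
  exact ⟨g, g.2, fun a ha => (Subgroup.mem_normalizer_iff.1 hg ⟨a, h ha⟩).1 ha, hgS⟩

theorem card_lt_card_of_lt {G : Type*} [Group G] [Finite G] {S T : Subgroup G} (h : S < T) :
    Nat.card S < Nat.card T :=
  lt_of_not_ge fun hc => h.ne (Subgroup.eq_of_le_of_card_ge h.le hc)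

theorem isPGroup_zpowers {G : Type*} [Group G] {g : G} {n : ℕ} (h : g ^ p ^ n = 1) :
    IsPGroup p (Subgroup.zpowers g) := by
  rintro ⟨_, m, rfl⟩
  refine ⟨n, Subtype.ext ?_⟩
  change (g ^ m) ^ p ^ n = 1
  rw [← zpow_natCast, zpow_comm, zpow_natCast, h, one_zpow]

/-- A power of an element has `p`-power order and fixes given elements of `p`-power order. -/
theorem exists_pow_pPart (hp : p.Prime) {n : ℕ} (hn : 0 < n) (a : ℕ) :
    ∃ e b, n ∣ e * p ^ b ∧ e ≡ 1 [MOD p ^ a] := by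
  obtain ⟨b, m, hm, rfl⟩ := Nat.exists_eq_pow_mul_and_not_dvd hn.ne' p hp.ne_one
  have hc : Nat.Coprime (p ^ a) m := Nat.Coprime.pow_left _ ((Nat.Prime.coprime_iff_not_dvd hp).2 hm)
  obtain ⟨e, he, he'⟩ := Nat.chineseRemainder hc 1 0
  refine ⟨e, b, ?_, he⟩
  rw [mul_comm (p ^ b)]
  exact mul_dvd_mul ((Nat.modEq_zero_iff_dvd).1 he') dvd_rfl

/-- By Sylow's theorem some `g` conjugates `A` into the group `S` realized along `f`; then `f ∘ g`
realizes `A`. -/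
theorem exists_conj_of_conjStab_sylow [Finite P] [Fact p.Prime] {f : Q →* P} (hf : F.IsMor f)
    (S : Sylow p (F.autGroup Q)) (hS : (S : Subgroup (F.autGroup Q)) ≤ conjStab F f)
    (A : Subgroup (F.autGroup Q)) (hA : IsPGroup p A) :
    ∃ ρ : Q →* P, F.IsMor ρ ∧ A ≤ conjStab F ρ := by
  obtain ⟨T, hT⟩ := hA.exists_le_sylow
  obtain ⟨g, hg⟩ := MulAction.exists_smul_eq (F.autGroup Q) T S
  refine ⟨f.comp g.1.toMonoidHom, hf.comp_mulAut g.2, fun a ha => ?_⟩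
  have h1 : g * a * g⁻¹ ∈ (S : Subgroup (F.autGroup Q)) := by
    rw [← hg]
    exact ⟨a, hT ha, rfl⟩
  obtain ⟨x, hx⟩ := hS h1
  refine ⟨x, fun u => ?_⟩
  have := hx (g.1 u)
  refine Eq.trans ?_ this
  change f (g.1 (a.1 u)) = f (g.1 (a.1 (g.1⁻¹ (g.1 u))))
  rw [MulAut.inv_apply_self]

theorem exists_conj_top [Finite P] [Fact p.Prime] (A : Subgroup (F.autGroup ⊤)) (hA : IsPGroup p A) :
    ∃ ρ : (⊤ : Subgroup P) →* P, F.IsMor ρ ∧ A ≤ conjStab F ρ := by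
  obtain ⟨S, hS⟩ := F.sylow
  refine exists_conj_of_conjStab_sylow (F.isMor_subtype ⊤) S ?_ A hA
  rw [hS]
  rintro ⟨_, -⟩ ⟨x, rfl⟩
  exact ⟨x, fun u => rfl⟩

/-- The automorphism of `Q` determined by an element that normalizes its image. -/
theorem exists_mulAut_of_normalizer [Finite P] {f : Q →* P} (hf : F.IsMor f) {n : P}
    (hn : n ∈ Subgroup.normalizer (f.range : Set P)) :
    ∃ a ∈ F.autGroup Q, ∀ u, f (a u) = n * f u * n⁻¹ := by
  refine hf.exists_mulAut (hf.conj n) ?_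
  refine Subgroup.eq_of_le_of_card_ge ?_ ?_
  · rintro _ ⟨u, rfl⟩
    exact (Subgroup.mem_normalizer_iff.1 hn (f u)).1 ⟨u, rfl⟩
  · exact ((Nat.card_congr (MonoidHom.ofInjective hf.injective).toEquiv).symm.trans
      (Nat.card_congr (MonoidHom.ofInjective (hf.conj n).injective).toEquiv)).le

theorem lt_normalizer [Finite P] [Fact p.Prime] (hP : IsPGroup p P) {D : Subgroup P} (h : D < ⊤) :
    D < Subgroup.normalizer (D : Set P) := by
  have := hP.isNilpotent
  exact Group.normalizerCondition_of_isNilpotent D h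

/-- The `p`-subgroups of automorphisms of a selfcentralizing subgroup are realized by
conjugation in `P`, along a suitable morphism. -/
theorem exists_conj [Finite P] [Fact p.Prime] (hP : IsPGroup p P) (hQ : F.IsSc Q)
    (A : Subgroup (F.autGroup Q)) (hA : IsPGroup p A) :
    ∃ ρ : Q →* P, F.IsMor ρ ∧ A ≤ conjStab F ρ := by
  induction hd : Nat.card P - Nat.card Q using Nat.strong_induction_on generalizing Q with
  | _ d ih =>
  subst hd
  have hp : p.Prime := Fact.out
  by_cases htop : Q = ⊤
  · subst htop
    exact exists_conj_top A hA
  have hcard : Nat.card Q < Nat.card P :=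
    lt_of_le_of_ne (Subgroup.card_le_card_group Q) fun h => htop (Subgroup.eq_top_of_card_eq Q h)
  -- a morphism whose image has a normalizer of maximal order
  obtain ⟨f, hf, hmax⟩ : ∃ f : Q →* P, F.IsMor f ∧ ∀ f' : Q →* P, F.IsMor f' →
      Nat.card (Subgroup.normalizer (f'.range : Set P)) ≤
        Nat.card (Subgroup.normalizer (f.range : Set P)) := by
    have hfin : Finite {f : Q →* P // F.IsMor f} := by
      have : Finite (Q →* P) := Finite.of_injective _ DFunLike.coe_injective
      infer_instance
    have : Nonempty {f : Q →* P // F.IsMor f} := ⟨⟨_, F.isMor_subtype Q⟩⟩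
    obtain ⟨⟨f, hf⟩, h⟩ := Finite.exists_max (fun f : {f : Q →* P // F.IsMor f} =>
      Nat.card (Subgroup.normalizer (f.1.range : Set P)))
    exact ⟨f, hf, fun f' hf' => h ⟨f', hf'⟩⟩
  have hSp : IsPGroup p (conjStab F f) := isPGroup_of_conj hP hf.injective _ le_rfl
  obtain ⟨T, hT⟩ := hSp.exists_le_sylow
  refine exists_conj_of_conjStab_sylow hf T ?_ A hA
  -- It suffices that `conjStab F f` is a Sylow subgroup. Otherwise it is properly contained in the
  -- Sylow subgroup `T`, where normalizers grow.
  by_contra hTS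
  -- an automorphism that normalizes `conjStab F f`
  obtain ⟨g, hgT, hgn, hgS⟩ : ∃ g ∈ (T : Subgroup (F.autGroup Q)),
      (∀ a ∈ conjStab F f, g * a * g⁻¹ ∈ conjStab F f) ∧ g ∉ conjStab F f :=
    exists_normalizing T.2 hT hTS
  set N := Subgroup.normalizer (f.range : Set P) with hN
  have hfN : ∀ u, f u ∈ N := fun u => Subgroup.le_normalizer ⟨u, rfl⟩
  -- its extension to the normalizer
  obtain ⟨ψ, hψ, hψg⟩ : ∃ ψ : N →* P, F.IsMor ψ ∧ ∀ u, ψ ⟨f u, hfN u⟩ = f (g.1 u) := by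
    refine exists_isMor_extension hQ hf (hf.comp_mulAut g.2) hfN (fun n hn u => ?_) (fun n hn => ?_)
    · obtain ⟨a, -, ha⟩ := exists_mulAut_of_normalizer hf hn
      exact ⟨a u, ha u⟩
    · obtain ⟨a, ha', ha⟩ := exists_mulAut_of_normalizer hf hn
      obtain ⟨n', hn'⟩ := hgn ⟨a, ha'⟩ ⟨n, ha⟩
      refine ⟨n', fun u v huv => ?_⟩
      have : v = a u := hf.injective (huv.trans (ha u).symm)
      subst this
      refine Eq.trans ?_ (hn' (g.1 u))
      change f (g.1 (a u)) = f (g.1 (a (g.1⁻¹ (g.1 u))))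
      rw [MulAut.inv_apply_self]
  have hψN : ∀ x, ψ x ∈ N := by
    intro x
    refine mem_normalizer_range fun u => ?_
    obtain ⟨u, rfl⟩ : ∃ v, g.1 v = u := g.1.surjective u
    obtain ⟨a, -, ha⟩ := exists_mulAut_of_normalizer hf x.2
    refine ⟨g.1 (a u), ?_⟩
    rw [← hψg, ← hψg, ← map_inv, ← map_mul, ← map_mul]
    exact congrArg ψ (Subtype.ext (ha u))
  obtain ⟨ψ, hψF, hψ'⟩ : ∃ ψ' ∈ F.autGroup N, ∀ u, (ψ' u : P) = ψ u :=
    exists_mulAut_of_endo hψ hψN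
  have hψpow : ∀ n u, ((ψ ^ n) ⟨f u, hfN u⟩ : N) = ⟨f ((g.1 ^ n) u), hfN _⟩ := by
    intro n
    induction n with
    | zero => exact fun u => rfl
    | succ n ih =>
      intro u
      rw [pow_succ, MulAut.mul_apply, pow_succ, MulAut.mul_apply, ← ih]
      congr 1
      exact Subtype.ext ((hψ' _).trans (hψg u))
  -- its `p`-part
  obtain ⟨a, ha⟩ := T.2 ⟨g, hgT⟩
  have hga : g.1 ^ p ^ a = 1 := congrArg (fun t => t.1.1) ha
  have : Finite (MulAut N) := Finite.of_injective _ DFunLike.coe_injective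
  obtain ⟨e, b, hb, he⟩ := exists_pow_pPart hp (orderOf_pos ψ) a
  have hge : g.1 ^ e = g.1 :=
    (pow_eq_pow_of_modEq he hga).trans (pow_one _)
  have hfQ : Nat.card Q = Nat.card f.range :=
    Nat.card_congr (MonoidHom.ofInjective hf.injective).toEquiv
  have hNQ : Nat.card Q < Nat.card N := by
    rw [hfQ]
    refine card_lt_card_of_lt (lt_normalizer hP (lt_top_iff_ne_top.2 fun h => ?_))
    rw [hfQ, h, Subgroup.card_top] at hcard
    exact hcard.false
  have hNP : Nat.card N ≤ Nat.card P := Subgroup.card_le_card_group N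
  have hNsc : F.IsSc N := (hQ.range hf).mono Subgroup.le_normalizer
  have hpow : IsPGroup p (Subgroup.zpowers (⟨ψ ^ e, pow_mem hψF e⟩ : F.autGroup N)) := by
    refine isPGroup_zpowers (n := b) (Subtype.ext ?_)
    change (ψ ^ e) ^ p ^ b = 1
    rw [← pow_mul]
    exact orderOf_dvd_iff_pow_eq_one.1 hb
  -- The exponent `e` makes `ψ ^ e` of `p`-power order while it still restricts to `g` on the image
  -- of `Q`. The induction hypothesis applies as `N` is larger than `Q`, and `ψ ^ e` becomes
  -- conjugation by `x`.
  obtain ⟨ρ, hρ, hle⟩ := ih _ (by omega) hNsc _ hpow rfl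
  obtain ⟨x, hx⟩ := hle (Subgroup.mem_zpowers _)
  have hx' : ∀ u, ρ ⟨f (g.1 u), hfN _⟩ = x * ρ ⟨f u, hfN u⟩ * x⁻¹ := by
    intro u
    have := hx ⟨f u, hfN u⟩
    rwa [hψpow, hge] at this
  -- `ρ(N)` normalizes `ρ(f(Q))`, and by the maximal choice of `f` it is the full normalizer, which
  -- contains `x`. Thus `g` is conjugation by an element of `N` along `f`, a contradiction.
  obtain ⟨n, hn⟩ : ∃ n, ρ n = x := by
    have hf' := hf.comp hρ hfN
    have h1 : ρ.range ≤ Subgroup.normalizer ((ρ.comp (f.codRestrict N hfN)).range : Set P) := by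
      rintro _ ⟨n, rfl⟩
      refine mem_normalizer_range fun u => ?_
      obtain ⟨a, -, ha⟩ := exists_mulAut_of_normalizer hf n.2
      refine ⟨a u, ?_⟩
      change ρ _ = ρ n * ρ _ * (ρ n)⁻¹
      rw [← map_inv, ← map_mul, ← map_mul]
      exact congrArg ρ (Subtype.ext (ha u))
    have h2 := Subgroup.eq_of_le_of_card_ge h1 ((hmax _ hf').trans
      (Nat.card_congr (MonoidHom.ofInjective hρ.injective).toEquiv).le)
    have h3 : x ∈ ρ.range := by
      rw [h2]
      exact mem_normalizer_range fun u => ⟨g.1 u, hx' u⟩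
    exact h3
  refine hgS ⟨n, fun u => ?_⟩
  have := hx' u
  rw [← hn, ← map_inv, ← map_mul, ← map_mul] at this
  exact congrArg Subtype.val (hρ.injective this)

theorem mul_eq_of_conj_eq {G : Type*} [Group G] {a b t : G} (h : b * t * b⁻¹ = a * t * a⁻¹) :
    a⁻¹ * b * t = t * (a⁻¹ * b) :=
  calc a⁻¹ * b * t = a⁻¹ * (b * t * b⁻¹) * b := by group
    _ = t * (a⁻¹ * b) := by rw [h]; group

/-- Write `f' = f ∘ g` with `g` an automorphism of `N` fixing `D` pointwise. Both morphisms induce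
the same conjugations on the image of `D`, so `g x = x * z` with `z` in `D`, and `g` has `p`-power
order. It is therefore realized by conjugation, along some `ρ`, by an element centralizing `ρ(D)`;
this element lies in `ρ(D)`, and `g` is inner. -/
theorem exists_eq_conj_of_normal [Finite P] [Fact p.Prime] (hP : IsPGroup p P) {D N : Subgroup P}
    (hD : F.IsSc D) (hDN : D ≤ N) (hn : ∀ n ∈ N, ∀ d ∈ D, n * d * n⁻¹ ∈ D) {f f' : N →* P}
    (hf : F.IsMor f) (hf' : F.IsMor f') (h : ∀ x : N, (x : P) ∈ D → f' x = f x) :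
    ∃ d : N, ∀ x, f' x = f (d * x * d⁻¹) := by
  have hres := hf.restrict hDN
  have hmul : ∀ x : N, ∃ z : N, (z : P) ∈ D ∧ f' x = f (x * z) := by
    intro x
    obtain ⟨z, hz⟩ := hD _ hres ((f x)⁻¹ * f' x) fun u => by
      have e : f' (x * Subgroup.inclusion hDN u * x⁻¹) = f (x * Subgroup.inclusion hDN u * x⁻¹) :=
        h _ (hn x x.2 u u.2)
      have e' : f' (Subgroup.inclusion hDN u) = f (Subgroup.inclusion hDN u) := h _ u.2
      rw [map_mul, map_mul, map_mul, map_mul, map_inv, map_inv, e'] at e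
      change (f x)⁻¹ * f' x * f (Subgroup.inclusion hDN u) =
        f (Subgroup.inclusion hDN u) * ((f x)⁻¹ * f' x)
      exact mul_eq_of_conj_eq e
    refine ⟨Subgroup.inclusion hDN z, z.2, ?_⟩
    rw [map_mul]
    exact (inv_mul_eq_iff_eq_mul.1 hz.symm)
  obtain ⟨g, hg, hgf⟩ : ∃ a ∈ F.autGroup N, ∀ u, f (a u) = f' u := by
    refine hf.exists_mulAut hf' (Subgroup.eq_of_le_of_card_ge ?_ ?_)
    · rintro _ ⟨x, rfl⟩
      obtain ⟨z, -, hz⟩ := hmul x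
      exact ⟨_, hz.symm⟩
    · exact ((Nat.card_congr (MonoidHom.ofInjective hf.injective).toEquiv).symm.trans
        (Nat.card_congr (MonoidHom.ofInjective hf'.injective).toEquiv)).le
  have hgD : ∀ x : N, (x : P) ∈ D → g x = x := fun x hx => hf.injective ((hgf x).trans (h x hx))
  -- As `z` lies in `D`, it is fixed by `g`, so powers of `g` multiply `x` by powers of `z`.
  have hpow : ∀ x, ∃ z : N, ∀ n, (g ^ n) x = x * z ^ n := by
    intro x
    obtain ⟨z, hzD, hz⟩ := hmul x
    refine ⟨z, fun n => ?_⟩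
    induction n with
    | zero => simp
    | succ n ih =>
      rw [pow_succ', MulAut.mul_apply, ih, map_mul, map_pow, hgD z hzD,
        hf.injective ((hgf x).trans hz), pow_succ', mul_assoc]
  obtain ⟨n, hcard⟩ := IsPGroup.iff_card.1 hP
  have hgp : g ^ p ^ n = 1 := by
    refine MulEquiv.ext fun x => ?_
    obtain ⟨z, hz⟩ := hpow x
    have hz1 : z ^ p ^ n = 1 := by
      refine Subtype.ext ?_
      rw [← hcard]
      exact pow_card_eq_one'
    rw [hz, hz1, mul_one]
    rfl
  obtain ⟨ρ, hρ, hle⟩ := exists_conj hP (hD.mono hDN)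
    (Subgroup.zpowers (⟨g, hg⟩ : F.autGroup N)) (isPGroup_zpowers (Subtype.ext hgp))
  obtain ⟨y, hy⟩ := hle (Subgroup.mem_zpowers _)
  obtain ⟨d, rfl⟩ := hD _ (hρ.restrict hDN) y fun u => by
    have := hy (Subgroup.inclusion hDN u)
    rw [hgD _ u.2] at this
    exact (eq_mul_inv_iff_mul_eq.1 this).symm
  refine ⟨Subgroup.inclusion hDN d, fun x => ?_⟩
  rw [← hgf]
  refine congrArg f (hρ.injective ((hy x).trans ?_))
  rw [map_mul, map_mul, map_inv]
  rfl

/-- Two morphisms which coincide on a selfcentralizing subgroup are conjugate. -/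
theorem exists_eq_conj [Finite P] [Fact p.Prime] (hP : IsPGroup p P) {D N : Subgroup P}
    (hD : F.IsSc D) (hDN : D ≤ N) {f f' : N →* P}
    (hf : F.IsMor f) (hf' : F.IsMor f') (h : ∀ x : N, (x : P) ∈ D → f' x = f x) :
    ∃ d : N, ∀ x, f' x = f (d * x * d⁻¹) := by
  induction hd : Nat.card P - Nat.card D using Nat.strong_induction_on generalizing D f with
  | _ d ih =>
  subst hd
  by_cases hND : N ≤ D
  · exact ⟨1, fun x => by simpa using h x (hND x.2)⟩
  -- The subgroup of agreement is enlarged to the normalizer of `D` in `N`, which is strictly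
  -- larger; after correcting `f` by an inner automorphism of `N`, the morphisms agree there.
  let E := N ⊓ Subgroup.normalizer (D : Set P)
  have hDE : D ≤ E := le_inf hDN Subgroup.le_normalizer
  have hlt : D < E := by
    refine lt_of_le_of_ne hDE fun e => ?_
    obtain ⟨g, hgN, hg, hgD⟩ := exists_normalizing (hP.to_subgroup N) hDN hND
    refine hgD (e ▸ ⟨hgN, ?_⟩)
    have := mem_normalizer_range (f := D.subtype) (n := g) fun u => ⟨⟨_, hg u u.2⟩, rfl⟩
    rwa [Subgroup.range_subtype] at this
  obtain ⟨d, hd⟩ := exists_eq_conj_of_normal hP hD hDE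
    (fun n hn d hd => (Subgroup.mem_normalizer_iff.1 hn.2 d).1 hd)
    (hf.restrict inf_le_left) (hf'.restrict inf_le_left) fun x hx => h _ hx
  let d' : N := Subgroup.inclusion inf_le_left d
  have hf2 : F.IsMor (f.comp (MulAut.conj d').toMonoidHom) := by
    have := hf.conj (f d')
    have e : (MulAut.conj (f d')).toMonoidHom.comp f = f.comp (MulAut.conj d').toMonoidHom := by
      ext x
      simp
    rwa [e] at this
  obtain ⟨c, hc⟩ := ih _ (Nat.sub_lt_sub_left (lt_of_lt_of_le (card_lt_card_of_lt hlt)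
      (Subgroup.card_le_card_group E)) (card_lt_card_of_lt hlt)) (hD.mono hDE) inf_le_left hf2
    (fun x hx => hd ⟨x, hx⟩) rfl
  refine ⟨d' * c, fun x => (hc x).trans ?_⟩
  change f (d' * (c * x * c⁻¹) * d'⁻¹) = _
  congr 1
  group

end FrobeniusCategory

/-! ## The exterior quotient of the category of selfcentralizing subgroups -/

namespace FrobeniusCategory

open DivisibleCategory

variable {p : ℕ} {P : Type u} [Group P] {F : FrobeniusCategory p P}

namespace Sc

/-- The underlying subgroup. -/
abbrev grp (Q : F.Sc) : Subgroup P := Q.obj.carrier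

variable {Q R T : F.Sc}

theorem isSc (Q : F.Sc) : F.IsSc Q.grp := selfcentralizing_iff.1 Q.property

/-- The object on a subgroup which contains the image of a selfcentralizing subgroup. -/
def above (Q : F.Sc) (f : Q.grp →* P) (hf : F.IsMor f) (N : Subgroup P) (h : ∀ u, f u ∈ N) : F.Sc :=
  ⟨⟨N⟩, selfcentralizing_iff.2 ((Q.isSc.range hf).mono (by
    rintro _ ⟨u, rfl⟩
    exact h u))⟩

/-- A morphism as a homomorphism to `P`. -/
def toP (φ : Q ⟶ R) : Q.grp →* P := R.grp.subtype.comp φ.hom.1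

theorem isMor_toP (φ : Q ⟶ R) : F.IsMor (toP φ) := mor_iff.1 φ.hom.2

theorem toP_mem (φ : Q ⟶ R) (u : Q.grp) : toP φ u ∈ R.grp := (φ.hom.1 u).2

theorem toP_ext {φ ψ : Q ⟶ R} (h : ∀ u, toP φ u = toP ψ u) : φ = ψ :=
  ObjectProperty.hom_ext _ (Subtype.ext (MonoidHom.ext fun u => Subtype.ext (h u)))

theorem toP_comp (φ : Q ⟶ R) (ψ : R ⟶ T) (u : Q.grp) :
    toP (φ ≫ ψ) u = toP ψ ⟨toP φ u, toP_mem φ u⟩ := rfl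

theorem toP_id (u : Q.grp) : toP (𝟙 Q) u = u := rfl

/-- The morphism given by a homomorphism to `P`. -/
def ofMor (f : Q.grp →* P) (hf : F.IsMor f) (h : ∀ u, f u ∈ R.grp) : Q ⟶ R :=
  ⟨⟨f.codRestrict R.grp h, mor_iff.2 hf⟩⟩

theorem isIso_of_surjective {φ : Q ⟶ R} (h : ∀ y ∈ R.grp, ∃ u, toP φ u = y) : IsIso φ := by
  obtain ⟨g, hg, hgf⟩ := (isMor_toP φ).exists_inv
  have hR : ∀ y : R.grp, R.grp.subtype y ∈ (toP φ).range := fun y => h y y.2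
  have hinv : ∀ u h, g ((R.grp.subtype.codRestrict _ hR) ⟨toP φ u, h⟩) = u := fun u _ => hgf u _
  have hm : ∀ y, (g.comp (R.grp.subtype.codRestrict _ hR)) y ∈ Q.grp := by
    rintro ⟨y, hy⟩
    obtain ⟨u, rfl⟩ := h y hy
    exact (hinv u hy).symm ▸ u.2
  refine ⟨ofMor _ ((F.isMor_subtype R.grp).comp hg hR) hm, toP_ext fun u => hinv u _,
    toP_ext ?_⟩
  rintro ⟨y, hy⟩
  obtain ⟨u, rfl⟩ := h y hy
  rw [toP_comp, toP_id]
  exact congrArg (toP φ) (Subtype.ext (hinv u hy))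

/-- The automorphism of the object determined by an automorphism of the subgroup. -/
def autHom (Q : F.Sc) : F.autGroup Q.grp →* Aut Q where
  toFun a :=
    { hom := ⟨⟨a.1.toMonoidHom, a.2⟩⟩
      inv := ⟨⟨(a⁻¹).1.toMonoidHom, (a⁻¹).2⟩⟩
      hom_inv_id := toP_ext fun u => congrArg Subtype.val (MulEquiv.symm_apply_apply a.1 u)
      inv_hom_id := toP_ext fun u => congrArg Subtype.val (MulEquiv.apply_symm_apply a.1 u) }
  map_one' := Aut.ext rfl
  map_mul' _ _ := Aut.ext rfl

theorem autHom_surjective (Q : F.Sc) : Function.Surjective (autHom Q) := by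
  intro b
  have h1 : ∀ u, toP b.inv ⟨toP b.hom u, toP_mem _ u⟩ = u := fun u =>
    congrArg (fun φ => toP φ u) b.hom_inv_id
  have h2 : ∀ u, toP b.hom ⟨toP b.inv u, toP_mem _ u⟩ = u := fun u =>
    congrArg (fun φ => toP φ u) b.inv_hom_id
  exact ⟨⟨{ b.hom.hom.1 with
    invFun := b.inv.hom.1
    left_inv := fun u => Subtype.ext (h1 u)
    right_inv := fun u => Subtype.ext (h2 u) }, b.hom.hom.2⟩, Aut.ext (toP_ext fun u => rfl)⟩

instance [Finite P] (Q : F.Sc) : Finite (Aut Q) := by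
  have : Finite (MulAut Q.grp) := Finite.of_injective _ DFunLike.coe_injective
  exact Finite.of_surjective _ (autHom_surjective Q)

end Sc

open Sc

/-- Two morphisms are equivalent if they differ by an inner automorphism of the target. -/
def extRel (F : FrobeniusCategory p P) : HomRel F.Sc := fun _ R φ ψ =>
  ∃ t ∈ R.grp, ∀ u, toP ψ u = t * toP φ u * t⁻¹

instance : Congruence F.extRel where
  equivalence :=
    { refl := fun φ => ⟨1, one_mem _, fun u => by simp⟩
      symm := by
        rintro φ ψ ⟨t, ht, h⟩
        exact ⟨t⁻¹, inv_mem ht, fun u => by rw [h]; group⟩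
      trans := by
        rintro φ ψ χ ⟨t, ht, h⟩ ⟨s, hs, h'⟩
        exact ⟨s * t, mul_mem hs ht, fun u => by rw [h', h]; group⟩ }
  comp_left := by
    rintro Q R T φ ψ ψ' ⟨t, ht, h⟩
    exact ⟨t, ht, fun u => h _⟩
  comp_right := by
    rintro Q R T φ φ' ψ ⟨t, ht, h⟩
    refine ⟨toP ψ ⟨t, ht⟩, toP_mem _ _, fun u => ?_⟩
    rw [toP_comp, toP_comp, ← map_inv, ← map_mul, ← map_mul]
    exact congrArg (toP ψ) (Subtype.ext (h u))

/-- The exterior quotient of `𝓕^sc`. -/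
abbrev Ext (F : FrobeniusCategory p P) := CategoryTheory.Quotient F.extRel

/-- The functor to the exterior quotient. -/
abbrev toExt (F : FrobeniusCategory p P) : F.Sc ⥤ F.Ext :=
  CategoryTheory.Quotient.functor F.extRel

variable {Q R T : F.Sc}

theorem toExt_eq_iff {φ ψ : Q ⟶ R} : F.toExt.map φ = F.toExt.map ψ ↔
    ∃ t ∈ R.grp, ∀ u, toP ψ u = t * toP φ u * t⁻¹ :=
  CategoryTheory.Quotient.functor_map_eq_iff F.extRel φ ψ

theorem mapAut_toExt_eq_one {a : F.autGroup Q.grp} : F.toExt.mapAut Q (autHom Q a) = 1 ↔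
    ∃ t ∈ Q.grp, ∀ u, (a.1 u : P) = t * u * t⁻¹ := by
  refine Iff.trans ⟨fun h => ?_, fun h => ?_⟩ (toExt_eq_iff (φ := 𝟙 Q) (ψ := (autHom Q a).hom))
  · exact ((congrArg Iso.hom h).trans (F.toExt.map_id Q).symm).symm
  · exact Aut.ext (h.symm.trans (F.toExt.map_id Q))

/-- The automorphism in the exterior quotient determined by an automorphism. -/
def extAut (Q : F.Sc) : F.autGroup Q.grp →* Aut (F.toExt.obj Q) :=
  (F.toExt.mapAut Q).comp (autHom Q)

theorem extAut_eq_one {a : F.autGroup Q.grp} : extAut Q a = 1 ↔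
    ∃ t ∈ Q.grp, ∀ u, (a.1 u : P) = t * u * t⁻¹ :=
  mapAut_toExt_eq_one

theorem mem_innGroup_iff {a : F.autGroup Q.grp} : a ∈ F.innGroup Q.grp ↔ extAut Q a = 1 := by
  rw [extAut_eq_one]
  constructor
  · rintro ⟨t, ht⟩
    refine ⟨t, t.2, fun u => ?_⟩
    have := DFunLike.congr_fun ht u
    exact congrArg Subtype.val this.symm
  · rintro ⟨t, ht, h⟩
    exact ⟨⟨t, ht⟩, MulEquiv.ext fun u => Subtype.ext (h u).symm⟩

theorem extAut_mem_autStab {a : F.autGroup Q.grp} {φ : Q ⟶ R} :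
    extAut Q a ∈ autStab (F.toExt.map φ) ↔
      ∃ r ∈ R.grp, ∀ u, toP φ (a.1 u) = r * toP φ u * r⁻¹ := by
  rw [mem_autStab']
  refine Iff.trans ⟨fun h => ?_, fun h => ?_⟩
    (toExt_eq_iff (φ := φ) (ψ := (autHom Q a).hom ≫ φ))
  · exact h.symm.trans (F.toExt.map_comp _ _).symm
  · exact ((F.toExt.map_comp _ _).symm.trans h.symm)

theorem isPGroup_ker_extAut (hP : IsPGroup p P) (Q : F.Sc) : IsPGroup p (extAut Q).ker := by
  refine isPGroup_of_conj hP (F.isMor_subtype Q.grp).injective _ fun a ha => ?_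
  obtain ⟨t, -, h⟩ := extAut_eq_one.1 ha
  exact ⟨t, h⟩

/-- If two composites with `φ` agree up to conjugation by `t`, then the second factors, after
conjugating one by `t`, coincide on the selfcentralizing image of `φ`. By `exists_eq_conj` they
differ by an inner automorphism of `Y`, whose image is inner in the target. -/
theorem epi_ext [Finite P] [Fact p.Prime] (hP : IsPGroup p P) {X Y : F.Ext} (f : X ⟶ Y) :
    Epi f := by
  refine ⟨fun {Z} g h e => ?_⟩
  obtain ⟨φ, rfl⟩ := F.toExt.map_surjective (X := X.as) (Y := Y.as) f
  obtain ⟨ψ, rfl⟩ := F.toExt.map_surjective (X := Y.as) (Y := Z.as) g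
  obtain ⟨ψ', rfl⟩ := F.toExt.map_surjective (X := Y.as) (Y := Z.as) h
  obtain ⟨t, ht, h⟩ := toExt_eq_iff.1 ((F.toExt.map_comp φ ψ).trans (e.trans
    (F.toExt.map_comp φ ψ').symm))
  obtain ⟨d, hd⟩ := exists_eq_conj hP (X.as.isSc.range (isMor_toP φ))
    (show (toP φ).range ≤ Y.as.grp by
      rintro _ ⟨u, rfl⟩
      exact toP_mem φ u) ((isMor_toP ψ).conj t) (isMor_toP ψ') (by
      rintro ⟨_, _⟩ ⟨u, rfl⟩
      exact h u)
  refine toExt_eq_iff.2 ⟨t * toP ψ d, mul_mem ht (toP_mem ψ d), fun u => (hd u).trans ?_⟩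
  change t * toP ψ (d * u * d⁻¹) * t⁻¹ = _
  rw [map_mul, map_mul, map_inv]
  group

theorem isPQuotient_toExt [Finite P] [Fact p.Prime] (hP : IsPGroup p P) :
    IsPQuotient p F.toExt where
  epi := epi_ext hP
  full := inferInstance
  exists_aut {Q R} φ ψ h := by
    obtain ⟨t, ht, h⟩ := toExt_eq_iff.1 h
    let a : F.autGroup R.grp := ⟨MulAut.conj ⟨t, ht⟩, F.conj_mem t _ fun u => rfl⟩
    exact ⟨autHom R a, mapAut_toExt_eq_one.2 ⟨t, ht, fun u => rfl⟩, toP_ext h⟩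
  isPGroup_ker Q := by
    rintro ⟨b, hb⟩
    obtain ⟨a, rfl⟩ := autHom_surjective Q b
    obtain ⟨n, hn⟩ := isPGroup_ker_extAut hP Q ⟨a, hb⟩
    refine ⟨n, Subtype.ext ?_⟩
    exact (map_pow (autHom Q) a _).symm.trans ((congrArg _ (congrArg Subtype.val hn)).trans
      (map_one _))
  finite_aut Q := inferInstance

theorem extAut_surjective [Finite P] [Fact p.Prime] (hP : IsPGroup p P) (Q : F.Sc) :
    Function.Surjective (extAut Q) :=
  ((isPQuotient_toExt hP).mapAut_surjective Q).comp (autHom_surjective Q)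

theorem isIso_toExt [Finite P] {φ : Q ⟶ R} (h : Nat.card R.grp ≤ Nat.card Q.grp) :
    IsIso (F.toExt.map φ) := by
  have hle : (toP φ).range ≤ R.grp := by
    rintro _ ⟨u, rfl⟩
    exact toP_mem φ u
  have heq := Subgroup.eq_of_le_of_card_ge hle (h.trans
    (Nat.card_congr (MonoidHom.ofInjective (isMor_toP φ).injective).toEquiv).le)
  have : IsIso φ := isIso_of_surjective fun y hy => by
    rw [← heq] at hy
    exact hy
  infer_instance

/-- The preimage of `W` in `𝓕(Q)` is a `p`-group, hence realized by conjugation along some `ρ`. The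
quotient is the group of all elements of `P` that induce, along `ρ`, automorphisms in this preimage;
morphisms stabilized by `W` factor through it by the extension axiom. -/
theorem exists_ext_quotient [Finite P] [Fact p.Prime] (hP : IsPGroup p P) (Q : F.Sc)
    (W : Subgroup (Aut (F.toExt.obj Q))) (hW : IsPGroup p W) :
    ∃ (N : F.Sc) (ν : Q ⟶ N), autStab (F.toExt.map ν) = W ∧
      ∀ {T : F.Sc} (χ : Q ⟶ T), W ≤ autStab (F.toExt.map χ) → ∃ ψ, ν ≫ ψ = χ := by
  obtain ⟨ρ, hρ, hle⟩ := exists_conj hP Q.isSc (W.comap (extAut Q))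
    (hW.comap_of_ker_isPGroup _ (isPGroup_ker_extAut hP Q))
  let N : Subgroup P :=
    { carrier := {x | ∃ a : F.autGroup Q.grp, extAut Q a ∈ W ∧ ∀ u, ρ (a.1 u) = x * ρ u * x⁻¹}
      one_mem' := ⟨1, by rw [map_one]; exact one_mem W, fun u => by simp⟩
      mul_mem' := by
        rintro x y ⟨a, ha, hx⟩ ⟨b, hb, hy⟩
        exact ⟨a * b, by rw [map_mul]; exact mul_mem ha hb, mul_of_conj hx hy⟩
      inv_mem' := by
        rintro x ⟨a, ha, hx⟩
        refine ⟨a⁻¹, by rw [map_inv]; exact inv_mem ha, fun u => ?_⟩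
        have h : a.1 ((a⁻¹).1 u) = u := MulEquiv.apply_symm_apply a.1 u
        have := hx ((a⁻¹).1 u)
        rw [h] at this
        rw [this]
        group }
  have hN : ∀ u, ρ u ∈ N := fun q => by
    have hq : MulAut.conj q ∈ F.autGroup Q.grp := F.conj_mem (q : P) _ fun u => rfl
    have hq1 : extAut Q ⟨MulAut.conj q, hq⟩ = 1 := extAut_eq_one.2 ⟨q, q.2, fun u => rfl⟩
    refine ⟨⟨MulAut.conj q, hq⟩, ?_, fun u => ?_⟩
    · rw [hq1]
      exact one_mem W
    · change ρ (q * u * q⁻¹) = _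
      rw [map_mul, map_mul, map_inv]
  refine ⟨Q.above ρ hρ N hN, ofMor ρ hρ hN, ?_, fun {T} χ hχ => ?_⟩
  · ext w
    obtain ⟨a, rfl⟩ := extAut_surjective hP Q w
    rw [extAut_mem_autStab]
    constructor
    · rintro ⟨x, ⟨a', ha', hx'⟩, hx⟩
      have : a = a' := Subtype.ext (MulEquiv.ext fun u => hρ.injective
        ((hx u).trans (hx' u).symm))
      rwa [this]
    · intro ha
      obtain ⟨x, hx⟩ := hle ha
      exact ⟨x, ⟨a, ha, hx⟩, hx⟩
  · have key : ∀ n ∈ N, ∃ n' ∈ T.grp, ∀ u v, ρ v = n * ρ u * n⁻¹ →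
        toP χ v = n' * toP χ u * n'⁻¹ := by
      rintro n ⟨a, ha, hn⟩
      obtain ⟨t, ht, h⟩ := extAut_mem_autStab.1 (hχ ha)
      refine ⟨t, ht, fun u v huv => ?_⟩
      have : v = a.1 u := hρ.injective (huv.trans (hn u).symm)
      rw [this, h]
    have hn : ∀ n ∈ N, ∀ u, ∃ v, ρ v = n * ρ u * n⁻¹ := by
      rintro n ⟨a, -, hn⟩ u
      exact ⟨_, hn u⟩
    obtain ⟨ψ, hψ, hψχ⟩ := exists_isMor_extension Q.isSc hρ (isMor_toP χ) hN hn
      fun n hn => (key n hn).imp fun n' h => h.2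
    -- `ψ n` and the element `n'` of `T` induce the same conjugation on the image of `χ`, so they
    -- differ by an element centralizing it, hence lying in it and so in `T`.
    have hψT : ∀ n : N, ψ n ∈ T.grp := by
      intro n
      obtain ⟨n', hn', h⟩ := key n n.2
      obtain ⟨u, hu⟩ := Q.isSc _ (isMor_toP χ) (n'⁻¹ * ψ n) fun u => by
        obtain ⟨v, hv⟩ := hn n n.2 u
        have e := h u v hv
        have e' : ψ ⟨ρ v, hN v⟩ = ψ (n * ⟨ρ u, hN u⟩ * n⁻¹) := congrArg ψ (Subtype.ext hv)
        rw [hψχ, map_mul, map_mul, map_inv, hψχ, e] at e'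
        exact mul_eq_of_conj_eq e'.symm
      have : ψ n = n' * toP χ u := by rw [hu]; group
      rw [this]
      exact mul_mem hn' (toP_mem χ u)
    exact ⟨ofMor (Q := Q.above ρ hρ N hN) ψ hψ hψT, toP_ext hψχ⟩

theorem isPGroup_autStab_toExt [Finite P] [Fact p.Prime] (hP : IsPGroup p P) (φ : Q ⟶ R) :
    IsPGroup p (autStab (F.toExt.map φ)) := by
  rintro ⟨w, hw⟩
  obtain ⟨a, rfl⟩ := extAut_surjective hP Q w
  obtain ⟨r, -, hr⟩ := extAut_mem_autStab.1 hw
  have := isPGroup_of_conj hP (isMor_toP φ).injective (Subgroup.zpowers a)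
    ((Subgroup.zpowers_le).2 ⟨r, hr⟩)
  obtain ⟨n, hn⟩ := this ⟨a, Subgroup.mem_zpowers a⟩
  refine ⟨n, Subtype.ext ?_⟩
  exact (map_pow (extAut Q) a _).symm.trans ((congrArg _ (congrArg Subtype.val hn)).trans
    (map_one _))

/-- If `φ` is not onto, some `n` in `R` outside `φ(Q)` normalizes it, and conjugation by `n` gives
an automorphism of `Q` stabilizing the class of `φ`. Were it inner, `n` would differ from an element
of `φ(Q)` by one centralizing `φ(Q)`, and so lie in `φ(Q)`. -/
theorem autStab_toExt_ne_bot [Finite P] [Fact p.Prime] (hP : IsPGroup p P) {φ : Q ⟶ R}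
    (h : ¬ IsIso (F.toExt.map φ)) : autStab (F.toExt.map φ) ≠ ⊥ := by
  have hle : (toP φ).range ≤ R.grp := by
    rintro _ ⟨u, rfl⟩
    exact toP_mem φ u
  have hnle : ¬ R.grp ≤ (toP φ).range := fun hle' => h (by
    have : IsIso φ := isIso_of_surjective fun y hy => hle' hy
    infer_instance)
  obtain ⟨n, hnR, hn, hnφ⟩ := exists_normalizing (hP.to_subgroup R.grp) hle hnle
  have hnn : n ∈ Subgroup.normalizer ((toP φ).range : Set P) :=
    mem_normalizer_range fun u => hn _ ⟨u, rfl⟩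
  obtain ⟨a, ha, h⟩ := exists_mulAut_of_normalizer (isMor_toP φ) hnn
  intro hbot
  have h1 : extAut Q ⟨a, ha⟩ ∈ autStab (F.toExt.map φ) := extAut_mem_autStab.2 ⟨n, hnR, h⟩
  rw [hbot] at h1
  obtain ⟨t, ht, hat⟩ := extAut_eq_one.1 (Subgroup.mem_bot.1 h1)
  refine hnφ ?_
  obtain ⟨u, hu⟩ := Q.isSc _ (isMor_toP φ) ((toP φ ⟨t, ht⟩)⁻¹ * n) fun u => by
    have e : a u = ⟨t, ht⟩ * u * ⟨t, ht⟩⁻¹ := Subtype.ext (hat u)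
    have := h u
    rw [e, map_mul, map_mul, map_inv] at this
    exact mul_eq_of_conj_eq this.symm
  exact ⟨⟨t, ht⟩ * u, by rw [map_mul, hu]; group⟩

/-- The kernel of the surjection `extAut` is the group of inner automorphisms, so a nontrivial
normal `p`-subgroup of `𝓕(Q)/𝓕_Q(Q)` has a nontrivial normal image in the automorphisms of the
exterior quotient. -/
theorem exists_normal_of_not_radical [Finite P] [Fact p.Prime] (hP : IsPGroup p P) (Q : F.Sc)
    (h : ¬ F.radical Q.obj) :
    ∃ O : Subgroup (Aut (F.toExt.obj Q)), O.Normal ∧ IsPGroup p O ∧ O ≠ ⊥ := by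
  have h1 : Subgroup.largestNormalPSubgroup p (F.autGroup Q.grp ⧸ F.innGroup Q.grp) ≠ ⊥ :=
    fun e => h ⟨Q.property, e⟩
  obtain ⟨N, ⟨hN, hNp⟩, hN1⟩ : ∃ N : Subgroup (F.autGroup Q.grp ⧸ F.innGroup Q.grp),
      (N.Normal ∧ IsPGroup p N) ∧ N ≠ ⊥ := by
    by_contra hcon
    push Not at hcon
    exact h1 (sSup_eq_bot.2 hcon)
  have hsurj := extAut_surjective hP Q
  refine ⟨(N.comap (QuotientGroup.mk' _)).map (extAut Q),
    Subgroup.Normal.map (hN.comap _) _ hsurj, ?_, ?_⟩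
  · rintro ⟨_, a, ha, rfl⟩
    obtain ⟨n, hn⟩ := hNp ⟨_, ha⟩
    refine ⟨n, Subtype.ext ?_⟩
    change extAut Q a ^ p ^ n = 1
    rw [← map_pow, ← mem_innGroup_iff]
    exact (QuotientGroup.eq_one_iff _).1 (congrArg Subtype.val hn)
  · intro hbot
    refine hN1 ((Subgroup.eq_bot_iff_forall _).2 fun x hx => ?_)
    induction x using QuotientGroup.induction_on with
    | H a =>
    have : extAut Q a ∈ (N.comap (QuotientGroup.mk' _)).map (extAut Q) := ⟨a, hx, rfl⟩
    rw [hbot] at this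
    exact (QuotientGroup.eq_one_iff a).2 (mem_innGroup_iff.2 (Subgroup.mem_bot.1 this))

theorem radicalFamily [Finite P] [Fact p.Prime] (hP : IsPGroup p P) :
    RadicalFamily p (fun R : F.Rd => F.toExt.obj (F.rdToSc.obj R)) where
  epi := epi_ext hP
  exists_quotient {Q} W hW := by
    obtain ⟨N, ν, h, h'⟩ := exists_ext_quotient hP Q.as W hW
    refine ⟨F.toExt.obj N, F.toExt.map ν, h, fun {T} χ hχ => ?_⟩
    obtain ⟨χ, rfl⟩ := F.toExt.map_surjective (X := Q.as) (Y := T.as) χ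
    obtain ⟨ψ, rfl⟩ := h' χ hχ
    exact ⟨F.toExt.map ψ, (F.toExt.map_comp _ _).symm⟩
  isPGroup_autStab {Q R} φ := by
    obtain ⟨φ, rfl⟩ := F.toExt.map_surjective (X := Q.as) (Y := R.as) φ
    exact isPGroup_autStab_toExt hP φ
  autStab_ne_bot {Q R} φ h := by
    obtain ⟨φ, rfl⟩ := F.toExt.map_surjective (X := Q.as) (Y := R.as) φ
    exact autStab_toExt_ne_bot hP h
  radical Q := by
    by_cases h : F.radical Q.as.obj
    · exact Or.inl ⟨⟨Q.as.obj, h⟩, rfl⟩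
    · exact Or.inr (exists_normal_of_not_radical hP Q.as h)
  rank := by
    refine ⟨fun Q => Nat.card Q.as.grp, Nat.card P, fun Q => Subgroup.card_le_card_group _,
      fun {Q R} φ h => ?_⟩
    obtain ⟨φ, rfl⟩ := F.toExt.map_surjective (X := Q.as) (Y := R.as) φ
    by_contra hlt
    exact h (isIso_toExt (not_lt.1 hlt))

end FrobeniusCategory

theorem IsPQuotient.comp_fullyFaithful {p : ℕ} {C₀ : Type u₃} [Category.{v} C₀] {C : Type u₁}
    [Category.{v₁} C] {𝓒 : Type u₂} [Category.{v₂} 𝓒] {G : C ⥤ 𝓒} (H : IsPQuotient p G)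
    (J : C₀ ⥤ C) [J.Full] [J.Faithful] : IsPQuotient p (J ⋙ G) where
  epi := H.epi
  full := by
    have := H.full
    infer_instance
  exists_aut {Q R} φ ψ h := by
    obtain ⟨u, hu, e⟩ := H.exists_aut (J.map φ) (J.map ψ) h
    have h2 : J.mapAut R (J.preimageIso u) = u := Aut.ext (J.map_preimage _)
    refine ⟨J.preimageIso u, (congrArg (G.mapAut _) h2).trans hu, J.map_injective ?_⟩
    rw [e, J.map_comp]
    exact congrArg (J.map φ ≫ ·) (congrArg Iso.hom h2).symm
  isPGroup_ker Q := by
    rintro ⟨a, ha⟩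
    obtain ⟨n, hn⟩ := H.isPGroup_ker (J.obj Q) ⟨J.mapAut Q a, ha⟩
    refine ⟨n, Subtype.ext (Aut.ext (J.map_injective ?_))⟩
    have h1 : J.mapAut Q (a ^ p ^ n) = 1 := (map_pow _ _ _).trans (congrArg Subtype.val hn)
    exact (congrArg Iso.hom h1).trans (J.map_id Q).symm
  finite_aut Q := by
    have := H.finite_aut (J.obj Q)
    refine Finite.of_injective (J.mapAut Q) fun a b h => Aut.ext (J.map_injective ?_)
    exact congrArg Iso.hom h

theorem Chain.finite_aut {C : Type u₁} [Category.{v₁} C] (h : ∀ Q : C, Finite (Aut Q))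
    (q : Chain C) : Finite (Aut q.functor) :=
  Finite.of_injective (fun σ (i : Fin (q.dim + 1)) => Chain.evalAut q i σ)
    fun _ _ h => Chain.aut_ext fun i => congrFun h i

/-! ## Strict extensions -/

/-- Injectivity of `K` on objects allows the values of `A` on its image to be replaced, along `η`,
by those of `B`, without conflict; the other values are kept. -/
theorem CategoryTheory.Functor.exists_iso_comp_eq {C : Type u₁} [Category.{v₁} C] {D : Type u₂}
    [Category.{v₂} D] {E : Type u₃} [Category.{v} E] (K : C ⥤ D)
    (hK : Function.Injective K.obj) (A : D ⥤ E) (B : C ⥤ E) (η : K ⋙ A ≅ B) :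
    ∃ (A' : D ⥤ E) (i : A ≅ A') (h : K ⋙ A' = B),
      Functor.whiskerLeft K i.inv ≫ η.hom = eqToHom h := by
  have key : ∀ d, ∃ (X : E) (i : A.obj d ≅ X), ∀ c (h : K.obj c = d), ∃ hX : X = B.obj c,
      i.hom ≫ eqToHom hX = eqToHom (congrArg A.obj h.symm) ≫ η.hom.app c := by
    intro d
    by_cases hd : ∃ c, K.obj c = d
    · obtain ⟨c, rfl⟩ := hd
      refine ⟨B.obj c, η.app c, fun c' h => ?_⟩
      obtain rfl := hK h
      exact ⟨rfl, by simp⟩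
    · exact ⟨_, Iso.refl _, fun c h => (hd ⟨c, h⟩).elim⟩
  choose X i hX hi using key
  have hη : ∀ c, η.hom.app c = (i (K.obj c)).hom ≫ eqToHom (hX _ c rfl) := fun c => by
    rw [hi _ c rfl]
    simp
  have hη' : ∀ c, η.inv.app c = eqToHom (hX _ c rfl).symm ≫ (i (K.obj c)).inv := fun c => by
    rw [← cancel_epi (η.hom.app c), Iso.hom_inv_id_app, hη]
    simp
  have h : K ⋙ A.copyObj X i = B := by
    refine CategoryTheory.Functor.ext (fun c => hX _ c rfl) fun c c' f => ?_
    have := η.hom.naturality f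
    change (i _).inv ≫ A.map (K.map f) ≫ (i _).hom = _
    have h2 : B.map f = η.inv.app c ≫ A.map (K.map f) ≫ η.hom.app c' := by
      rw [← Functor.comp_map, η.hom.naturality, Iso.inv_hom_id_app_assoc]
    rw [h2, hη, hη']
    simp only [Category.assoc, eqToHom_trans]
    exact ((eqToHom_trans_assoc _ _ _).trans ((Category.id_comp _).trans
      (congrArg (fun t => (i (K.obj c)).inv ≫ A.map (K.map f) ≫ t) (Category.comp_id _)))).symm
  refine ⟨A.copyObj X i, A.isoCopyObj X i, h, ?_⟩
  ext c
  rw [eqToHom_app]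
  change (i _).inv ≫ η.hom.app c = _
  rw [hη, Iso.inv_hom_id_assoc]
  rfl

namespace KStarLifting

variable {k : Type w} [Field k] {C : Type u₁} [Category.{v₁} C] {A : C ⥤ GrpCat.{u}}

theorem eq_of_natTrans_eq {L L' : KStarLifting.{w, u} k A} (f : L ⟶ L')
    (h : L.functor = L'.functor) (hf : Hom.nat f = eqToHom h) : L = L' := by
  obtain ⟨A₁, i⟩ := L
  obtain ⟨A₂, j⟩ := L'
  change A₁ = A₂ at h
  subst h
  have := KStarLifting.Hom.comm f
  rw [show Hom.natTrans f = _ from hf] at this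
  have h2 : j.hom = i.hom := by
    refine Eq.trans ?_ this
    simp
  rw [Iso.ext h2]

/-- A lifting isomorphic to a given one with an isomorphic functor. -/
theorem exists_hom_of_iso (L : KStarLifting.{w, u} k A) {B : C ⥤ KStarGrp.{w, u} k}
    (i : L.functor ≅ B) : ∃ (L' : KStarLifting.{w, u} k A) (f : L' ⟶ L) (h : L'.functor = B),
      Hom.nat f = eqToHom h ≫ i.inv :=
  ⟨⟨B, Functor.isoWhiskerRight i.symm _ ≪≫ L.iso⟩, KStarLifting.Hom.mk i.inv (by simp), rfl,
    (Category.id_comp _).symm⟩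

variable {D : Type u₂} [Category.{v₂} D]

/-- Since no two chains have the same image, a lifting extending `L` up to isomorphism can be
altered, objectwise, into one restricting to `L` exactly. -/
theorem exists_restrict_eq (J : C ⥤ D) (hJ : Function.Injective J.obj) {B : D ⥤ GrpCat.{u}}
    (e : J ⋙ B ≅ A) (L : KStarLifting.{w, u} k A) (L₁ : KStarLifting.{w, u} k B)
    (f : (restrict J e).obj L₁ ⟶ L) :
    ∃ (L' : KStarLifting.{w, u} k B), Nonempty (L' ⟶ L₁) ∧ (restrict J e).obj L' = L := by
  let η : J ⋙ L₁.functor ≅ L.functor :=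
    ⟨Hom.nat f, Hom.nat (inv f), congrArg Hom.nat (IsIso.hom_inv_id f),
      congrArg Hom.nat (IsIso.inv_hom_id f)⟩
  obtain ⟨A', i, h, hi⟩ := Functor.exists_iso_comp_eq J hJ L₁.functor L.functor η
  obtain ⟨L', g, rfl, hg⟩ := L₁.exists_hom_of_iso i
  refine ⟨L', ⟨g⟩, eq_of_natTrans_eq ((restrict J e).map g ≫ f) h (Eq.trans ?_ hi)⟩
  change Functor.whiskerLeft J (Hom.nat g) ≫ Hom.nat f = _
  rw [hg]
  simp [η]

end KStarLifting

theorem Chain.map_obj_injective {C : Type u₁} [Category.{v} C] {D : Type u₂} [Category.{v} D]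
    (G : C ⥤ D) [G.Full] [G.Faithful] (hG : Function.Injective G.obj) :
    Function.Injective (Chain.map G).obj := by
  rintro ⟨n, q⟩ ⟨n', q'⟩ h
  obtain rfl : n = n' := congrArg Chain.dim h
  have h2 : q ⋙ G = q' ⋙ G := by
    simpa using h
  refine congrArg (Chain.mk n) (CategoryTheory.Functor.ext
    (fun i => hG (Functor.congr_obj h2 i)) fun i j f => G.map_injective ?_)
  have := Functor.congr_hom h2 f
  simpa [eqToHom_map] using this

theorem theorem2p9 {p : ℕ} [Fact p.Prime] {P : Type u} [Group P] [Finite P] (hP : IsPGroup p P)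
    {k : Type w} [Field k] [IsAlgClosed k] [CharP k p] (F : FrobeniusCategory p P)
    (L : F.RadicalLifting k) :
    ∃ L' : F.Folding k, (F.restrictFolding k).obj L' = L ∧
      ∀ (L'' : F.Folding k)
        (α : (F.restrictFolding k).obj L'' ≅ (F.restrictFolding k).obj L'),
        ∃! β : L'' ≅ L', (F.restrictFolding k).mapIso β = α := by
  have H := FrobeniusCategory.isPQuotient_toExt (F := F) hP
  have H₀ := H.comp_fullyFaithful F.rdToSc
  obtain ⟨L₁, e, h⟩ := KTransport.exists_extension_of_lifting H H₀
    (FrobeniusCategory.radicalFamily hP) (Chain.finite_aut H₀.finite_aut)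
    (Chain.finite_aut H.finite_aut) L
  obtain ⟨L', ⟨j⟩, hL⟩ := KStarLifting.exists_restrict_eq (Chain.map F.rdToSc)
    (Chain.map_obj_injective _ fun Q R h => by
      have := congrArg ObjectProperty.FullSubcategory.obj h
      exact ObjectProperty.FullSubcategory.ext this) (Chain.mapAut F.rdToSc) L L₁ e
  refine ⟨L', hL, fun L'' α => ?_⟩
  -- The universal property concerns the lifting before strictification; `j` passes to it, and every
  -- morphism of liftings is invertible.
  obtain ⟨β, hβ, hu⟩ := h L'' (α.hom ≫ (F.restrictFolding k).map j ≫ e)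
  refine ⟨asIso (β ≫ inv j), Iso.ext ?_, fun β' hβ' => Iso.ext ?_⟩
  · rw [← cancel_mono ((F.restrictFolding k).map j ≫ e), ← hβ]
    simp
  · have := hu (β'.hom ≫ j) (by
      rw [← hβ']
      simp)
    simp [← this]
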